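/- \textbf{Setting.} A text $T[1..n]$ over an arbitrary alphabet is read letter by letter. A \emph{landmark scheme} for length $n$ consists of a last level $L$ with $2^L\le n$ and sizes $b_0,\dots,b_L\in\mathbb N\cup\{\infty\}$ with $b_0=\dots=b_{L-1}$. After reading $T[h]$, the \emph{landmarks} are the nonnegative numbers $2^\lambda(\lfloor h/2^\lambda\rfloor-i)$ with $0\le\lambda\le L$ and $0\le i<b_\lambda$. \emph{Running} the process $P(c)$ after reading $T[h]$ succeeds if $2c-h-2$ is a landmark and $T[(2c-h-1)..h]$ is a palindrome; it fails if $2c-h-2$ is a landmark and $T[(2c-h-1)..h]$ is not a palindrome, or if $2c-h-2<0$; otherwise it gives no information. (Fingerprint comparisons are assumed to have no false positives.) $P(c)$ is \emph{dead} once one of its runs has failed, and \emph{alive} otherwise. \textbf{Partition.} $T[1..h]$ is kept partitioned into segments whose lengths are powers of $2$, nonincreasing from left to right; for some $M$ there are between $3$ and $5$ segments of length $2^\ell$ for each $0\le\ell<M$, between $1$ and $5$ of length $2^M$, and no longer ones. When $h$ grows by one, a new segment of length $1$ is appended, and then at most one pair of adjacent segments of equal length, such that the segment on their left (if any) is longer,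 is merged. \textbf{Descriptions.} A segment $s$ of length $2^\ell$ has a description of one of two kinds, which determines its \emph{relevant} processes. \begin{itemize} \item \emph{Sparse}: a list of at most $4$ distinct processes $P(c)$ with $c$ inside $s$. The relevant processes are those on the list. A process whose run fails is removed from the list. \item \emph{Dense}: a pair $(c,p)$ such that $p>0$ is an even multiple of the smallest period of $s$ (that is, $p$ is even and divisible by that period), $p\le\frac12 2^\ell$, and $T[c..(c+p-1)]$ is a palindrome lying within $s$; moreover $s$ is a subword of $(ww^R)^\infty$ for some nonempty word $w$ with $|w|\le\frac14 2^\ell$. The relevant processes are the $P(c+\alpha\frac p2)$, $\alpha\ge0$, with center inside $s$. \end{itemize} In both cases every process $P(c)$ with $c$ inside $s$ that is not relevant must be dead. \textbf{Theorem.} There are a single program for a word RAM, equipped with an instruction that runs a given process in one step, and a constant $C$ such that the following holds for all $n$, all landmark schemes for length $n$ with $b_\lambda\ge12$ for all $\lambda\le L$ and $b_L2^L\ge n$, and all texts $T$ of length $n$. Started with empty memory and executed once after each letter $T[h]$, $h=1,\dots,n$, the program maintains in memory, as a linked list, a partition of $T[1..h]$ as above together with a description of every segment. In step $h$ it runs all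 processes that are relevant at the end of the step and all processes $P(c)$, $1\le c\le h$, that were alive before the step. It uses at most $C(\log n+1)$ words of memory, each holding a natural number at most $Cn$, and step $h$ takes at most $C(\log n+1+r_h)$ time, where $r_h$ is the total number of relevant processes after step $h$ (each of them is run in $O(1)$ time). Here $\log n$ may be read as $\lfloor\log_2 n\rfloor$. -/

import Mathlib

/-! Texts: a text is a function `T : ℕ → α` of which only the letters `T 1, …, T n` are used. -/

/-- The fragment `T[i..j]` is a palindrome. -/
def IsPalindromeAt {α : Type*} (T : ℕ → α) (i j : ℕ) : Prop :=
  ∀ k, i ≤ k → k ≤ j → T k = T (i + j - k)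

/-- `q` is a period of the fragment `T[a..a+m-1]` of length `m`. -/
def IsPeriodOf {α : Type*} (T : ℕ → α) (a m q : ℕ) : Prop :=
  0 < q ∧ ∀ i, a ≤ i → i + q < a + m → T i = T (i + q)

/-- The period of the fragment `T[a..a+m-1]`: its smallest (positive) period. -/
noncomputable def per {α : Type*} (T : ℕ → α) (a m : ℕ) : ℕ :=
  sInf {q | IsPeriodOf T a m q}

/-- `T[a..a+m-1]` is a subword of the infinite word `(w wᴿ)^∞`. -/
def IsSubwordOfPower {α : Type*} (T : ℕ → α) (a m : ℕ) (w : List α) : Prop :=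
  ∃ o : ℕ, ∀ i, i < m →
    (w ++ w.reverse)[(o + i) % (w ++ w.reverse).length]? = some (T (a + i))

/-! Landmarks and processes. -/

/-- The sizes of the levels `0, …, L` of landmarks, for texts of length `n`. A size may be
infinite. -/
structure LandmarkScheme (n : ℕ) where
  L : ℕ
  b : ℕ → ℕ∞
  L_le : 2 ^ L ≤ n
  b_eq : ∀ l, l < L → b l = b 0

/-- After reading `T[h]`, the position `y` is a landmark: it is one of the `b l` most recently seen
positions divisible by `2 ^ l`, for some level `l ≤ L` (position `0`, which stands for the empty
prefix, counts as a position). -/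
def LandmarkScheme.IsLandmark {n : ℕ} (S : LandmarkScheme n) (h y : ℕ) : Prop :=
  ∃ l, l ≤ S.L ∧ ∃ i : ℕ, (i : ℕ∞) < S.b l ∧ i ≤ h / 2 ^ l ∧ y = 2 ^ l * (h / 2 ^ l - i)

/-- Running the process `P(c)` after reading `T[h]` succeeds: `2c-h-2` is a landmark and
`T[(2c-h-1)..h]` is a palindrome. -/
def Succeeds {α : Type*} {n : ℕ} (S : LandmarkScheme n) (T : ℕ → α) (h c : ℕ) : Prop :=
  h + 2 ≤ 2 * c ∧ S.IsLandmark h (2 * c - h - 2) ∧ IsPalindromeAt T (2 * c - h - 1) h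

/-- Running the process `P(c)` after reading `T[h]` fails: either `2c-h-2` is a landmark and
`T[(2c-h-1)..h]` is not a palindrome, or `T[(2c-h-1)..h]` would begin to the left of the text. -/
def Fails {α : Type*} {n : ℕ} (S : LandmarkScheme n) (T : ℕ → α) (h c : ℕ) : Prop :=
  2 * c < h + 2 ∨
    (h + 2 ≤ 2 * c ∧ S.IsLandmark h (2 * c - h - 2) ∧ ¬ IsPalindromeAt T (2 * c - h - 1) h)

open Classical in
/-- What a run of `P(c)` after reading `T[h]` reports: success `1`, failure `2`, or `0` if
`2c-h-2` is not a landmark. -/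
noncomputable def runAnswer {α : Type*} {n : ℕ} (S : LandmarkScheme n) (T : ℕ → α)
    (h c : ℕ) : ℕ :=
  if Succeeds S T h c then 1 else if Fails S T h c then 2 else 0

/-- `log j` is the list of the centers of the processes that are run after reading `T[j]`. The
process `P(c)` is dead after step `h` if one of its runs, in the steps `1, …, h`, failed;
otherwise it is alive. -/
def Dead {α : Type*} {n : ℕ} (S : LandmarkScheme n) (T : ℕ → α) (log : ℕ → List ℕ)
    (h c : ℕ) : Prop :=
  ∃ j, 1 ≤ j ∧ j ≤ h ∧ c ∈ log j ∧ Fails S T j c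

/-! Segments with their descriptions, and the partition scheme. Lists of segments run from the
right (the most recently read part of the text) to the left. -/

inductive Description where
  /-- the list of (the centers of) the processes -/
  | sparse (l : List ℕ)
  /-- the numbers `c` and `p` -/
  | dense (c p : ℕ)

/-- The segment `T[start..start+len-1]` together with a description. -/
structure Segment where
  start : ℕ
  len : ℕ
  desc : Description

open Classical in
/-- The (centers of) relevant processes of a segment: the listed ones of a sparse description, and
those of the form `c + a * (p / 2)`, `a ≥ 0`, inside the segment for a dense one. -/
noncomputable def Segment.relevant (s : Segment) : Finset ℕ :=
  match s.desc with
  | .sparse l => l.toFinset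
  | .dense c p =>
      (Finset.Ico s.start (s.start + s.len)).filter (fun x => ∃ a : ℕ, x = c + a * (p / 2))

/-- The description has the required shape. -/
def Segment.WellFormed {α : Type*} (T : ℕ → α) (s : Segment) : Prop :=
  match s.desc with
  | .sparse l => l.length ≤ 4 ∧ l.Nodup ∧ ∀ c ∈ l, s.start ≤ c ∧ c < s.start + s.len
  | .dense c p =>
      (∃ w : List α, w ≠ [] ∧ 4 * w.length ≤ s.len ∧ IsSubwordOfPower T s.start s.len w) ∧
      0 < p ∧ 2 * p ≤ s.len ∧ per T s.start s.len ∣ p ∧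
      s.start ≤ c ∧ c + p ≤ s.start + s.len ∧ Even p ∧ IsPalindromeAt T c (c + p - 1)

/-- The segments of the list are disjoint, adjacent, and cover exactly `T[1..h]`. -/
def Covers : ℕ → List Segment → Prop
  | h, [] => h = 0
  | h, s :: r => 1 ≤ s.start ∧ s.start + s.len = h + 1 ∧ Covers (s.start - 1) r

/-- The lengths, from right to left, are powers of two and nondecreasing; for some `M` there are
between `3` and `5` segments of each length `2 ^ l` with `l < M`, between `1` and `5` of length
`2 ^ M`, and no longer ones. -/
def ValidLengths (d : List ℕ) : Prop :=
  d.Pairwise (· ≤ ·) ∧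
  ∃ M : ℕ, (∀ x ∈ d, ∃ l, l ≤ M ∧ x = 2 ^ l) ∧
    (∀ l, l < M → 3 ≤ d.count (2 ^ l) ∧ d.count (2 ^ l) ≤ 5) ∧
    1 ≤ d.count (2 ^ M) ∧ d.count (2 ^ M) ≤ 5

/-- One step of the partition scheme on the lengths, listed from right to left: a new segment of
length `1` appears at the right end, and then at most one pair of adjacent segments of the same
length `2 ^ l`, such that the segment on their left (if any) is longer, is merged. -/
def PartitionStep (d d' : List ℕ) : Prop :=
  d' = 1 :: d ∨
    ∃ (pre post : List ℕ) (l : ℕ), 1 :: d = pre ++ 2 ^ l :: 2 ^ l :: post ∧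
      (∀ x ∈ post.head?, 2 ^ l < x) ∧ d' = pre ++ 2 ^ (l + 1) :: post

/-! A word machine with random access memory, a step count, and one additional instruction:
to run a process. -/

/-- The contents of the memory cells. -/
abbrev Memory : Type := ℕ → ℕ

/-- The operations on words. -/
inductive WordOp where
  | add | sub | mul | div | mod | lt | eq

def WordOp.eval : WordOp → ℕ → ℕ → ℕ
  | .add, x, y => x + y
  | .sub, x, y => x - y
  | .mul, x, y => x * y
  | .div, x, y => x / y
  | .mod, x, y => x % y
  | .lt, x, y => if x < y then 1 else 0
  | .eq, x, y => if x = y then 1 else 0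

inductive Expr where
  | lit (k : ℕ)
  /-- the contents of the memory cell whose address is the value of `a` -/
  | load (a : Expr)
  | op (o : WordOp) (e₁ e₂ : Expr)

def Expr.eval (M : Memory) : Expr → ℕ
  | .lit k => k
  | .load a => M (a.eval M)
  | .op o e₁ e₂ => o.eval (e₁.eval M) (e₂.eval M)

/-- The evaluation only reads cells with addresses below `s`, and no value that occurs in it
exceeds `w`. -/
def Expr.Fits (s w : ℕ) (M : Memory) : Expr → Prop
  | .lit k => k ≤ w
  | .load a => a.Fits s w M ∧ a.eval M < s ∧ M (a.eval M) ≤ w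
  | .op o e₁ e₂ => e₁.Fits s w M ∧ e₂.Fits s w M ∧ o.eval (e₁.eval M) (e₂.eval M) ≤ w

/-- The number of elementary steps of an evaluation. -/
def Expr.cost : Expr → ℕ
  | .lit _ => 1
  | .load a => a.cost + 1
  | .op _ e₁ e₂ => e₁.cost + e₂.cost + 1

inductive Program where
  | skip
  /-- store the value of `e` in the cell with address `a` -/
  | assign (a e : Expr)
  /-- run the process whose center is the value of `e`; store the outcome in the cell with
  address `a` -/
  | run (a e : Expr)
  | seq (p₁ p₂ : Program)
  | ite (e : Expr) (p₁ p₂ : Program)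
  | while (e : Expr) (p : Program)

/-- `Exec ans s w p M M' t log`: started on the memory `M`, the program `p` halts with the memory
`M'` after `t` elementary steps, having run the processes in `log` (in this order). It only uses
the cells with addresses below `s`, and all words that occur are at most `w`. Running `P(c)` yields
`ans c`; every run counts as one step. -/
inductive Exec (ans : ℕ → ℕ) (s w : ℕ) :
    Program → Memory → Memory → ℕ → List ℕ → Prop where
  | skip (M : Memory) : Exec ans s w .skip M M 1 []
  | assign (M : Memory) (a e : Expr) (ha : a.Fits s w M) (he : e.Fits s w M)
      (hs : a.eval M < s) :
      Exec ans s w (.assign a e) M (Function.update M (a.eval M) (e.eval M))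
        (a.cost + e.cost + 1) []
  | run (M : Memory) (a e : Expr) (ha : a.Fits s w M) (he : e.Fits s w M)
      (hs : a.eval M < s) (hw : ans (e.eval M) ≤ w) :
      Exec ans s w (.run a e) M (Function.update M (a.eval M) (ans (e.eval M)))
        (a.cost + e.cost + 1) [e.eval M]
  | seq (p₁ p₂ : Program) (M₁ M₂ M₃ : Memory) (t₁ t₂ : ℕ) (l₁ l₂ : List ℕ)
      (h₁ : Exec ans s w p₁ M₁ M₂ t₁ l₁) (h₂ : Exec ans s w p₂ M₂ M₃ t₂ l₂) :
      Exec ans s w (.seq p₁ p₂) M₁ M₃ (t₁ + t₂) (l₁ ++ l₂)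
  | ite_true (e : Expr) (p₁ p₂ : Program) (M M' : Memory) (t : ℕ) (l : List ℕ)
      (he : e.Fits s w M) (hc : e.eval M ≠ 0) (h₁ : Exec ans s w p₁ M M' t l) :
      Exec ans s w (.ite e p₁ p₂) M M' (e.cost + 1 + t) l
  | ite_false (e : Expr) (p₁ p₂ : Program) (M M' : Memory) (t : ℕ) (l : List ℕ)
      (he : e.Fits s w M) (hc : e.eval M = 0) (h₂ : Exec ans s w p₂ M M' t l) :
      Exec ans s w (.ite e p₁ p₂) M M' (e.cost + 1 + t) l
  | while_true (e : Expr) (p : Program) (M₁ M₂ M₃ : Memory) (t₁ t₂ : ℕ) (l₁ l₂ : List ℕ)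
      (he : e.Fits s w M₁) (hc : e.eval M₁ ≠ 0) (h₁ : Exec ans s w p M₁ M₂ t₁ l₁)
      (h₂ : Exec ans s w (.while e p) M₂ M₃ t₂ l₂) :
      Exec ans s w (.while e p) M₁ M₃ (e.cost + 1 + t₁ + t₂) (l₁ ++ l₂)
  | while_false (e : Expr) (p : Program) (M : Memory) (he : e.Fits s w M)
      (hc : e.eval M = 0) :
      Exec ans s w (.while e p) M M (e.cost + 1) []

/-! The segments and their descriptions are kept in the memory as a linked list of records. -/

/-- The eight cells from address `q` on hold: the first position of the segment, its length, a tag,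
four cells of data, and the address of the next record. The tag is the number of listed processes
if the description is sparse, and `5` if it is dense. -/
def Segment.StoredAt (s : Segment) (M : Memory) (q : ℕ) : Prop :=
  M q = s.start ∧ M (q + 1) = s.len ∧
    match s.desc with
    | .sparse l => l.length ≤ 4 ∧ M (q + 2) = l.length ∧
        ∀ (i : ℕ) (hi : i < l.length), M (q + 3 + i) = l[i]
    | .dense c p => M (q + 2) = 5 ∧ M (q + 3) = c ∧ M (q + 4) = p

/-- The linked list that starts at address `q` (where `0` is the null address) stores the given
segments with their descriptions. -/
def StoredList (M : Memory) : ℕ → List Segment → Prop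
  | q, [] => q = 0
  | q, s :: r => q ≠ 0 ∧ s.StoredAt M q ∧ StoredList M (M (q + 7)) r

/-!
The partition of the text can be given in closed form. Every segment of length `2 ^ l` that ever
exists is `T[(k - 1) * 2 ^ l + 1..k * 2 ^ l]` for some `k ≥ 1`, and it is created in step `born l k`;
after step `h` there have been `made h l` segments of this length, of which the first
`2 * made h (l + 1)` have already been merged in pairs. In step `h + 1` there is a merge precisely if
`h + 5 = 2 ^ l * (2 * j + 9)` for some `l` and `j`, so that at most one merge takes place, on a level
that is determined by the exponent of `2` in `h + 5`. The program finds it by arithmetic alone, and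
the same arithmetic gives the addresses of the records involved.

The mathematical content is in the descriptions. A segment of length `2 ^ l = 2 * μ`, `l ≥ 1`, is
merged only after at least `2 ^ l` further steps, during which each of its relevant processes has met
a landmark and hence has succeeded or failed (`exists_succeeds_or_fails`). Since the segment was
created late, a success after its creation exhibits a palindrome of radius at least `7 * μ - 3`
about the center (`Mature.palAt`). For a dense segment the program records whether no, one, or
at least two different relevant processes have succeeded since the segment was created. In the first
two cases all other processes of the segment are dead (`SegOK.dead_of_not_flagged`), and the segment
enters the merge with at most one center. In the third case the periodicity of the segment extends
far beyond its ends (`extend_word`), and it enters the merge with two neighbouring centers.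

If neither half is of the last kind and there are at most four centers, the merged segment is
sparse. Otherwise there is a periodic word with period `2 * g`, `g ≤ μ`, that the text follows on a
neighbourhood of the merged segment: with five centers two of them have distance less than `μ`,
and reflecting alternately about these two yields the periodicity (`exists_word_of_close`). All
centers are centers of palindromes of radius `μ`, hence they are centers of symmetry of this periodic
word (`sym_of_palAt`), and so the greatest common divisor `G` of their distances is a half-period of
it (`halfPeriod_gcdDist`). The dense description with `p = 2 * G` is then correct, and its relevant
processes include all processes that may still be alive (`SegOK.merge`). As `G` is computed by
Euclid's algorithm from at most eight numbers, a merge takes logarithmic time.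

The programs are verified with weakest preconditions for the parts without loops (`exec_of_wp`) and
an invariant rule for loops (`exec_while`). A step consists of appending a segment
(`Ready.append`), a merge (`Ready.update`), and a run of all relevant processes (`Ready.run`). A
process is removed from a segment in the same step in which it is run for the last time, and at most
four are removed from each of the logarithmically many segments; this accounts for the difference
between the number of runs and `r_h`.
-/

namespace PalSegments

set_option linter.unusedSimpArgs false

/-! ### Symmetric words -/

/-- The two-sided infinite word `F` is symmetric about the center `c`, which lies between the
positions `c - 1` and `c`. -/
def Sym {α : Type*} (F : ℤ → α) (c : ℤ) : Prop := ∀ i, F (2 * c - 1 - i) = F i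

/-- `2 * g` is a (possibly trivial or negative) period of the two-sided infinite word `F`. -/
def HalfPeriod {α : Type*} (F : ℤ → α) (g : ℤ) : Prop := ∀ i, F (i + 2 * g) = F i

/-- `U` contains a palindrome of radius `R` with center `c`. -/
def PalAt {α : Type*} (U : ℤ → α) (c R : ℤ) : Prop :=
  ∀ i, c - R ≤ i → i < c + R → U (2 * c - 1 - i) = U i

lemma PalAt.mono {α : Type*} {U : ℤ → α} {c R R' : ℤ} (h : PalAt U c R) (hR : R' ≤ R) :
    PalAt U c R' :=
  fun i h₁ h₂ => h i (by omega) (by omega)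

lemma Sym.halfPeriod {α : Type*} {F : ℤ → α} {c c' : ℤ} (h : Sym F c) (h' : Sym F c') :
    HalfPeriod F (c' - c) := by
  intro i
  rw [← h i, ← h' (2 * c - 1 - i)]
  congr 1; ring

/-- The half-periods of a word form a group. -/
def halfPeriods {α : Type*} (F : ℤ → α) : AddSubgroup ℤ where
  carrier := {g | HalfPeriod F g}
  add_mem' := by
    intro a b ha hb i
    rw [show i + 2 * (a + b) = (i + 2 * a) + 2 * b by ring, hb, ha]
  zero_mem' := by intro i; simp
  neg_mem' := by
    intro a ha i
    rw [← ha (i + 2 * -a)]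
    congr 1; ring

lemma mem_halfPeriods {α : Type*} {F : ℤ → α} {g : ℤ} : g ∈ halfPeriods F ↔ HalfPeriod F g :=
  Iff.rfl

lemma HalfPeriod.mul {α : Type*} {F : ℤ → α} {g : ℤ} (h : HalfPeriod F g) (k : ℤ) :
    HalfPeriod F (k * g) := by
  have := (halfPeriods F).zsmul_mem (mem_halfPeriods.2 h) k
  simpa [mem_halfPeriods] using this

lemma Sym.add_mul {α : Type*} {F : ℤ → α} {c g : ℤ} (h : Sym F c) (hg : HalfPeriod F g)
    (k : ℤ) : Sym F (c + k * g) := by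
  intro i
  rw [← h i, ← hg.mul k (2 * c - 1 - i)]
  congr 1; ring

lemma HalfPeriod.gcd {α : Type*} {F : ℤ → α} {a b : ℕ} (ha : HalfPeriod F a)
    (hb : HalfPeriod F b) : HalfPeriod F (Nat.gcd a b : ℕ) := by
  have h := (halfPeriods F).add_mem (mem_halfPeriods.2 (ha.mul (Nat.gcdA a b)))
    (mem_halfPeriods.2 (hb.mul (Nat.gcdB a b)))
  rw [mem_halfPeriods] at h
  rw [Nat.gcd_eq_gcd_ab]
  convert h using 1
  ring

/-- A word that agrees with `F` between two centers of symmetry of `F`, and that has large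
palindromes about these two centers, agrees with `F` on a large interval: reflecting alternately
about the two centers leads from any position of the interval into the part between them. -/
lemma eq_of_palAt {α : Type*} {F U : ℤ → α} {c c' R : ℤ} (hcc : c < c') (hc : Sym F c)
    (hc' : Sym F c') (hb : ∀ i, c ≤ i → i < c' → U i = F i) (hp : PalAt U c R)
    (hp' : PalAt U c' R) : ∀ i, c' - R ≤ i → i < c + R → U i = F i := by
  have right : ∀ n : ℕ, ∀ i, c ≤ i → i < c + n → i < c + R → U i = F i := by
    intro n
    induction n with
    | zero => intro i h₁ h₂; simp at h₂; omega
    | succ n ih =>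
      intro i h₁ h₂ h₃
      by_cases h₄ : i < c'
      · exact hb i h₁ h₄
      rw [← hp' i (by omega) (by omega), ← hc' i]
      by_cases h₅ : c ≤ 2 * c' - 1 - i
      · exact hb _ h₅ (by omega)
      rw [← hp (2 * c' - 1 - i) (by omega) (by omega), ← hc (2 * c' - 1 - i)]
      exact ih _ (by omega) (by push_cast at h₂; omega) (by omega)
  intro i h₁ h₂
  by_cases h₃ : c ≤ i
  · exact right (i - c + 1).toNat i h₃ (by omega) h₂
  · rw [← hp i (by omega) (by omega), ← hc i]
    exact right (2 * c - 1 - i - c + 1).toNat _ (by omega) (by omega) (by omega)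

/-- The word that is obtained by repeating `U[c..c+g-1]` and its reversal alternately. -/
def fold {α : Type*} (U : ℤ → α) (c g : ℤ) (i : ℤ) : α :=
  if (i - c) % (2 * g) < g then U (c + (i - c) % (2 * g))
  else U (c + (2 * g - 1 - (i - c) % (2 * g)))

lemma fold_refl {α : Type*} (U : ℤ → α) (c g i j : ℤ)
    (h : (i - c) % (2 * g) + (j - c) % (2 * g) = 2 * g - 1) : fold U c g i = fold U c g j := by
  unfold fold
  split_ifs with h₁ h₂ h₂
  · omega
  · congr 2; omega
  · congr 2; omega
  · omega

lemma emod_refl (r g : ℤ) (hg : 0 < g) : (-1 - r) % (2 * g) = 2 * g - 1 - r % (2 * g) := by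
  have h₁ := Int.emod_nonneg r (show 2 * g ≠ 0 by omega)
  have h₂ := Int.emod_lt_of_pos r (show 0 < 2 * g by omega)
  have h₃ : -1 - r = (2 * g - 1 - r % (2 * g)) + (2 * g) * (-1 - r / (2 * g)) := by
    have := Int.emod_add_mul_ediv r (2 * g)
    linarith
  rw [h₃, Int.add_mul_emod_self_left]
  exact Int.emod_eq_of_lt (by omega) (by omega)

lemma sym_fold_left {α : Type*} (U : ℤ → α) (c g : ℤ) (hg : 0 < g) : Sym (fold U c g) c := by
  intro i
  apply fold_refl
  rw [show 2 * c - 1 - i - c = -1 - (i - c) by ring, emod_refl _ _ hg]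
  ring

lemma sym_fold_right {α : Type*} (U : ℤ → α) (c g : ℤ) (hg : 0 < g) :
    Sym (fold U c g) (c + g) := by
  intro i
  apply fold_refl
  rw [show 2 * (c + g) - 1 - i - c = -1 - (i - c) + 2 * g by ring, Int.add_emod_right,
    emod_refl _ _ hg]
  ring

lemma fold_eq {α : Type*} (U : ℤ → α) (c g i : ℤ) (h₁ : c ≤ i) (h₂ : i < c + g) :
    fold U c g i = U i := by
  have : (i - c) % (2 * g) = i - c := Int.emod_eq_of_lt (by omega) (by omega)
  unfold fold
  rw [this, if_pos (by omega)]
  congr 1; ring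

/-- A center of a palindrome of radius `g` in a word of period `2 * g` is a center of symmetry of
the whole word. -/
lemma sym_of_palAt {α : Type*} {F U : ℤ → α} {c g : ℤ} (hg : 0 < g) (hF : HalfPeriod F g)
    (hU : ∀ i, c - g ≤ i → i < c + g → U i = F i) (hp : PalAt U c g) : Sym F c := by
  intro i
  have h₁ := Int.emod_nonneg (i - (c - g)) (show 2 * g ≠ 0 by omega)
  have h₂ := Int.emod_lt_of_pos (i - (c - g)) (show 0 < 2 * g by omega)
  have h₃ := Int.emod_add_mul_ediv (i - (c - g)) (2 * g)
  set r := (i - (c - g)) % (2 * g)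
  set k := (i - (c - g)) / (2 * g)
  have e₁ : F i = F (c - g + r) := by
    rw [← hF.mul k (c - g + r)]; congr 1; linarith
  have e₂ : F (2 * c - 1 - i) = F (2 * c - 1 - (c - g + r)) := by
    rw [← hF.mul k (2 * c - 1 - i)]; congr 1; linarith
  rw [e₁, e₂, ← hU _ (by omega) (by omega), ← hU _ (by omega) (by omega)]
  exact hp _ (by omega) (by omega)

/-! ### Periodic structure from two or more centers -/

/-- Two close centers of large palindromes force a periodic structure on a neighbourhood of a
segment of length `4 * μ`. The bound `7 * μ - 3` for the radius is the one that holds for segments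
of length `2 * μ`, as they are created late. -/
lemma exists_word_of_close {α : Type*} {U : ℤ → α} {a μ R c c' : ℤ} (hR : 7 * μ - 3 ≤ R)
    (hc : a ≤ c) (hcc : c < c') (hc' : c' < a + 4 * μ) (hp : PalAt U c R)
    (hp' : PalAt U c' R) : ∃ F : ℤ → α, HalfPeriod F (c' - c) ∧
      ∀ i, a - 3 * μ + 2 ≤ i → i < a + 7 * μ - 3 → U i = F i := by
  have s₁ := sym_fold_left U c (c' - c) (by omega)
  have s₂ := sym_fold_right U c (c' - c) (by omega)
  rw [show c + (c' - c) = c' by ring] at s₂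
  refine ⟨fold U c (c' - c), s₁.halfPeriod s₂, fun i h₁ h₂ => ?_⟩
  refine eq_of_palAt hcc s₁ s₂ (fun j h₃ h₄ => ?_) hp hp' i (by omega) (by omega)
  exact (fold_eq U c _ j h₃ (by omega)).symm

/-- If the structure of a dense segment `[b, b + 2 * μ)` has two centers with large palindromes,
then it extends to a neighbourhood of every segment of length `4 * μ` that has this segment as one
of its halves. -/
lemma extend_word {α : Type*} {F U : ℤ → α} {a b μ R c g u v : ℤ} (hb : a ≤ b)
    (hb' : b ≤ a + 2 * μ) (hR : 7 * μ - 3 ≤ R) (hF : Sym F c) (hg : HalfPeriod F g)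
    (hU : ∀ i, b ≤ i → i < b + 2 * μ → U i = F i) (hu : b ≤ u) (huv : u < v)
    (hv : v < b + 2 * μ) (hu' : ∃ k : ℤ, u = c + k * g) (hv' : ∃ k : ℤ, v = c + k * g)
    (hp : PalAt U u R) (hp' : PalAt U v R) :
    ∀ i, a - 3 * μ + 2 ≤ i → i < a + 7 * μ - 3 → U i = F i := by
  obtain ⟨k, rfl⟩ := hu'
  obtain ⟨k', rfl⟩ := hv'
  intro i h₁ h₂
  exact eq_of_palAt huv (hF.add_mul hg k) (hF.add_mul hg k')
    (fun j h₃ h₄ => hU j (by omega) (by omega)) hp hp' i (by omega) (by omega)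

/-- The greatest common divisor of the distances of the elements of `X` from `x₀`. -/
def gcdDist (x₀ : ℕ) (X : List ℕ) : ℕ :=
  X.foldl (fun G x => Nat.gcd G ((x - x₀) + (x₀ - x))) 0

lemma gcdDist_append (x₀ : ℕ) (X : List ℕ) (x : ℕ) :
    gcdDist x₀ (X ++ [x]) = Nat.gcd (gcdDist x₀ X) ((x - x₀) + (x₀ - x)) := by
  simp [gcdDist]

lemma gcdDist_dvd_dist (x₀ : ℕ) (X : List ℕ) :
    ∀ x ∈ X, gcdDist x₀ X ∣ (x - x₀) + (x₀ - x) := by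
  induction X using List.reverseRecOn with
  | nil => simp
  | append_singleton X y ih =>
    intro x hx
    rw [gcdDist_append]
    rcases List.mem_append.1 hx with hx | hx
    · exact (Nat.gcd_dvd_left _ _).trans (ih x hx)
    · rw [List.mem_singleton.1 hx]; exact Nat.gcd_dvd_right _ _

lemma gcdDist_dvd (x₀ : ℕ) (X : List ℕ) {x : ℕ} (hx : x ∈ X) :
    (gcdDist x₀ X : ℤ) ∣ (x : ℤ) - x₀ := by
  have h := gcdDist_dvd_dist x₀ X x hx
  rcases le_total x₀ x with h' | h'
  · have e : ((x : ℤ) - x₀) = (((x - x₀) + (x₀ - x) : ℕ) : ℤ) := by omega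
    rw [e]; exact_mod_cast h
  · have e : ((x : ℤ) - x₀) = -(((x - x₀) + (x₀ - x) : ℕ) : ℤ) := by omega
    rw [e, dvd_neg]; exact_mod_cast h

lemma gcdDist_dvd_sub (x₀ : ℕ) (X : List ℕ) {x y : ℕ} (hx : x ∈ X) (hy : y ∈ X) :
    (gcdDist x₀ X : ℤ) ∣ (x : ℤ) - y := by
  have := dvd_sub (gcdDist_dvd x₀ X hx) (gcdDist_dvd x₀ X hy)
  simpa using this

lemma halfPeriod_gcdDist {α : Type*} {F : ℤ → α} {x₀ : ℕ} (h₀ : Sym F x₀) (X : List ℕ)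
    (hX : ∀ x ∈ X, Sym F (x : ℤ)) : HalfPeriod F (gcdDist x₀ X : ℕ) := by
  induction X using List.reverseRecOn with
  | nil => intro i; simp [gcdDist]
  | append_singleton X y ih =>
    rw [gcdDist_append]
    refine (ih fun x hx => hX x (by simp [hx])).gcd ?_
    have hy := hX y (by simp)
    rcases le_total x₀ y with h' | h'
    · have e : (((y - x₀) + (x₀ - y) : ℕ) : ℤ) = (y : ℤ) - x₀ := by omega
      rw [e]; exact h₀.halfPeriod hy
    · have e : (((y - x₀) + (x₀ - y) : ℕ) : ℤ) = (x₀ : ℤ) - y := by omega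
      rw [e]; exact hy.halfPeriod h₀

/-- Among five points of an interval of length `4 * μ`, two have distance less than `μ`. -/
lemma exists_close {X : List ℕ} {a μ : ℕ} (hμ : 0 < μ) (hX : X.Nodup) (h5 : 5 ≤ X.length)
    (hr : ∀ x ∈ X, a ≤ x ∧ x < a + 4 * μ) : ∃ x ∈ X, ∃ y ∈ X, x < y ∧ y - x < μ := by
  classical
  have hc : (Finset.range 4).card < X.toFinset.card := by
    rw [List.toFinset_card_of_nodup hX]; simp; omega
  obtain ⟨x, hx, y, hy, hne, he⟩ := Finset.exists_ne_map_eq_of_card_lt_of_maps_to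
    (f := fun x => (x - a) / μ) hc (by
      intro x hx
      have := hr x (by simpa using hx)
      simp only [Finset.coe_range, Set.mem_Iio]
      rw [Nat.div_lt_iff_lt_mul hμ]; omega)
  simp only [List.mem_toFinset] at hx hy
  have key : ∀ x ∈ X, ∀ y ∈ X, x < y → (x - a) / μ = (y - a) / μ → y - x < μ := by
    intro x hx y hy hxy he
    have h₁ := Nat.div_add_mod (x - a) μ
    have h₂ := Nat.div_add_mod (y - a) μ
    have h₃ := Nat.mod_lt (y - a) hμ
    have h₄ := hr x hx
    rw [he] at h₁
    omega
  rcases lt_or_gt_of_ne hne with h | h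
  · exact ⟨x, hx, y, hy, h, key x hx y hy h he⟩
  · exact ⟨y, hy, x, hx, h, key y hy x hx h he.symm⟩

/-! ### Dense descriptions -/

/-- A text as a two-sided infinite word. -/
def toWord {α : Type*} (T : ℕ → α) (i : ℤ) : α := T i.toNat

lemma palAt_of_isPalindromeAt {α : Type*} {T : ℕ → α} {t c : ℕ} (h : t + 2 ≤ 2 * c)
    (hp : IsPalindromeAt T (2 * c - t - 1) t) : PalAt (toWord T) c (t + 1 - c) := by
  intro i h₁ h₂
  unfold toWord
  have := hp i.toNat (by omega) (by omega)
  rw [this]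
  congr 1
  omega

/-- The structure behind a dense description: the segment `[a, a + m)` of the text agrees with a
periodic word that is symmetric about the centers `c + k * g`. -/
def Structured {α : Type*} (T : ℕ → α) (a m c g : ℕ) : Prop :=
  ∃ F : ℤ → α, Sym F c ∧ HalfPeriod F g ∧
    ∀ i : ℤ, a ≤ i → i < (a + m : ℕ) → toWord T i = F i

/-- The smallest period divides every period that is at most half of the length. -/
lemma per_dvd {α : Type*} {T : ℕ → α} {a m p : ℕ} (hp : IsPeriodOf T a m p) (h2 : 2 * p ≤ m) :
    per T a m ∣ p := by
  have hne : {q | IsPeriodOf T a m q}.Nonempty := ⟨p, hp⟩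
  have hq : IsPeriodOf T a m (per T a m) := Nat.sInf_mem hne
  have hmin : ∀ q, IsPeriodOf T a m q → per T a m ≤ q := fun q h => Nat.sInf_le h
  generalize per T a m = q at *
  have hqp := hmin p hp
  by_contra hnd
  have hd : 0 < p % q := Nat.pos_of_ne_zero fun h => hnd (Nat.dvd_of_mod_eq_zero h)
  have hlt := Nat.mod_lt p hq.1
  have hdm := Nat.div_add_mod p q
  set d := p % q
  set k := p / q
  have iter : ∀ s i, a ≤ i → i + q * s < a + m → T i = T (i + q * s) := by
    intro s
    induction s with
    | zero => intro i _ _; simp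
    | succ s ih =>
      intro i h₁ h₂
      rw [Nat.mul_succ] at h₂ ⊢
      rw [ih i h₁ (by omega), hq.2 _ (by omega) (by omega)]
      congr 1; omega
  have step : ∀ i, a ≤ i → i + p < a + m → T i = T (i + d) := by
    intro i h₁ h₂
    rw [hp.2 i h₁ h₂, iter k (i + d) (by omega) (by omega)]
    congr 1; omega
  have : IsPeriodOf T a m d := by
    refine ⟨hd, fun i h₁ h₂ => ?_⟩
    have e := Nat.div_add_mod (i - a) q
    have e' := Nat.mod_lt (i - a) hq.1
    set s := (i - a) / q
    set r := (i - a) % q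
    have hi : i = a + r + q * s := by omega
    rw [hi, ← iter s (a + r) (by omega) (by omega), step _ (by omega) (by omega),
      iter s (a + r + d) (by omega) (by omega)]
    congr 1; omega
  have := hmin d this
  omega

lemma Structured.wellFormed {α : Type*} {T : ℕ → α} {a m c g : ℕ} (h : Structured T a m c g)
    (hg : 0 < g) (h4 : 4 * g ≤ m) (hc : a ≤ c) (hc' : c < a + g) :
    Segment.WellFormed T ⟨a, m, .dense c (2 * g)⟩ := by
  obtain ⟨F, hs, hF, hU⟩ := h
  have hT : ∀ i : ℕ, a ≤ i → i < a + m → T i = F i := by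
    intro i h₁ h₂
    rw [← hU i (by omega) (by omega)]; simp [toWord]
  have hper : IsPeriodOf T a m (2 * g) := by
    refine ⟨by omega, fun i h₁ h₂ => ?_⟩
    rw [hT i h₁ (by omega), hT (i + 2 * g) (by omega) h₂, ← hF i]
    push_cast; rfl
  have hs' : Sym F (c + g) := by simpa using hs.add_mul hF 1
  have hd : per T a m ∣ 2 * g := per_dvd hper (by omega)
  refine ⟨⟨(List.range g).map fun k => T (c + k), ?_, ?_, ?_⟩, by omega,
    by dsimp only; omega, hd, hc, by dsimp only; omega, even_two_mul g, ?_⟩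
  · simp; omega
  · simpa using h4
  · refine ⟨2 * g - (c - a), fun i (hi : i < m) => ?_⟩
    simp only [List.length_append, List.length_reverse, List.length_map, List.length_range]
    rw [← two_mul]
    have e := Nat.div_add_mod (2 * g - (c - a) + i) (2 * g)
    have e' := Nat.mod_lt (2 * g - (c - a) + i) (show 0 < 2 * g by omega)
    set s := (2 * g - (c - a) + i) / (2 * g)
    set r := (2 * g - (c - a) + i) % (2 * g)
    have hTi : T (a + i) = F (c + r) := by
      rw [hT _ (by omega) (by omega), ← hF.mul (s - 1) (c + r)]
      congr 1
      have e2 : (2 * g : ℤ) * s + r = 2 * g - (c - a) + i := by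
        have := congrArg (Nat.cast : ℕ → ℤ) e
        push_cast at this
        rw [this]; omega
      push_cast
      linarith
    rw [hTi]
    by_cases hr : r < g
    · rw [List.getElem?_append_left (by simpa using hr)]
      simp only [List.getElem?_map, List.getElem?_range hr, Option.map_some]
      rw [hT _ (by omega) (by omega)]; push_cast; rfl
    · rw [List.getElem?_append_right (by simp; omega), List.getElem?_reverse (by simp; omega)]
      simp only [List.length_map, List.length_range, List.getElem?_map]
      rw [List.getElem?_range (by omega), Option.map_some, hT _ (by omega) (by omega),
        ← hs' (c + r)]
      congr 2; omega
  · intro k h₁ h₂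
    rw [hT k (by omega) (by omega), hT _ (by omega) (by omega), ← hs' k]
    congr 1; omega

/-! ### Landmarks -/

/-- Among `2 ^ l` consecutive runs of a process `P(c)` that take place at a distance of less than
`6 * 2 ^ l` from its center, one succeeds or fails. The landmarks of level `l` serve as witnesses
if this level exists, and those of the last level otherwise. -/
lemma exists_succeeds_or_fails {α : Type*} {n : ℕ} (S : LandmarkScheme n) (T : ℕ → α)
    (hb : ∀ l, l ≤ S.L → 12 ≤ S.b l) (hn : (n : ℕ∞) ≤ S.b S.L * 2 ^ S.L) {l c t₀ : ℕ}
    (hc : c ≤ t₀) (ht : t₀ < c + 5 * 2 ^ l) (htn : t₀ + 2 ^ l ≤ n) :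
    ∃ t, t₀ ≤ t ∧ t < t₀ + 2 ^ l ∧ (Succeeds S T t c ∨ Fails S T t c) := by
  have hpos' : 0 < 2 ^ l := by positivity
  by_cases h₀ : 2 * c < t₀ + 2
  · exact ⟨t₀, le_rfl, by omega, Or.inr (Or.inl h₀)⟩
  obtain ⟨lam, hlam, hle, hcase⟩ : ∃ lam, lam ≤ S.L ∧ 2 ^ lam ≤ 2 ^ l ∧
      (lam = l ∨ lam = S.L) := by
    rcases le_total l S.L with h | h
    · exact ⟨l, h, le_rfl, Or.inl rfl⟩
    · exact ⟨S.L, le_rfl, Nat.pow_le_pow_right (by norm_num) h, Or.inr rfl⟩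
  have hpos : 0 < 2 ^ lam := by positivity
  -- `t₀ + r` is the first step, from `t₀` on, in which the relevant position is divisible by
  -- `2 ^ lam`
  obtain ⟨k, r, e, hr⟩ : ∃ k r, 2 ^ lam * k + r = 2 * c - t₀ - 2 ∧ r < 2 ^ lam :=
    ⟨_, _, Nat.div_add_mod _ _, Nat.mod_lt _ hpos⟩
  have hy : 2 * c - (t₀ + r) - 2 = 2 ^ lam * k := by omega
  have hk : k ≤ (t₀ + r) / 2 ^ lam := by
    rw [Nat.le_div_iff_mul_le hpos, mul_comm]; omega
  obtain ⟨i, hi⟩ := Nat.exists_eq_add_of_le hk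
  have hd := Nat.div_mul_le_self (t₀ + r) (2 ^ lam)
  rw [hi, add_mul, mul_comm k] at hd
  have hlm : S.IsLandmark (t₀ + r) (2 * c - (t₀ + r) - 2) := by
    refine ⟨lam, hlam, i, ?_, by omega, by rw [hy, hi, Nat.add_sub_cancel]⟩
    rcases hcase with rfl | rfl
    · have : i < 12 := Nat.lt_of_mul_lt_mul_right (a := 2 ^ lam) (by omega)
      calc (i : ℕ∞) < (12 : ℕ) := by exact_mod_cast this
        _ ≤ S.b lam := by exact_mod_cast hb lam hlam
    · by_contra hcon
      rw [not_lt] at hcon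
      have h₁ : (n : ℕ∞) ≤ (i : ℕ∞) * 2 ^ S.L := hn.trans (mul_le_mul_left hcon _)
      have h₂ : n ≤ i * 2 ^ S.L := by exact_mod_cast h₁
      omega
  refine ⟨t₀ + r, by omega, by omega, ?_⟩
  by_cases hp : IsPalindromeAt T (2 * c - (t₀ + r) - 1) (t₀ + r)
  · exact Or.inl ⟨by omega, hlm, hp⟩
  · exact Or.inr (Or.inr ⟨by omega, hlm, hp⟩)

lemma not_fails_of_succeeds {α : Type*} {n : ℕ} {S : LandmarkScheme n} {T : ℕ → α} {h c : ℕ}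
    (hs : Succeeds S T h c) : ¬ Fails S T h c := by
  rintro (hf | ⟨_, _, hf⟩)
  · have := hs.1; omega
  · exact hf hs.2.2

lemma runAnswer_eq_one {α : Type*} {n : ℕ} {S : LandmarkScheme n} {T : ℕ → α} {h c : ℕ} :
    runAnswer S T h c = 1 ↔ Succeeds S T h c := by
  unfold runAnswer; split_ifs <;> simp_all

lemma runAnswer_eq_two {α : Type*} {n : ℕ} {S : LandmarkScheme n} {T : ℕ → α} {h c : ℕ} :
    runAnswer S T h c = 2 ↔ Fails S T h c := by
  unfold runAnswer; split_ifs with h₁ h₂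
  · simpa using not_fails_of_succeeds h₁
  · simpa using h₂
  · simpa using h₂

lemma runAnswer_le {α : Type*} {n : ℕ} (S : LandmarkScheme n) (T : ℕ → α) (h c : ℕ) :
    runAnswer S T h c ≤ 2 := by
  unfold runAnswer; split_ifs <;> simp

/-! ### The lengths of the segments -/

/-- The number of segments of length `2 ^ l` that have been created in the steps `1, …, h`. The
`k`-th of them is always `T[(k - 1) * 2 ^ l + 1..k * 2 ^ l]`. -/
def made (h : ℕ) : ℕ → ℕ
  | 0 => h
  | l + 1 => (h + 4 - 7 * 2 ^ l) / 2 ^ (l + 1)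

/-- The step that creates the `k`-th segment of length `2 ^ l`. -/
def born : ℕ → ℕ → ℕ
  | 0, k => k
  | l + 1, k => k * 2 ^ (l + 1) + 7 * 2 ^ l - 4

/-- The closed forms for the numbers and for the times of creation agree. -/
lemma le_made_iff {h l k : ℕ} (hk : 1 ≤ k) : k ≤ made h l ↔ born l k ≤ h := by
  cases l with
  | zero => rfl
  | succ l =>
    have : 0 < 2 ^ l := by positivity
    have h2 : 1 * 2 ^ (l + 1) ≤ k * 2 ^ (l + 1) := Nat.mul_le_mul_right _ hk
    rw [made, born, Nat.le_div_iff_mul_le (by positivity)]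
    rw [pow_succ] at *
    omega

/-- On every level below the topmost one there are between `3` and `5` segments. -/
lemma made_bounds (h l : ℕ) : 2 * made h (l + 1) ≤ made h l ∧ made h l ≤ 2 * made h (l + 1) + 5 ∧
    (1 ≤ made h (l + 1) → 2 * made h (l + 1) + 3 ≤ made h l) := by
  have hj : ∃ j, made h (l + 1) = j := ⟨_, rfl⟩
  obtain ⟨j, hj⟩ := hj
  rw [hj]
  have hQ : 0 < 2 ^ l := by positivity
  have hj' := hj
  rw [made, pow_succ, Nat.div_eq_iff (by positivity)] at hj'
  obtain ⟨h₁, h₂⟩ := hj'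
  cases l with
  | zero => simp only [made]; simp at h₁ h₂; omega
  | succ l =>
    rw [made]
    have hP : 0 < 2 ^ l := by positivity
    simp only [pow_succ] at *
    generalize 2 ^ l = Q at *
    have e₁ : j * (Q * 2 * 2) = 4 * (Q * j) := by ring
    rw [e₁] at h₁ h₂
    refine ⟨?_, ?_, fun h => ?_⟩
    · rw [Nat.le_div_iff_mul_le (by positivity), show 2 * j * (Q * 2) = 4 * (Q * j) by ring]
      omega
    · rw [← Nat.lt_succ_iff, Nat.div_lt_iff_lt_mul (by positivity),
        show (2 * j + 5).succ * (Q * 2) = 4 * (Q * j) + 12 * Q by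
          rw [Nat.succ_eq_add_one]; ring]
      omega
    · rw [Nat.le_div_iff_mul_le (by positivity),
        show (2 * j + 3) * (Q * 2) = 4 * (Q * j) + 6 * Q by ring]
      have : Q * 1 ≤ Q * j := Nat.mul_le_mul_left _ h
      omega

lemma two_pow_mul_odd_inj {l l' a b : ℕ} (h : 2 ^ l * (2 * a + 1) = 2 ^ l' * (2 * b + 1)) :
    l = l' := by
  have key : ∀ l l' a b : ℕ, 2 ^ l * (2 * a + 1) = 2 ^ l' * (2 * b + 1) → ¬ l < l' := by
    intro l l' a b h hlt
    obtain ⟨d, rfl⟩ := Nat.exists_eq_add_of_lt hlt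
    have hpos : 0 < 2 ^ l := by positivity
    have : 2 * a + 1 = 2 * (2 ^ d * (2 * b + 1)) := by
      apply Nat.eq_of_mul_eq_mul_left hpos
      rw [h]; ring
    omega
  rcases lt_trichotomy l l' with h' | h' | h'
  · exact absurd h' (key _ _ _ _ h)
  · exact h'
  · exact absurd h' (key _ _ _ _ h.symm)

/-- No segment of length `2 ^ (l + 1)` is created in step `h + 1` unless `h + 5` has the form given
here. -/
lemma made_succ_eq (h l : ℕ) (hl : ¬ ∃ j, h + 5 = 2 ^ l * (2 * j + 9)) :
    made (h + 1) (l + 1) = made h (l + 1) := by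
  have hpos : 0 < 2 ^ l := by positivity
  simp only [made]
  by_cases h₁ : h + 5 ≤ 7 * 2 ^ l
  · rw [show h + 1 + 4 - 7 * 2 ^ l = 0 by omega, show h + 4 - 7 * 2 ^ l = 0 by omega]
  · rw [show h + 1 + 4 - 7 * 2 ^ l = (h + 4 - 7 * 2 ^ l) + 1 by omega, Nat.succ_div, if_neg,
      Nat.add_zero]
    rintro ⟨i, hi⟩
    rcases i with _ | i
    · simp at hi
    · refine hl ⟨i, ?_⟩
      have : 2 ^ (l + 1) * (i + 1) = 2 ^ l * (2 * i + 2) := by ring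
      have : 2 ^ l * (2 * i + 9) = 2 ^ l * (2 * i + 2) + 7 * 2 ^ l := by ring
      omega

lemma made_merge {h l j : ℕ} (hl : h + 5 = 2 ^ l * (2 * j + 9)) :
    made h (l + 1) = j ∧ made (h + 1) (l + 1) = j + 1 := by
  have hpos : 0 < 2 ^ l := by positivity
  have e : h + 1 + 4 - 7 * 2 ^ l = 2 ^ (l + 1) * (j + 1) := by
    have h₁ : 2 ^ (l + 1) * (j + 1) = 2 ^ l * (2 * j + 2) := by ring
    have h₂ : 2 ^ l * (2 * j + 9) = 2 ^ l * (2 * j + 2) + 7 * 2 ^ l := by ring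
    omega
  have e' : made (h + 1) (l + 1) = j + 1 := by
    rw [made, e, Nat.mul_div_cancel_left _ (by positivity)]
  refine ⟨?_, e'⟩
  have hs : h + 1 + 4 - 7 * 2 ^ l = (h + 4 - 7 * 2 ^ l) + 1 := by
    have : 0 < 2 ^ (l + 1) * (j + 1) := by positivity
    omega
  rw [made, hs, Nat.succ_div, if_pos (by rw [← hs, e]; exact Dvd.intro _ rfl)] at e'
  simp only [made]
  omega

lemma made_merge_other {h l j : ℕ} (hl : h + 5 = 2 ^ l * (2 * j + 9)) {l' : ℕ} (hne : l' ≠ l) :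
    made (h + 1) (l' + 1) = made h (l' + 1) := by
  apply made_succ_eq
  rintro ⟨i, hi⟩
  apply hne
  refine two_pow_mul_odd_inj (a := i + 4) (b := j + 4) ?_
  rw [show 2 * (i + 4) + 1 = 2 * i + 9 by ring, show 2 * (j + 4) + 1 = 2 * j + 9 by ring]
  omega

lemma made_eq_zero {h l : ℕ} (hl : h < l) : made h l = 0 := by
  cases l with
  | zero => omega
  | succ l =>
    have := Nat.lt_two_pow_self (n := l)
    rw [made, Nat.div_eq_of_lt]
    rw [pow_succ]; omega

/-- The segments of length `2 ^ l` number `a, a - 1, …, a - c + 1`. -/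
def levelList (l : ℕ) : ℕ → ℕ → List (ℕ × ℕ)
  | _, 0 => []
  | a, c + 1 => (l, a) :: levelList l (a - 1) c

/-- The segments of the levels `l, …, l + K - 1` of the partition, from right to left, if `A l'`
segments have been created on level `l'`. Such a segment is given by its level and its number. -/
def skel (A : ℕ → ℕ) : ℕ → ℕ → List (ℕ × ℕ)
  | _, 0 => []
  | l, K + 1 => levelList l (A l) (A l - 2 * A (l + 1)) ++ skel A (l + 1) K

lemma mem_levelList {l a c : ℕ} (hc : c ≤ a) {x : ℕ × ℕ} :
    x ∈ levelList l a c ↔ x.1 = l ∧ a < x.2 + c ∧ x.2 ≤ a := by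
  induction c generalizing a with
  | zero => simp [levelList]
  | succ c ih =>
    rw [levelList, List.mem_cons, ih (by omega), Prod.ext_iff]
    simp only
    omega

lemma mem_skel {A : ℕ → ℕ} {l K : ℕ} {x : ℕ × ℕ} :
    x ∈ skel A l K ↔ l ≤ x.1 ∧ x.1 < l + K ∧ 2 * A (x.1 + 1) < x.2 ∧ x.2 ≤ A x.1 := by
  induction K generalizing l with
  | zero => simp [skel]; omega
  | succ K ih =>
    rw [skel, List.mem_append, ih, mem_levelList (by omega)]
    constructor
    · rintro (⟨rfl, h₁, h₂⟩ | h)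
      · omega
      · omega
    · rintro ⟨h₁, h₂, h₃, h₄⟩
      by_cases h : x.1 = l
      · left; subst h; omega
      · right; omega

lemma skel_congr {A A' : ℕ → ℕ} {l : ℕ} (h : ∀ l', l ≤ l' → A l' = A' l') (K : ℕ) :
    skel A l K = skel A' l K := by
  induction K generalizing l with
  | zero => rfl
  | succ K ih =>
    rw [skel, skel, h l le_rfl, h (l + 1) (by omega), ih fun l' hl => h l' (by omega)]

lemma skel_append_segment {A A' : ℕ → ℕ} (h0 : A' 0 = A 0 + 1) (h : ∀ l, A' (l + 1) = A (l + 1))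
    (hA : 2 * A 1 ≤ A 0) (K : ℕ) : skel A' 0 (K + 1) = (0, A' 0) :: skel A 0 (K + 1) := by
  rw [skel, skel, h, h0, show A 0 + 1 - 2 * A (0 + 1) = (A 0 - 2 * A (0 + 1)) + 1 by
    simp; omega, levelList]
  rw [skel_congr (A := A') (A' := A) fun l' hl => by
    obtain ⟨l, rfl⟩ := Nat.exists_eq_add_of_le' hl
    exact h l]
  rfl

lemma levelList_append {l a c d : ℕ} : levelList l a (c + d) =
    levelList l a c ++ levelList l (a - c) d := by
  induction c generalizing a with
  | zero => simp [levelList]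
  | succ c ih =>
    rw [Nat.succ_add, levelList, levelList, ih, List.cons_append, Nat.sub_sub, Nat.add_comm 1]

/-- If one more segment has been created on level `l + 1`, then the leftmost two segments of level
`l` have been replaced by it. -/
lemma skel_merge {A A' : ℕ → ℕ} {l : ℕ} (hl : A' (l + 1) = A (l + 1) + 1)
    (h : ∀ l', l' ≠ l + 1 → A' l' = A l') (h₂ : 2 * A (l + 1) + 3 ≤ A l)
    (h₃ : 2 * A (l + 2) ≤ A (l + 1)) {l₀ K : ℕ} (h₀ : l₀ ≤ l) (hK : l + 2 ≤ l₀ + K) :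
    ∃ pre post, skel A l₀ K = pre ++ (l, 2 * A (l + 1) + 3) :: (l, 2 * A (l + 1) + 2) ::
        (l, 2 * A (l + 1) + 1) :: post ∧
      skel A' l₀ K = pre ++ (l, 2 * A (l + 1) + 3) :: (l + 1, A (l + 1) + 1) :: post ∧ ∀ x ∈ post, l < x.1 := by
  induction K generalizing l₀ with
  | zero => omega
  | succ K ih =>
    by_cases hll : l₀ = l
    · subst hll
      obtain ⟨K, rfl⟩ : ∃ K', K = K' + 1 := ⟨K - 1, by omega⟩
      refine ⟨levelList l₀ (A l₀) (A l₀ - (2 * A (l₀ + 1) + 3)), skel A (l₀ + 1) (K + 1),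
        ?_, ?_, ?_⟩
      · rw [skel, show A l₀ - 2 * A (l₀ + 1) = (A l₀ - (2 * A (l₀ + 1) + 3)) + 3 by omega,
          levelList_append, show A l₀ - (A l₀ - (2 * A (l₀ + 1) + 3)) = 2 * A (l₀ + 1) + 3 by
            omega]
        simp [levelList]
      · rw [skel, hl, h l₀ (by omega),
          show A l₀ - 2 * (A (l₀ + 1) + 1) = A l₀ - (2 * A (l₀ + 1) + 3) + 1 by omega,
          levelList_append, show A l₀ - (A l₀ - (2 * A (l₀ + 1) + 3)) = 2 * A (l₀ + 1) + 3 by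
            omega, skel, skel,
          hl, h (l₀ + 1 + 1) (by omega),
          show A (l₀ + 1) + 1 - 2 * A (l₀ + 1 + 1) = (A (l₀ + 1) - 2 * A (l₀ + 1 + 1)) + 1 by
            have : l₀ + 2 = l₀ + 1 + 1 := rfl
            rw [this] at h₃; omega, levelList]
        rw [skel_congr (A := A') (A' := A) fun l' hl => h l' (by omega)]
        simp [levelList]
      · intro x hx
        have := mem_skel.1 hx
        omega
    · obtain ⟨pre, post, e₁, e₂, e₃⟩ := ih (l₀ := l₀ + 1) (by omega) (by omega)
      refine ⟨levelList l₀ (A l₀) (A l₀ - 2 * A (l₀ + 1)) ++ pre, post, ?_, ?_, e₃⟩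
      · rw [skel, e₁, List.append_assoc]
      · rw [skel, e₂, List.append_assoc, h l₀ (by omega)]
        by_cases hl' : l₀ + 1 = l + 1
        · omega
        · rw [h _ hl']

/-- The segment number `k` of length `2 ^ l` with the description `d l k`. -/
def mkSegment (d : ℕ → ℕ → Description) (x : ℕ × ℕ) : Segment :=
  ⟨(x.2 - 1) * 2 ^ x.1 + 1, 2 ^ x.1, d x.1 x.2⟩

lemma covers_levelList (d : ℕ → ℕ → Description) {l : ℕ} {r : List Segment} {a c : ℕ}
    (hc : c ≤ a) (hr : Covers ((a - c) * 2 ^ l) r) :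
    Covers (a * 2 ^ l) ((levelList l a c).map (mkSegment d) ++ r) := by
  induction c generalizing a with
  | zero => simpa [levelList] using hr
  | succ c ih =>
    obtain ⟨a, rfl⟩ : ∃ a', a = a' + 1 := ⟨a - 1, by omega⟩
    rw [levelList, List.map_cons, List.cons_append]
    refine ⟨by simp [mkSegment], ?_, ?_⟩
    · simp [mkSegment]; ring
    · have := ih (a := a) (by omega) (by rwa [Nat.add_sub_add_right] at hr)
      simpa [mkSegment] using this

lemma covers_skel (d : ℕ → ℕ → Description) {A : ℕ → ℕ} (hA : ∀ l, 2 * A (l + 1) ≤ A l)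
    {l K : ℕ} (hK : A (l + K) = 0) : Covers (A l * 2 ^ l) ((skel A l K).map (mkSegment d)) := by
  induction K generalizing l with
  | zero => simp only [Nat.add_zero] at hK; simp [skel, Covers, hK]
  | succ K ih =>
    rw [skel, List.map_append]
    apply covers_levelList _ (by omega)
    rw [Nat.sub_sub_self (hA l)]
    have := ih (l := l + 1) (by rw [← hK]; congr 1; omega)
    rwa [pow_succ, mul_comm (2 ^ l), ← mul_assoc, mul_comm (A (l + 1))] at this

/-- The lengths of the segments of the partition. -/
def lens (s : List (ℕ × ℕ)) : List ℕ := s.map fun x => 2 ^ x.1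

lemma count_levelList (l l' a c : ℕ) :
    (lens (levelList l a c)).count (2 ^ l') = if l' = l then c else 0 := by
  induction c generalizing a with
  | zero => simp [levelList, lens]
  | succ c ih =>
    have := ih (a - 1)
    unfold lens at *
    rw [levelList, List.map_cons, List.count_cons, this]
    by_cases h : l' = l
    · simp [h]
    · have : ¬ (2 ^ l = 2 ^ l') := fun e => h (Nat.pow_right_injective le_rfl e).symm
      simp [h, this]

lemma count_skel (A : ℕ → ℕ) (l l' K : ℕ) : (lens (skel A l K)).count (2 ^ l') =
    if l ≤ l' ∧ l' < l + K then A l' - 2 * A (l' + 1) else 0 := by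
  induction K generalizing l with
  | zero => rw [if_neg (by omega)]; simp [skel, lens]
  | succ K ih =>
    have h₁ := count_levelList l l' (A l) (A l - 2 * A (l + 1))
    have h₂ := ih (l + 1)
    unfold lens at *
    rw [skel, List.map_append, List.count_append, h₁, h₂]
    by_cases h : l' = l
    · subst h; simp
    · rw [if_neg h]
      by_cases h' : l ≤ l' ∧ l' < l + (K + 1)
      · rw [if_pos h', if_pos (by omega), Nat.zero_add]
      · rw [if_neg h', if_neg (by omega)]

lemma pairwise_skel (A : ℕ → ℕ) (l K : ℕ) : (lens (skel A l K)).Pairwise (· ≤ ·) := by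
  have key : (skel A l K).Pairwise fun x y => x.1 ≤ y.1 := by
    induction K generalizing l with
    | zero => simp [skel]
    | succ K ih =>
      rw [skel, List.pairwise_append]
      refine ⟨?_, ih (l + 1), ?_⟩
      · generalize A l = a
        generalize a - 2 * A (l + 1) = c
        have h : ∀ x ∈ levelList l a c, x.1 = l := by
          induction c generalizing a with
          | zero => simp [levelList]
          | succ c ih => simp [levelList]; exact fun a b h => ih _ (a, b) h
        exact List.pairwise_of_forall_mem_list fun x hx y hy => by rw [h x hx, h y hy]
      · intro x hx y hy
        rw [mem_levelList (by omega)] at hx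
        have := mem_skel.1 hy
        omega
  exact List.pairwise_map.2 (key.imp fun h => Nat.pow_le_pow_right (by norm_num) h)

lemma validLengths_skel {h K : ℕ} (hh : 1 ≤ h) (hK : h < K) :
    ValidLengths (lens (skel (made h) 0 K)) := by
  refine ⟨pairwise_skel _ _ _, ?_⟩
  have hex : ∃ l, made h (l + 1) = 0 := ⟨h, made_eq_zero (by omega)⟩
  classical
  set M := Nat.find hex
  have hM : made h (M + 1) = 0 := Nat.find_spec hex
  have hlt : ∀ l, l < M → 1 ≤ made h (l + 1) := fun l hl =>
    Nat.one_le_iff_ne_zero.2 (Nat.find_min hex hl)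
  have hMh : M ≤ h := Nat.find_le (made_eq_zero (by omega))
  have hM1 : 1 ≤ made h M := by
    rcases hM0 : M with _ | l
    · simpa [made] using hh
    · exact hlt l (by omega)
  have hz : ∀ l, M < l → made h l = 0 := by
    intro l hl
    induction l with
    | zero => omega
    | succ l ih =>
      rcases Nat.lt_succ_iff_lt_or_eq.1 hl with h' | h'
      · have := (made_bounds h l).1
        have := ih h'
        omega
      · rw [← h']; exact hM
  refine ⟨M, ?_, ?_, ?_⟩
  · intro x hx
    obtain ⟨y, hy, rfl⟩ := List.mem_map.1 hx
    refine ⟨y.1, ?_, rfl⟩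
    have h₁ := mem_skel.1 hy
    by_contra hcon
    have := hz y.1 (by omega)
    omega
  · intro l hl
    rw [count_skel, if_pos (by omega)]
    have h₁ := made_bounds h l
    have h₂ := h₁.2.2 (hlt l hl)
    omega
  · rw [count_skel, if_pos (by omega), hM]
    have h₁ := made_bounds h M
    omega

lemma length_levelList (l a c : ℕ) : (levelList l a c).length = c := by
  induction c generalizing a with
  | zero => rfl
  | succ c ih => rw [levelList, List.length_cons, ih]

lemma length_skel_le (h l K : ℕ) : (skel (made h) l K).length ≤ 5 * K := by
  induction K generalizing l with
  | zero => simp [skel]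
  | succ K ih =>
    rw [skel, List.length_append, length_levelList]
    have := ih (l + 1)
    have := made_bounds h l
    omega

/-! ### Reasoning about programs -/

instance : Add Expr := ⟨.op .add⟩
instance : Sub Expr := ⟨.op .sub⟩
instance : Mul Expr := ⟨.op .mul⟩
instance : Div Expr := ⟨.op .div⟩
instance : Mod Expr := ⟨.op .mod⟩
instance (k : ℕ) : OfNat Expr k := ⟨.lit k⟩

/-- The contents of the cell `k`. -/
abbrev cell (k : ℕ) : Expr := .load (.lit k)

/-- The test whether two words are equal. -/
abbrev eqE (a b : Expr) : Expr := .op .eq a b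

/-- The test whether one word is smaller than another one. -/
abbrev ltE (a b : Expr) : Expr := .op .lt a b

infixr:51 " ;; " => Program.seq
infix:52 " ::= " => Program.assign

/-- No cell contains a word that is larger than `w`. -/
def Bounded (w : ℕ) (M : Memory) : Prop := ∀ a, M a ≤ w

/-- A form of `Expr.Fits` for memories that contain only words of size at most `w`, without the
conditions that hold automatically. -/
def Fits' (s w : ℕ) (M : Memory) : Expr → Prop
  | .lit k => k ≤ w
  | .load a => Fits' s w M a ∧ a.eval M < s
  | .op .add e₁ e₂ => Fits' s w M e₁ ∧ Fits' s w M e₂ ∧ e₁.eval M + e₂.eval M ≤ w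
  | .op .mul e₁ e₂ => Fits' s w M e₁ ∧ Fits' s w M e₂ ∧ e₁.eval M * e₂.eval M ≤ w
  | .op _ e₁ e₂ => Fits' s w M e₁ ∧ Fits' s w M e₂

lemma fits_of_fits' {s w : ℕ} {M : Memory} (hw : 1 ≤ w) (hM : Bounded w M) {e : Expr}
    (h : Fits' s w M e) : e.Fits s w M ∧ e.eval M ≤ w := by
  induction e with
  | lit k => exact ⟨h, h⟩
  | load a ih => exact ⟨⟨(ih h.1).1, h.2, hM _⟩, hM _⟩
  | op o e₁ e₂ ih₁ ih₂ =>
    cases o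
    case add => exact ⟨⟨(ih₁ h.1).1, (ih₂ h.2.1).1, h.2.2⟩, h.2.2⟩
    case mul => exact ⟨⟨(ih₁ h.1).1, (ih₂ h.2.1).1, h.2.2⟩, h.2.2⟩
    case sub =>
      have h' := (Nat.sub_le (e₁.eval M) (e₂.eval M)).trans (ih₁ h.1).2
      exact ⟨⟨(ih₁ h.1).1, (ih₂ h.2).1, h'⟩, h'⟩
    case div =>
      have h' := (Nat.div_le_self (e₁.eval M) (e₂.eval M)).trans (ih₁ h.1).2
      exact ⟨⟨(ih₁ h.1).1, (ih₂ h.2).1, h'⟩, h'⟩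
    case mod =>
      have h' := (Nat.mod_le (e₁.eval M) (e₂.eval M)).trans (ih₁ h.1).2
      exact ⟨⟨(ih₁ h.1).1, (ih₂ h.2).1, h'⟩, h'⟩
    case lt =>
      have h' : WordOp.lt.eval (e₁.eval M) (e₂.eval M) ≤ w := by
        simp only [WordOp.eval]; split_ifs <;> omega
      exact ⟨⟨(ih₁ h.1).1, (ih₂ h.2).1, h'⟩, h'⟩
    case eq =>
      have h' : WordOp.eq.eval (e₁.eval M) (e₂.eval M) ≤ w := by
        simp only [WordOp.eval]; split_ifs <;> omega
      exact ⟨⟨(ih₁ h.1).1, (ih₂ h.2).1, h'⟩, h'⟩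

/-- The weakest precondition of a program without loops and without runs of processes. -/
def wp (s w : ℕ) : Program → (Memory → Prop) → Memory → Prop
  | .skip, Q, M => Q M
  | .assign a e, Q, M => Fits' s w M a ∧ Fits' s w M e ∧ a.eval M < s ∧
      Q (Function.update M (a.eval M) (e.eval M))
  | .seq p₁ p₂, Q, M => wp s w p₁ (wp s w p₂ Q) M
  | .ite e p₁ p₂, Q, M => Fits' s w M e ∧ (e.eval M ≠ 0 → wp s w p₁ Q M) ∧
      (e.eval M = 0 → wp s w p₂ Q M)
  | .run _ _, _, _ => False
  | .while _ _, _, _ => False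

/-- A bound for the number of steps of a program without loops. -/
def costBound : Program → ℕ
  | .skip => 1
  | .assign a e => a.cost + e.cost + 1
  | .run a e => a.cost + e.cost + 1
  | .seq p₁ p₂ => costBound p₁ + costBound p₂
  | .ite e p₁ p₂ => e.cost + 1 + max (costBound p₁) (costBound p₂)
  | .while _ _ => 0

lemma bounded_update {w : ℕ} {M : Memory} (hM : Bounded w M) {a v : ℕ} (hv : v ≤ w) :
    Bounded w (Function.update M a v) := by
  intro b
  rw [Function.update_apply]
  split_ifs
  exacts [hv, hM b]

/-- A program without loops and runs halts within its cost bound in a memory that satisfies the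
postcondition. -/
lemma exec_of_wp {ans : ℕ → ℕ} {s w : ℕ} (hw : 1 ≤ w) {p : Program} {Q : Memory → Prop}
    {M : Memory} (hM : Bounded w M) (h : wp s w p Q M) :
    ∃ M' t, Exec ans s w p M M' t [] ∧ t ≤ costBound p ∧ Bounded w M' ∧ Q M' := by
  induction p generalizing Q M with
  | skip => exact ⟨M, 1, .skip M, le_rfl, hM, h⟩
  | assign a e =>
    obtain ⟨h₁, h₂, h₃, h₄⟩ := h
    exact ⟨_, _, .assign M a e (fits_of_fits' hw hM h₁).1 (fits_of_fits' hw hM h₂).1 h₃, le_rfl,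
      bounded_update hM (fits_of_fits' hw hM h₂).2, h₄⟩
  | run a e => exact h.elim
  | seq p₁ p₂ ih₁ ih₂ =>
    obtain ⟨M₁, t₁, h₁, h₂, h₃, h₄⟩ := ih₁ hM h
    obtain ⟨M₂, t₂, h₅, h₆, h₇, h₈⟩ := ih₂ h₃ h₄
    exact ⟨M₂, t₁ + t₂, .seq _ _ _ _ _ _ _ [] [] h₁ h₅, by unfold costBound; omega, h₇, h₈⟩
  | ite e p₁ p₂ ih₁ ih₂ =>
    obtain ⟨h₁, h₂, h₃⟩ := h
    by_cases he : e.eval M = 0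
    · obtain ⟨M₂, t₂, h₅, h₆, h₇, h₈⟩ := ih₂ hM (h₃ he)
      exact ⟨M₂, _, .ite_false _ _ _ _ _ _ _ (fits_of_fits' hw hM h₁).1 he h₅,
        by unfold costBound; omega, h₇, h₈⟩
    · obtain ⟨M₂, t₂, h₅, h₆, h₇, h₈⟩ := ih₁ hM (h₂ he)
      exact ⟨M₂, _, .ite_true _ _ _ _ _ _ _ (fits_of_fits' hw hM h₁).1 he h₅,
        by unfold costBound; omega, h₇, h₈⟩
  | _ => exact h.elim

/-- The rule for loops. The invariant `I k M t l` refers to a bound `k` for the number of remaining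
rounds, to the memory `M`, and to the time `t` spent and the list `l` of the processes run so
far. -/
lemma exec_while {ans : ℕ → ℕ} {s w : ℕ} {e : Expr} {p : Program}
    (I : ℕ → Memory → ℕ → List ℕ → Prop) {Q : Memory → ℕ → List ℕ → Prop}
    (step : ∀ k M t l, I k M t l → e.Fits s w M ∧
      ((e.eval M = 0 ∧ Q M (t + e.cost + 1) l) ∨
        ∃ k', k = k' + 1 ∧ e.eval M ≠ 0 ∧ ∃ M' t' l', Exec ans s w p M M' t' l' ∧
          I k' M' (t + (e.cost + 1 + t')) (l ++ l')))
    (k : ℕ) (M : Memory) (t : ℕ) (l : List ℕ) (h : I k M t l) :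
    ∃ M' t' l', Exec ans s w (.while e p) M M' t' l' ∧ Q M' (t + t') (l ++ l') := by
  induction k generalizing M t l with
  | zero =>
    obtain ⟨h₁, ⟨h₂, h₃⟩ | ⟨k', h₂, _⟩⟩ := step _ _ _ _ h
    · exact ⟨M, _, [], .while_false e p M h₁ h₂, by simpa [add_assoc] using h₃⟩
    · omega
  | succ k ih =>
    obtain ⟨h₁, ⟨h₂, h₃⟩ | ⟨k', h₂, h₃, M₁, t₁, l₁, h₄, h₅⟩⟩ := step _ _ _ _ h
    · exact ⟨M, _, [], .while_false e p M h₁ h₂, by simpa [add_assoc] using h₃⟩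
    · obtain rfl : k = k' := by omega
      obtain ⟨M₂, t₂, l₂, h₆, h₇⟩ := ih _ _ _ h₅
      exact ⟨M₂, _, _, .while_true e p _ _ _ _ _ _ _ h₁ h₃ h₄ h₆, by
        simpa [add_assoc, List.append_assoc] using h₇⟩

lemma Expr.Fits.mono {s s' w w' : ℕ} {M : Memory} (hs : s ≤ s') (hw : w ≤ w') {e : Expr}
    (h : e.Fits s w M) : e.Fits s' w' M := by
  induction e with
  | lit k => exact le_trans (b := w) h hw
  | load a ih => exact ⟨ih h.1, h.2.1.trans_le hs, h.2.2.trans hw⟩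
  | op o e₁ e₂ ih₁ ih₂ => exact ⟨ih₁ h.1, ih₂ h.2.1, h.2.2.trans hw⟩

lemma exec_mono {ans : ℕ → ℕ} {s s' w w' : ℕ} (hs : s ≤ s') (hw : w ≤ w') {p : Program}
    {M M' : Memory} {t : ℕ} {L : List ℕ} (h : Exec ans s w p M M' t L) :
    Exec ans s' w' p M M' t L := by
  induction h with
  | skip M => exact .skip M
  | assign M a e ha he h =>
    exact .assign M a e (Expr.Fits.mono hs hw ha) (Expr.Fits.mono hs hw he) (h.trans_le hs)
  | run M a e ha he h h' =>
    exact .run M a e (Expr.Fits.mono hs hw ha) (Expr.Fits.mono hs hw he) (h.trans_le hs)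
      (h'.trans hw)
  | seq _ _ _ _ _ _ _ _ _ _ _ ih₁ ih₂ => exact .seq _ _ _ _ _ _ _ _ _ ih₁ ih₂
  | ite_true _ _ _ _ _ _ _ he hc _ ih =>
    exact .ite_true _ _ _ _ _ _ _ (Expr.Fits.mono hs hw he) hc ih
  | ite_false _ _ _ _ _ _ _ he hc _ ih =>
    exact .ite_false _ _ _ _ _ _ _ (Expr.Fits.mono hs hw he) hc ih
  | while_true _ _ _ _ _ _ _ _ _ he hc _ _ ih₁ ih₂ =>
    exact .while_true _ _ _ _ _ _ _ _ _ (Expr.Fits.mono hs hw he) hc ih₁ ih₂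
  | while_false _ _ _ he hc => exact .while_false _ _ _ (Expr.Fits.mono hs hw he) hc

lemma add_def (a b : Expr) : a + b = .op .add a b := rfl
lemma sub_def (a b : Expr) : a - b = .op .sub a b := rfl
lemma mul_def (a b : Expr) : a * b = .op .mul a b := rfl
lemma div_def (a b : Expr) : a / b = .op .div a b := rfl
lemma mod_def (a b : Expr) : a % b = .op .mod a b := rfl
lemma ofNat_def (k : ℕ) [k.AtLeastTwo] : (OfNat.ofNat k : Expr) = .lit k := rfl
lemma zero_def : (0 : Expr) = .lit 0 := rfl
lemma one_def : (1 : Expr) = .lit 1 := rfl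

/-! ### Appending a segment and finding the level of a merge -/

/-!
The memory is used as follows. Cell `0` holds the address of the first record, that is, of the record
of the rightmost segment, cell `1` the number `h` of letters read so far. The cells `2` to `18` are
scratch cells:

* `2`, `3`: the numbers `2 ^ l` and `64 * l`, where `l` is the exponent of `2` in `h + 4`;
* `4`: the address of the record that is being processed;
* `5`, `6`: the center of the process that is being run, and the outcome of the run;
* `7`, `8`: counters and intermediate results;
* `9`, `10`: the number of centers that enter a merge, and whether one of the halves enters with two
  centers that stand for a whole progression;
* `11`, `12`: the two numbers of Euclid's algorithm;
* `13` to `16`: the addresses of the records of the left half, the right half, the merged segment, and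
  the segment to its right;
* `17`, `18`: the first position of the merged segment, and the address of the next record.

The centers that enter a merge are collected in the cells `32` to `43`. The records begin at address
`64` and occupy eight cells each. In the record of a dense segment the third and the fourth cell of
data represent the set of the relevant processes that have succeeded since the segment was created,
as far as it matters: the first of them, or `0`, and whether there are at least two.
-/

/-- Append the segment of length `1`. -/
def appendProg : Program :=
  1 ::= cell 1 + 1 ;;
  4 ::= 8 * (cell 1 % 8) + 64 ;;
  cell 4 ::= cell 1 ;;
  cell 4 + 1 ::= 1 ;;
  cell 4 + 2 ::= 1 ;;
  cell 4 + 3 ::= cell 1 ;;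
  cell 4 + 7 ::= cell 0 ;;
  0 ::= cell 4

lemma exec_appendProg {ans : ℕ → ℕ} {s w h : ℕ} {M : Memory} (hM : Bounded w M)
    (hs : 200 ≤ s) (hw : 200 + h ≤ w) (h1 : M 1 = h) :
    ∃ M' t, Exec ans s w appendProg M M' t [] ∧ t ≤ costBound appendProg ∧ Bounded w M' ∧
      ∃ q, q = 8 * ((h + 1) % 8) + 64 ∧ M' 0 = q ∧ M' 1 = h + 1 ∧ M' q = h + 1 ∧ M' (q + 1) = 1 ∧
      M' (q + 2) = 1 ∧ M' (q + 3) = h + 1 ∧ M' (q + 7) = M 0 ∧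
      ∀ a, 64 ≤ a → a < q ∨ q + 8 ≤ a → M' a = M a := by
  apply exec_of_wp (by omega) hM
  have hr := Nat.mod_lt (h + 1) (show 0 < 8 by norm_num)
  have hr' : 8 * ((h + 1) % 8) < 64 := by omega
  simp [appendProg, wp, Fits', add_def, mul_def, mod_def, ofNat_def, zero_def, one_def,
    Expr.eval, WordOp.eval, Function.update_apply, h1]
  generalize 8 * ((h + 1) % 8) = r at *
  and_intros
  all_goals first | omega | skip
  intro a ha hb
  split_ifs <;> omega

/-- Find the level on which segments may be merged in this step: the exponent of `2` in
`h + 4`. -/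
def levelProg : Program :=
  (2 ::= 1 ;; 3 ::= 0) ;;
  .while (eqE ((cell 1 + 4) % (2 * cell 2)) 0)
    (2 ::= 2 * cell 2 ;;
    3 ::= cell 3 + 64)

lemma exec_levelProg {ans : ℕ → ℕ} {s w h : ℕ} {M : Memory} (hM : Bounded w M)
    (hs : 200 ≤ s) (hw : 200 * (h + 5) ≤ w) (h1 : M 1 = h) :
    ∃ M' t l j, Exec ans s w levelProg M M' t [] ∧ t ≤ 100 * (Nat.log 2 (h + 4) + 1) ∧
      Bounded w M' ∧ h + 4 = 2 ^ l * (2 * j + 1) ∧ M' 2 = 2 ^ l ∧ M' 3 = 64 * l ∧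
      ∀ a, a ≠ 2 → a ≠ 3 → M' a = M a := by
  obtain ⟨l, m, ⟨j, rfl⟩, hl⟩ := Nat.exists_eq_two_pow_mul_odd (n := h + 4) (by omega)
  have hllog : l ≤ Nat.log 2 (h + 4) := by
    apply Nat.le_log_of_pow_le (by norm_num)
    rw [hl]; exact Nat.le_mul_of_pos_right _ (by omega)
  obtain ⟨M₁, t₁, hE₁, ht₁, hB₁, h₂, h₃, hf⟩ : ∃ M' t, Exec ans s w (2 ::= 1 ;; 3 ::= 0) M M' t [] ∧
      t ≤ costBound (2 ::= 1 ;; 3 ::= 0) ∧ Bounded w M' ∧ M' 2 = 1 ∧ M' 3 = 0 ∧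
      ∀ a, a ≠ 2 → a ≠ 3 → M' a = M a := by
    apply exec_of_wp (by omega) hM
    simp [wp, Fits', ofNat_def, one_def, Expr.eval, Function.update_apply]
    and_intros
    all_goals first | omega | skip
    intro a ha hb
    simp [ha, hb]
  obtain ⟨M₂, t₂, L₂, hE₂, hL₂, ht₂, hB₂, h₂', h₃', hf'⟩ := exec_while (ans := ans) (s := s)
    (w := w) (e := eqE ((cell 1 + 4) % (2 * cell 2)) 0) (p := 2 ::= 2 * cell 2 ;; 3 ::= cell 3 + 64)
    (fun k M' t L => L = [] ∧ k ≤ l ∧ t ≤ 30 * (l - k) ∧ Bounded w M' ∧ M' 2 = 2 ^ (l - k) ∧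
      M' 3 = 64 * (l - k) ∧ ∀ a, a ≠ 2 → a ≠ 3 → M' a = M a)
    (Q := fun M' t L => L = [] ∧ t ≤ 30 * l + 20 ∧ Bounded w M' ∧ M' 2 = 2 ^ l ∧
      M' 3 = 64 * l ∧ ∀ a, a ≠ 2 → a ≠ 3 → M' a = M a) (by
    rintro k M' t L ⟨rfl, hk, ht, hB, e₂, e₃, hf⟩
    have e₁ : M' 1 = h := by rw [hf 1 (by norm_num) (by norm_num), h1]
    have hle : 2 ^ (l - k) ≤ h + 4 := by
      calc 2 ^ (l - k) ≤ 2 ^ l := Nat.pow_le_pow_right (by norm_num) (Nat.sub_le _ _)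
        _ ≤ h + 4 := by rw [hl]; exact Nat.le_mul_of_pos_right _ (by omega)
    have hlt := Nat.lt_two_pow_self (n := l - k)
    refine ⟨(fits_of_fits' (by omega) hB ?_).1, ?_⟩
    · simp only [Fits', add_def, mul_def, mod_def, ofNat_def, zero_def, Expr.eval, WordOp.eval,
        e₁, e₂]
      omega
    have hcost : (eqE ((cell 1 + 4) % (2 * cell 2)) 0).cost = 11 := rfl
    have heval : (eqE ((cell 1 + 4) % (2 * cell 2)) 0).eval M' =
        if (h + 4) % (2 * 2 ^ (l - k)) = 0 then 1 else 0 := by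
      simp only [add_def, mul_def, mod_def, ofNat_def, zero_def, Expr.eval, WordOp.eval, e₁, e₂]
    rcases k with _ | k
    · left
      rw [hcost]
      refine ⟨?_, rfl, by omega, hB, by simpa using e₂, by simpa using e₃, hf⟩
      rw [heval, if_neg]
      intro h0
      obtain ⟨i, hi⟩ := Nat.dvd_of_mod_eq_zero h0
      rw [hl, Nat.sub_zero, mul_assoc, mul_left_comm] at hi
      have := Nat.eq_of_mul_eq_mul_left (by positivity) hi
      omega
    · right
      have hlk : l - k = l - (k + 1) + 1 := by omega
      refine ⟨k, rfl, ?_, ?_⟩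
      · rw [heval, if_pos]
        · norm_num
        · apply Nat.mod_eq_zero_of_dvd
          rw [hl, ← pow_succ', ← hlk]
          exact Dvd.dvd.mul_right (pow_dvd_pow _ (Nat.sub_le _ _)) _
      · obtain ⟨M₃, t₃, hE₃, ht₃, hB₃, h₃⟩ := exec_of_wp (ans := ans) (s := s) (w := w)
          (by omega) (p := 2 ::= 2 * cell 2 ;; 3 ::= cell 3 + 64) (M := M')
          (Q := fun M₃ => M₃ 2 = 2 ^ (l - k) ∧ M₃ 3 = 64 * (l - k) ∧
            ∀ a, a ≠ 2 → a ≠ 3 → M₃ a = M a) hB (by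
            simp [wp, Fits', add_def, mul_def, ofNat_def, Expr.eval,
              WordOp.eval, Function.update_apply, e₂, e₃]
            and_intros
            all_goals first | omega | skip
            · rw [hlk, pow_succ']
            · intro a ha hb
              simp [ha, hb, hf])
        have hcost' : costBound (2 ::= 2 * cell 2 ;; 3 ::= cell 3 + 64) = 12 := rfl
        exact ⟨M₃, t₃, [], hE₃, rfl, by omega, by rw [hcost]; omega, hB₃, h₃⟩) l M₁ 0 []
      ⟨rfl, le_rfl, by simp, hB₁, by simpa using h₂, by simpa using h₃, hf⟩
  simp only [List.nil_append] at hL₂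
  subst hL₂
  refine ⟨M₂, _, l, j, .seq _ _ _ _ _ _ _ [] [] hE₁ hE₂, ?_, hB₂, hl, h₂', h₃', hf'⟩
  have : costBound (2 ::= 1 ;; 3 ::= 0) = 6 := rfl
  omega

/-! ### Collecting centers and computing their common divisor -/

/-- The consecutive cells from address `a` on contain the list `X`. -/
def ArrayAt (M : Memory) (a : ℕ) (X : List ℕ) : Prop :=
  ∀ i (hi : i < X.length), M (a + i) = X[i]

/-- The first `k` cells from address `a` on, as a list. -/
def cells (M : Memory) (a k : ℕ) : List ℕ := (List.range k).map fun i => M (a + i)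

lemma length_cells (M : Memory) (a k : ℕ) : (cells M a k).length = k := by simp [cells]

lemma arrayAt_iff {M : Memory} {a : ℕ} {X : List ℕ} :
    ArrayAt M a X ↔ cells M a X.length = X := by
  constructor
  · intro h
    apply List.ext_getElem (length_cells _ _ _)
    intro i h₁ h₂
    simp [cells, h i h₂]
  · intro h i hi
    have : (cells M a X.length)[i]'(by rwa [length_cells]) = X[i] := by simp only [h]
    simpa [cells] using this

lemma ArrayAt.append {M : Memory} {a : ℕ} {X Y : List ℕ} (hX : ArrayAt M a X)
    (hY : ArrayAt M (a + X.length) Y) : ArrayAt M a (X ++ Y) := by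
  intro i hi
  by_cases h : i < X.length
  · rw [List.getElem_append_left h]; exact hX i h
  · rw [List.getElem_append_right (by omega), ← hY (i - X.length) (by simp at hi; omega)]
    congr 1; omega

/-- The record at address `q` is that of a dense segment in which two different processes have
succeeded. -/
def Flagged (M : Memory) (q : ℕ) : Prop := M (q + 2) = 5 ∧ M (q + 6) ≠ 0

open Classical in
/-- The centers of the segment with the record at address `q` that matter for a merge: the listed
ones if the description is sparse; if it is dense, then two centers that generate all relevant
ones, provided that two different processes have succeeded, and otherwise the only one that has
succeeded. -/
noncomputable def centers (M : Memory) (q : ℕ) : List ℕ :=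
  if M (q + 2) = 5 then
    if M (q + 6) ≠ 0 then [M (q + 3), M (q + 3) + M (q + 4) / 2]
    else if M (q + 5) ≠ 0 then [M (q + 5)] else []
  else cells M (q + 3) (M (q + 2))

/-- Append the centers of the segment with the record at the address in cell `4` to the array that
starts at address `32` and whose length is in cell `9`. -/
def collectProg : Program :=
  .ite (eqE (.load (cell 4 + 2)) 5)
    (.ite (.load (cell 4 + 6))
      (cell 9 + 32 ::= .load (cell 4 + 3) ;;
      cell 9 + 33 ::= .load (cell 4 + 3) + .load (cell 4 + 4) / 2 ;;
      9 ::= cell 9 + 2 ;;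
      10 ::= 1)
      (.ite (.load (cell 4 + 5))
        (cell 9 + 32 ::= .load (cell 4 + 5) ;;
        9 ::= cell 9 + 1)
        .skip))
    (cell 9 + 32 ::= .load (cell 4 + 3) ;;
    cell 9 + 33 ::= .load (cell 4 + 4) ;;
    cell 9 + 34 ::= .load (cell 4 + 5) ;;
    cell 9 + 35 ::= .load (cell 4 + 6) ;;
    9 ::= cell 9 + .load (cell 4 + 2))

lemma exec_collectProg {ans : ℕ → ℕ} {s w r N n : ℕ} {M : Memory} (hM : Bounded w M)
    (hs : 200 ≤ s) (hr : r + 100 ≤ s) (hw : 200 + s + 2 * n ≤ w) (h4 : M 4 = r + 64) (h9 : M 9 = N)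
    (hN : N ≤ 4) (htag : M (r + 64 + 2) ≤ 5)
    (hd : M (r + 64 + 2) = 5 → M (r + 64 + 3) ≤ n ∧ M (r + 64 + 4) ≤ n) :
    ∃ M' t, Exec ans s w collectProg M M' t [] ∧ t ≤ costBound collectProg ∧ Bounded w M' ∧
      ArrayAt M' (32 + N) (centers M (r + 64)) ∧ M' 9 = N + (centers M (r + 64)).length ∧
      ((Flagged M (r + 64) ∧ M' 10 = 1) ∨ (¬ Flagged M (r + 64) ∧ M' 10 = M 10)) ∧
      ∀ a, a ≠ 9 → a ≠ 10 → a < 32 + N ∨ 44 ≤ a → M' a = M a := by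
  apply exec_of_wp (by omega) hM
  have hne : ∀ k, 30 ≤ k → ¬ r + k = N := by omega
  have hne' : ∀ k, 30 ≤ k → ¬ N = r + k := by omega
  by_cases h5 : M (r + 64 + 2) = 5
  · obtain ⟨hd₁, hd₂⟩ := hd h5
    have hdiv := Nat.div_le_self (M (r + 64 + 4)) 2
    by_cases h6 : M (r + 64 + 6) = 0
    · by_cases h7 : M (r + 64 + 5) = 0
      · simp [collectProg, wp, Fits', add_def, div_def, ofNat_def, one_def, Expr.eval,
          WordOp.eval, Function.update_apply, h4, h5, h6, h7, h9, centers, Flagged, ArrayAt]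
        omega
      · have hX : centers M (r + 64) = [M (r + 64 + 5)] := by simp [centers, h5, h6, h7]
        rw [hX]
        simp [collectProg, wp, Fits', add_def, div_def, ofNat_def, one_def, Expr.eval,
          WordOp.eval, Function.update_apply, h4, h5, h6, h7, h9, Flagged, ArrayAt, hne, hne']
        and_intros
        all_goals first | omega | skip
        · rw [if_neg (by omega), if_pos (by omega)]
        · intro a h₁ h₂ h₃
          rw [if_neg h₁, if_neg (by omega)]
    · have hX : centers M (r + 64) = [M (r + 64 + 3), M (r + 64 + 3) + M (r + 64 + 4) / 2] := by
        simp [centers, h5, h6]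
      rw [hX]
      simp [collectProg, wp, Fits', add_def, div_def, ofNat_def, one_def, Expr.eval,
        WordOp.eval, Function.update_apply, h4, h5, h6, h9, Flagged, ArrayAt, hne, hne']
      and_intros
      all_goals first | omega | skip
      · intro i hi
        rw [if_neg (by omega), if_neg (by omega)]
        interval_cases i
        · simp [show ¬ 32 + N = N + 33 by omega, show 32 + N = N + 32 by omega]
        · simp [show 32 + N + 1 = N + 33 by omega]
      · intro a h₁ h₂ h₃
        simp [h₁, h₂, show ¬ a = N + 33 by omega, show ¬ a = N + 32 by omega]
  · have hX : centers M (r + 64) = cells M (r + 64 + 3) (M (r + 64 + 2)) := by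
      simp [centers, h5]
    rw [hX]
    simp [collectProg, wp, Fits', add_def, div_def, ofNat_def, one_def, Expr.eval,
      WordOp.eval, Function.update_apply, h4, h5, h9, Flagged, ArrayAt, hne, hne', length_cells]
    and_intros
    all_goals first | omega | skip
    · intro i hi
      have hi4 : i < 4 := by omega
      rw [if_neg (by omega)]
      simp only [cells, List.getElem_map, List.getElem_range]
      interval_cases i
      · simp [show ¬ 32 + N = N + 33 by omega, show 32 + N = N + 32 by omega]
      · simp [show 32 + N + 1 = N + 33 by omega]
      · simp [show 32 + N + 2 = N + 34 by omega]
      · simp [show 32 + N + 3 = N + 35 by omega]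
    · intro a h₁ h₂ h₃
      simp [h₁, h₂, show ¬ a = N + 33 by omega, show ¬ a = N + 32 by omega,
        show ¬ a = N + 34 by omega, show ¬ a = N + 35 by omega]

/-- Two steps of Euclid's algorithm on the cells `11` and `12`. -/
def euclidBody : Program :=
  11 ::= cell 11 % cell 12 ;;
  .ite (cell 11) (12 ::= cell 12 % cell 11) (11 ::= cell 12 ;; 12 ::= 0)

lemma exec_euclid {ans : ℕ → ℕ} {s w k : ℕ} {M : Memory} (hM : Bounded w M)
    (hs : 200 ≤ s) (hw : 200 ≤ w) (hk : M 12 < 2 ^ k) :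
    ∃ M' t, Exec ans s w (.while (cell 12) euclidBody) M M' t [] ∧ t ≤ 30 * k + 10 ∧
      Bounded w M' ∧ M' 11 = Nat.gcd (M 11) (M 12) ∧ ∀ a, a ≠ 11 → a ≠ 12 → M' a = M a := by
  obtain ⟨M₂, t₂, L₂, hE₂, hL₂, h₂⟩ := exec_while (ans := ans) (s := s) (w := w) (e := cell 12)
    (p := euclidBody)
    (fun i M' t L => L = [] ∧ i ≤ k ∧ t ≤ 30 * (k - i) ∧ Bounded w M' ∧ M' 12 < 2 ^ i ∧
      Nat.gcd (M' 11) (M' 12) = Nat.gcd (M 11) (M 12) ∧ ∀ a, a ≠ 11 → a ≠ 12 → M' a = M a)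
    (Q := fun M' t L => L = [] ∧ t ≤ 30 * k + 10 ∧ Bounded w M' ∧
      M' 11 = Nat.gcd (M 11) (M 12) ∧ ∀ a, a ≠ 11 → a ≠ 12 → M' a = M a) (by
    rintro i M' t L ⟨rfl, hi, ht, hB, h12, hg, hf⟩
    refine ⟨⟨by simp [Expr.Fits]; omega, by simp [Expr.eval]; omega, hB _⟩, ?_⟩
    have hcost : (cell 12).cost = 2 := rfl
    rw [hcost]
    by_cases h0 : M' 12 = 0
    · left
      exact ⟨h0, rfl, by omega, hB, by rw [← hg, h0, Nat.gcd_zero_right], hf⟩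
    · right
      rcases i with _ | i
      · simp at h12; omega
      refine ⟨i, rfl, h0, ?_⟩
      have hlt := Nat.mod_lt (M' 11) (Nat.pos_of_ne_zero h0)
      have hgcd : Nat.gcd (M' 11 % M' 12) (M' 12) = Nat.gcd (M' 11) (M' 12) := by
        rw [Nat.gcd_comm (M' 11), Nat.gcd_rec (M' 12)]
      -- the smaller number is at least halved by two steps
      have hhalf : M' 11 % M' 12 ≠ 0 → 2 * (M' 12 % (M' 11 % M' 12)) < M' 12 := by
        intro hne
        have h₁ := Nat.mod_lt (M' 12) (Nat.pos_of_ne_zero hne)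
        have h₂ := Nat.div_add_mod (M' 12) (M' 11 % M' 12)
        have h₃ : 0 < M' 12 / (M' 11 % M' 12) := Nat.div_pos hlt.le (Nat.pos_of_ne_zero hne)
        have h₄ := Nat.mul_le_mul_left (M' 11 % M' 12) h₃
        omega
      have hgcd' : Nat.gcd (M' 11 % M' 12) (M' 12 % (M' 11 % M' 12)) =
          Nat.gcd (M' 11 % M' 12) (M' 12) := by
        rw [Nat.gcd_comm, ← Nat.gcd_rec]
      obtain ⟨M₃, t₃, hE₃, ht₃, hB₃, h₃⟩ := exec_of_wp (ans := ans) (s := s) (w := w)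
        (by omega) (p := euclidBody) (M := M') (Q := fun M₃ => M₃ 12 < 2 ^ i ∧
          Nat.gcd (M₃ 11) (M₃ 12) = Nat.gcd (M 11) (M 12) ∧
          ∀ a, a ≠ 11 → a ≠ 12 → M₃ a = M a) hB (by
          rw [pow_succ] at h12
          have hpos : 0 < 2 ^ i := by positivity
          by_cases he : M' 11 % M' 12 = 0
          · simp [euclidBody, wp, Fits', mod_def, ofNat_def, zero_def, Expr.eval, WordOp.eval,
              Function.update_apply, he]
            and_intros
            all_goals first | omega | skip
            · rw [← hg, ← hgcd, he, Nat.gcd_zero_left]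
            · intro a h₁ h₂
              simp [h₁, h₂, hf]
          · simp [euclidBody, wp, Fits', mod_def, ofNat_def, zero_def, Expr.eval, WordOp.eval,
              Function.update_apply, he]
            have := hhalf he
            and_intros
            all_goals first | omega | skip
            · intro a h₁ h₂
              simp [h₁, h₂, hf])
      have hcost' : costBound euclidBody ≤ 25 := by decide
      exact ⟨M₃, t₃, [], hE₃, rfl, by omega, by omega, hB₃, h₃⟩) k M 0 []
    ⟨rfl, le_rfl, by omega, hM, hk, rfl, fun _ _ _ => rfl⟩
  simp only [List.nil_append, zero_add] at hL₂ h₂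
  subst hL₂
  exact ⟨M₂, t₂, hE₂, h₂⟩

/-- Compute the greatest common divisor of the distances between the elements of the array. -/
def gcdProg : Program :=
  (11 ::= 0 ;; 7 ::= 0) ;;
  .while (ltE (cell 7) (cell 9))
    (12 ::= .load (cell 7 + 32) - cell 32 + (cell 32 - .load (cell 7 + 32)) ;;
    .while (cell 12) euclidBody ;;
    7 ::= cell 7 + 1)

lemma exec_gcdProg {ans : ℕ → ℕ} {s w k : ℕ} {X : List ℕ} {M : Memory} (hM : Bounded w M)
    (hs : 200 ≤ s) (hw : 200 + 2 ^ k ≤ w) (h9 : M 9 = X.length) (hN : X.length ≤ 8)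
    (hX : ArrayAt M 32 X) (hk : ∀ x ∈ X, x < 2 ^ k) :
    ∃ M' t, Exec ans s w gcdProg M M' t [] ∧ t ≤ 1000 * (k + 1) ∧
      Bounded w M' ∧ M' 11 = gcdDist (M 32) X ∧
      ∀ a, a ≠ 7 → a ≠ 11 → a ≠ 12 → M' a = M a := by
  have hpos : 0 < 2 ^ k := by positivity
  obtain ⟨M₁, t₁, hE₁, ht₁, hB₁, h₁₁, h₇, hf⟩ : ∃ M' t, Exec ans s w (11 ::= 0 ;; 7 ::= 0) M M' t []
      ∧ t ≤ costBound (11 ::= 0 ;; 7 ::= 0) ∧ Bounded w M' ∧ M' 11 = 0 ∧ M' 7 = 0 ∧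
      ∀ a, a ≠ 7 → a ≠ 11 → a ≠ 12 → M' a = M a := by
    apply exec_of_wp (by omega) hM
    simp [wp, Fits', ofNat_def, zero_def, one_def, Expr.eval, Function.update_apply]
    refine ⟨by omega, by omega, by omega, by omega, ?_⟩
    intro a ha hb
    simp [ha, hb]
  obtain ⟨M₂, t₂, L₂, hE₂, hL₂, h₂⟩ := exec_while (ans := ans) (s := s) (w := w)
    (e := ltE (cell 7) (cell 9))
    (p := 12 ::= .load (cell 7 + 32) - cell 32 + (cell 32 - .load (cell 7 + 32)) ;;
      .while (cell 12) euclidBody ;; 7 ::= cell 7 + 1)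
    (fun i M' t L => L = [] ∧ i ≤ X.length ∧ t ≤ (100 + 30 * k) * (X.length - i) ∧ Bounded w M' ∧
      M' 7 = X.length - i ∧ M' 11 = gcdDist (M 32) (X.take (X.length - i)) ∧
      ∀ a, a ≠ 7 → a ≠ 11 → a ≠ 12 → M' a = M a)
    (Q := fun M' t L => L = [] ∧ t ≤ (100 + 30 * k) * X.length + 10 ∧ Bounded w M' ∧
      M' 11 = gcdDist (M 32) X ∧ ∀ a, a ≠ 7 → a ≠ 11 → a ≠ 12 → M' a = M a) (by
    rintro i M' t L ⟨rfl, hi, ht, hB, e7, hg, hf⟩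
    have e9 : M' 9 = X.length := by rw [hf 9 (by norm_num) (by norm_num) (by norm_num), h9]
    have e32 : M' 32 = M 32 := hf 32 (by norm_num) (by norm_num) (by norm_num)
    refine ⟨(fits_of_fits' (by omega) hB ?_).1, ?_⟩
    · simp [Fits', Expr.eval]; omega
    have hcost : (ltE (cell 7) (cell 9)).cost = 5 := rfl
    have heval : (ltE (cell 7) (cell 9)).eval M' = if X.length - i < X.length then 1 else 0 := by
      simp [Expr.eval, WordOp.eval, e7, e9]
    rw [hcost, heval]
    rcases i with _ | i
    · left
      simp only [Nat.sub_zero, List.take_length] at hg ht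
      exact ⟨by simp, rfl, by omega, hB, hg, hf⟩
    right
    refine ⟨i, rfl, by rw [if_pos (by omega)]; norm_num, ?_⟩
    obtain ⟨j, hj⟩ : ∃ j, X.length - (i + 1) = j := ⟨_, rfl⟩
    have hj' : X.length - i = j + 1 := by omega
    have hjX : j < X.length := by omega
    rw [hj] at hg ht e7
    have ej : M' (j + 32) = X[j] := by
      rw [hf _ (by omega) (by omega) (by omega), add_comm]; exact hX j hjX
    have hj2 := hk X[j] (List.getElem_mem hjX)
    have h02 : M 32 < 2 ^ k := by
      have := hX 0 (by omega)
      rw [Nat.add_zero] at this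
      rw [this]; exact hk _ (List.getElem_mem _)
    obtain ⟨M₃, t₃, hE₃, ht₃, hB₃, h₁₂, h₃⟩ := exec_of_wp (ans := ans) (s := s) (w := w)
      (by omega) (p := 12 ::= .load (cell 7 + 32) - cell 32 + (cell 32 - .load (cell 7 + 32)))
      (M := M') (Q := fun M₃ => M₃ 12 = (X[j] - M 32) + (M 32 - X[j]) ∧
        ∀ a, a ≠ 12 → M₃ a = M' a) hB (by
        simp [wp, Fits', add_def, sub_def, ofNat_def, zero_def, Expr.eval, WordOp.eval,
          Function.update_apply, e7, ej, e32]
        and_intros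
        all_goals omega)
    obtain ⟨M₄, t₄, hE₄, ht₄, hB₄, h₁₁, h₄⟩ := exec_euclid (ans := ans) (s := s) (w := w) (k := k)
      hB₃ hs (by omega) (by omega)
    obtain ⟨M₅, t₅, hE₅, ht₅, hB₅, h₇, h₅⟩ := exec_of_wp (ans := ans) (s := s) (w := w)
      (by omega) (p := 7 ::= cell 7 + 1) (M := M₄) (Q := fun M₅ => M₅ 7 = M₄ 7 + 1 ∧
        ∀ a, a ≠ 7 → M₅ a = M₄ a) hB₄ (by
        have e : M₄ 7 = j := by
          rw [h₄ _ (by norm_num) (by norm_num), h₃ _ (by norm_num), e7]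
        simp [wp, Fits', add_def, ofNat_def, one_def, Expr.eval, WordOp.eval,
          Function.update_apply, e]
        and_intros
        all_goals omega)
    have hc₃ : costBound (12 ::= .load (cell 7 + 32) - cell 32 + (cell 32 - .load (cell 7 + 32)))
      ≤ 40 := by decide
    have hc₅ : costBound (7 ::= cell 7 + 1) ≤ 10 := by decide
    refine ⟨M₅, _, [], .seq _ _ _ _ _ _ _ [] [] hE₃ (.seq _ _ _ _ _ _ _ [] [] hE₄ hE₅),
      rfl, by omega, ?_, hB₅, ?_, ?_, ?_⟩
    · rw [hj', Nat.mul_succ]; omega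
    · rw [h₇, h₄ _ (by norm_num) (by norm_num), h₃ _ (by norm_num), e7, hj']
    · rw [hj', List.take_succ_eq_append_getElem hjX, gcdDist_append, h₅ _ (by norm_num), h₁₁,
        h₃ _ (by norm_num), hg, h₁₂]
    · intro a h₁ h₂ h₃'
      rw [h₅ a h₁, h₄ a h₂ h₃', h₃ a h₃', hf a h₁ h₂ h₃']) X.length M₁ 0 []
    ⟨rfl, le_rfl, by omega, hB₁, by simpa using h₇, by simp [h₁₁, gcdDist], hf⟩
  simp only [List.nil_append, zero_add] at hL₂ h₂
  subst hL₂
  refine ⟨M₂, _, .seq _ _ _ _ _ _ _ [] [] hE₁ hE₂, ?_, h₂.2⟩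
  have hc : costBound (11 ::= 0 ;; 7 ::= 0) = 6 := rfl
  have := Nat.mul_le_mul_left (100 + 30 * k) hN
  have := h₂.1
  omega

/-! ### Merging the records of two segments -/

/-- The address of the record of the segment number `k` of length `2 ^ l`. At any time, the
segments of each length that are in use have at most eight consecutive numbers, so that eight records
for each level suffice. -/
def addr (l k : ℕ) : ℕ := 64 * l + 8 * (k % 8) + 64

/-- Compute the addresses of the records that take part in a merge. -/
def addressProg : Program :=
  8 ::= (cell 1 + 4 - 7 * cell 2) / cell 2 ;;
  14 ::= cell 3 + 8 * (cell 8 % 8) + 64 ;;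
  13 ::= cell 3 + 8 * ((cell 8 + 7) % 8) + 64 ;;
  15 ::= cell 3 + 8 * (cell 8 / 2 % 8) + 128 ;;
  16 ::= cell 3 + 8 * ((cell 8 + 1) % 8) + 64

/-- Save the cells of the left segment that the merged segment inherits, and initialize the array
of centers. -/
def prepareProg : Program :=
  17 ::= .load (cell 13) ;;
  18 ::= .load (cell 13 + 7) ;;
  9 ::= 0 ;;
  10 ::= 0 ;;
  4 ::= cell 13

lemma exec_addressProg {ans : ℕ → ℕ} {s w h l j : ℕ} {M : Memory} (hM : Bounded w M)
    (hs : 64 * l + 300 ≤ s) (hw : 500 * (h + 5) ≤ w) (hw' : s + 100 ≤ w) (h1 : M 1 = h)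
    (h2 : M 2 = 2 ^ l) (h3 : M 3 = 64 * l) (hj : h + 4 = 2 ^ l * (2 * j + 9)) :
    ∃ M' t, Exec ans s w addressProg M M' t [] ∧ t ≤ costBound addressProg ∧ Bounded w M' ∧
      M' 13 = addr l (2 * j + 1) ∧ M' 14 = addr l (2 * j + 2) ∧ M' 15 = addr (l + 1) (j + 1) ∧
      M' 16 = addr l (2 * j + 3) ∧ ∀ a, a < 4 ∨ 19 ≤ a → M' a = M a := by
  apply exec_of_wp (by omega) hM
  have hpos : 0 < 2 ^ l := by positivity
  have hdiv : (h + 4 - 7 * 2 ^ l) / 2 ^ l = 2 * j + 2 := by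
    rw [hj, show 2 ^ l * (2 * j + 9) - 7 * 2 ^ l = 2 ^ l * (2 * j + 2) by
      rw [show 2 ^ l * (2 * j + 9) = 2 ^ l * (2 * j + 2) + 7 * 2 ^ l by ring]; omega,
      Nat.mul_div_cancel_left _ hpos]
  have hle : 2 ^ l ≤ h + 4 := by rw [hj]; exact Nat.le_mul_of_pos_right _ (by omega)
  have hjh : 2 * j + 9 ≤ h + 4 := by rw [hj]; exact Nat.le_mul_of_pos_left _ hpos
  simp only [addressProg, wp, Fits', add_def, sub_def, mul_def, div_def, mod_def, ofNat_def,
    Expr.eval, WordOp.eval, Function.update_apply, h1, h2, h3, hdiv, Nat.reduceEqDiff, if_true,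
    if_false, addr]
  clear hdiv hj
  generalize 2 ^ l = m at *
  and_intros
  all_goals first | omega | trivial | skip
  intro a ha
  split_ifs <;> omega

lemma exec_prepareProg {ans : ℕ → ℕ} {s w q : ℕ} {M : Memory} (hM : Bounded w M)
    (hs : q + 64 ≤ s) (hs' : 200 ≤ s) (hw : s + 200 ≤ w) (h13 : M 13 = q) (hq : 64 ≤ q) :
    ∃ M' t, Exec ans s w prepareProg M M' t [] ∧ t ≤ costBound prepareProg ∧ Bounded w M' ∧
      M' 17 = M q ∧ M' 18 = M (q + 7) ∧ M' 9 = 0 ∧ M' 10 = 0 ∧ M' 4 = q ∧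
      ∀ a, a ≠ 4 → a ≠ 9 → a ≠ 10 → a ≠ 17 → a ≠ 18 → M' a = M a := by
  apply exec_of_wp (by omega) hM
  obtain ⟨r, rfl⟩ := Nat.exists_eq_add_of_le' hq
  simp [prepareProg, wp, Fits', add_def, ofNat_def, zero_def, Expr.eval, WordOp.eval,
    Function.update_apply, h13]
  and_intros
  all_goals first | omega | skip
  intro a h₁ h₂ h₃ h₄ h₅
  simp [h₁, h₂, h₃, h₄, h₅]

/-- Write the record of a merged segment with a dense description. -/
def writeDense : Program :=
  cell 15 ::= cell 17 ;;
  cell 15 + 1 ::= 2 * cell 2 ;;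
  cell 15 + 2 ::= 5 ;;
  cell 15 + 3 ::= cell 17 + (cell 32 - cell 17) % cell 11 ;;
  cell 15 + 4 ::= 2 * cell 11 ;;
  cell 15 + 5 ::= 0 ;;
  cell 15 + 6 ::= 0 ;;
  cell 15 + 7 ::= cell 18 ;;
  cell 16 + 7 ::= cell 15

/-- Write the record of a merged segment with a sparse description. -/
def writeSparse : Program :=
  cell 15 ::= cell 17 ;;
  cell 15 + 1 ::= 2 * cell 2 ;;
  cell 15 + 2 ::= cell 9 ;;
  cell 15 + 3 ::= cell 32 ;;
  cell 15 + 4 ::= cell 33 ;;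
  cell 15 + 5 ::= cell 34 ;;
  cell 15 + 6 ::= cell 35 ;;
  cell 15 + 7 ::= cell 18 ;;
  cell 16 + 7 ::= cell 15

/-- The effect of writing the record at address `qp`, apart from the description: its length is `m`,
and it is linked from the record at address `q₀`. -/
def Linked (M M' : Memory) (qp q₀ m : ℕ) : Prop :=
  M' qp = M 17 ∧ M' (qp + 1) = m ∧ M' (qp + 7) = M 18 ∧ M' (q₀ + 7) = qp ∧
    ∀ a, a < qp ∨ qp + 8 ≤ a → a ≠ q₀ + 7 → M' a = M a

lemma exec_writeDense {ans : ℕ → ℕ} {s w m a G x qp q₀ : ℕ} {M : Memory} (hM : Bounded w M)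
    (hs : 200 ≤ s) (hqs : qp + 64 ≤ s) (hqs' : q₀ + 64 ≤ s) (hw : s + 200 ≤ w)
    (hw' : 2 * m + 2 * G + a + x ≤ w) (h15 : M 15 = qp) (h16 : M 16 = q₀) (h2 : M 2 = m)
    (h17 : M 17 = a) (h11 : M 11 = G) (h32 : M 32 = x) (hq : 64 ≤ qp) (hq₀ : 64 ≤ q₀)
    (hd : q₀ + 8 ≤ qp ∨ qp + 8 ≤ q₀) :
    ∃ M' t, Exec ans s w writeDense M M' t [] ∧ t ≤ costBound writeDense ∧ Bounded w M' ∧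
      Linked M M' qp q₀ (2 * m) ∧ M' (qp + 2) = 5 ∧ M' (qp + 3) = a + (x - a) % G ∧
      M' (qp + 4) = 2 * G ∧ M' (qp + 5) = 0 ∧ M' (qp + 6) = 0 := by
  apply exec_of_wp (by omega) hM
  have hmod := Nat.mod_le (x - a) G
  obtain ⟨r, rfl⟩ := Nat.exists_eq_add_of_le' hq
  obtain ⟨r', rfl⟩ := Nat.exists_eq_add_of_le' hq₀
  have hne : ∀ i j, i < 8 → j < 8 → ¬ r + 64 + i = r' + 64 + j := by omega
  have hne₀ : ∀ j, j < 8 → ¬ r + 64 = r' + 64 + j := by omega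
  simp only [writeDense, wp, Fits', add_def, sub_def, mul_def, mod_def, ofNat_def, zero_def,
    one_def, Expr.eval, WordOp.eval, Function.update_apply, h2, h11, h15, h16, h17, h32, Linked]
  simp [hne, hne₀]
  and_intros
  all_goals first | omega | skip
  intro b h₁ h₂
  split_ifs <;> omega

lemma exec_writeSparse {ans : ℕ → ℕ} {s w m qp q₀ : ℕ} {X : List ℕ} {M : Memory}
    (hM : Bounded w M) (hs : 200 ≤ s) (hqs : qp + 64 ≤ s) (hqs' : q₀ + 64 ≤ s) (hw : s + 200 ≤ w)
    (hw' : 2 * m ≤ w) (h15 : M 15 = qp) (h16 : M 16 = q₀) (h2 : M 2 = m)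
    (h9 : M 9 = X.length) (hX : ArrayAt M 32 X) (hN : X.length ≤ 4) (hq : 64 ≤ qp) (hq₀ : 64 ≤ q₀)
    (hd : q₀ + 8 ≤ qp ∨ qp + 8 ≤ q₀) :
    ∃ M' t, Exec ans s w writeSparse M M' t [] ∧ t ≤ costBound writeSparse ∧ Bounded w M' ∧
      Linked M M' qp q₀ (2 * m) ∧ M' (qp + 2) = X.length ∧ ArrayAt M' (qp + 3) X := by
  apply exec_of_wp (by omega) hM
  obtain ⟨r, rfl⟩ := Nat.exists_eq_add_of_le' hq
  obtain ⟨r', rfl⟩ := Nat.exists_eq_add_of_le' hq₀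
  have hne : ∀ i j, i < 8 → j < 8 → ¬ r + 64 + i = r' + 64 + j := by omega
  have hne₀ : ∀ j, j < 8 → ¬ r + 64 = r' + 64 + j := by omega
  simp only [writeSparse, wp, Fits', add_def, sub_def, mul_def, mod_def, ofNat_def, zero_def,
    one_def, Expr.eval, WordOp.eval, Function.update_apply, h2, h9, h15, h16, Linked]
  simp [hne, hne₀]
  and_intros
  all_goals first | omega | skip
  · intro b h₁ h₂
    split_ifs <;> omega
  · intro i hi
    have := hX i hi
    have hi4 : i < 4 := by omega
    rw [← this]
    interval_cases i <;> simp [Function.update_apply, hne] <;> omega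

lemma cells_congr {M M' : Memory} {a k : ℕ} (h : ∀ i, i < k → M' (a + i) = M (a + i)) :
    cells M' a k = cells M a k := by
  unfold cells
  apply List.map_congr_left
  intro i hi
  exact h i (List.mem_range.1 hi)

lemma centers_congr {M M' : Memory} {q : ℕ} (hq : M (q + 2) ≤ 5)
    (h : ∀ i, i < 8 → M' (q + i) = M (q + i)) : centers M' q = centers M q := by
  unfold centers
  rw [h 2 (by norm_num), h 3 (by norm_num), h 4 (by norm_num), h 5 (by norm_num),
    h 6 (by norm_num)]
  split_ifs with h5
  · rfl
  · rfl
  · rfl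
  · apply cells_congr
    intro i hi
    rw [add_assoc, h (3 + i) (by omega)]

lemma length_centers_le {M : Memory} {q : ℕ} (hq : M (q + 2) ≤ 5) : (centers M q).length ≤ 4 := by
  unfold centers
  split_ifs
  · simp
  · simp
  · simp
  · rw [length_cells]; omega

lemma gcdDist_lt {x₀ B : ℕ} (X : List ℕ) (hB : 0 < B) (h₀ : x₀ < B) (hX : ∀ x ∈ X, x < B) :
    gcdDist x₀ X < B := by
  induction X using List.reverseRecOn with
  | nil => simpa [gcdDist] using hB
  | append_singleton X y ih =>
    rw [gcdDist_append]
    have h₁ := ih fun x hx => hX x (by simp [hx])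
    have h₂ := hX y (by simp)
    rcases Nat.eq_zero_or_pos (gcdDist x₀ X) with h | h
    · rw [h, Nat.gcd_zero_left]; omega
    · exact (Nat.gcd_le_left _ h).trans_lt h₁

/-- Merge two adjacent segments of length `2 ^ l`, where `2 ^ l` is in cell `2`, and `64 * l` is in
cell `3`. -/
def mergeProg : Program :=
  addressProg ;; prepareProg ;; collectProg ;; 4 ::= cell 14 ;; collectProg ;;
  .ite (cell 10 + ltE 4 (cell 9)) (gcdProg ;; writeDense) writeSparse

/-- The description of a merged segment with record at address `qp` and first position `a`, in terms
of the list `X` of centers of its halves; `fl` says that one of the halves enters the merge with two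
centers that stand for a whole progression. -/
def MergedDesc (M' : Memory) (qp a : ℕ) (fl : Prop) (X : List ℕ) : Prop :=
  ((fl ∨ 5 ≤ X.length) ∧ M' (qp + 2) = 5 ∧
    M' (qp + 3) = a + (X.headD 0 - a) % gcdDist (X.headD 0) X ∧
    M' (qp + 4) = 2 * gcdDist (X.headD 0) X ∧ M' (qp + 5) = 0 ∧ M' (qp + 6) = 0) ∨
  (¬ fl ∧ X.length ≤ 4 ∧ M' (qp + 2) = X.length ∧ cells M' (qp + 3) X.length = X)

/-- The merge takes place in step `h`, if `h + 4 = 2 ^ l * (2 * j + 9)`. The halves are the segments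
number `2 * j + 1` and `2 * j + 2` of length `2 ^ l`, and number `2 * j + 3` is the segment to their
right, whose record has to be linked to the new one. -/
lemma exec_mergeProg {ans : ℕ → ℕ} {s w h l j k : ℕ} {M : Memory} (hM : Bounded w M)
    (hs : 64 * l + 300 ≤ s) (hw : 500 * (h + 5) ≤ w) (hw' : 2 * s + 400 + 10 * 2 ^ k ≤ w)
    (hh : 2 * (h + 5) + 10 * 2 ^ k ≤ w) (h1 : M 1 = h) (h2 : M 2 = 2 ^ l) (h3 : M 3 = 64 * l)
    (hj : h + 4 = 2 ^ l * (2 * j + 9)) {q₁ q₂ q₀ qp : ℕ} (hq₁ : q₁ = addr l (2 * j + 1))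
    (hq₂ : q₂ = addr l (2 * j + 2)) (hq₀ : q₀ = addr l (2 * j + 3))
    (hqp : qp = addr (l + 1) (j + 1)) (ha : M q₁ < 2 ^ k) (t₁ : M (q₁ + 2) ≤ 5)
    (t₂ : M (q₂ + 2) ≤ 5) (d₁ : M (q₁ + 2) = 5 → M (q₁ + 3) < 2 ^ k ∧ M (q₁ + 4) < 2 ^ k)
    (d₂ : M (q₂ + 2) = 5 → M (q₂ + 3) < 2 ^ k ∧ M (q₂ + 4) < 2 ^ k)
    (hX : ∀ x ∈ centers M q₁ ++ centers M q₂, x < 2 ^ k) :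
    ∃ M' t, Exec ans s w mergeProg M M' t [] ∧ t ≤ 5000 * (k + 1) ∧ Bounded w M' ∧
      M' 0 = M 0 ∧ M' 1 = M 1 ∧ M' qp = M q₁ ∧ M' (qp + 1) = 2 ^ (l + 1) ∧
      M' (qp + 7) = M (q₁ + 7) ∧ M' (q₀ + 7) = qp ∧
      MergedDesc M' qp (M q₁) (Flagged M q₁ ∨ Flagged M q₂) (centers M q₁ ++ centers M q₂) ∧
      ∀ a, 64 ≤ a → a < qp ∨ qp + 8 ≤ a → a ≠ q₀ + 7 → M' a = M a := by
  classical
  have hpos : 0 < 2 ^ l := by positivity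
  have hposk : 0 < 2 ^ k := by positivity
  have hle : 2 ^ l ≤ h + 4 := by rw [hj]; exact Nat.le_mul_of_pos_right _ (by omega)
  have r₁ : 64 ≤ q₁ ∧ q₁ + 8 ≤ 64 * l + 128 := by rw [hq₁]; unfold addr; omega
  have r₂ : 64 ≤ q₂ ∧ q₂ + 8 ≤ 64 * l + 128 := by rw [hq₂]; unfold addr; omega
  have r₀ : 64 ≤ q₀ ∧ q₀ + 8 ≤ 64 * l + 128 := by rw [hq₀]; unfold addr; omega
  have rp : 64 * l + 128 ≤ qp ∧ qp ≤ 64 * l + 184 := by rw [hqp]; unfold addr; omega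
  have l₁ := length_centers_le t₁
  have l₂ := length_centers_le t₂
  obtain ⟨M₁, u₁, hE₁, hu₁, hB₁, a13, a14, a15, a16, f₁⟩ := exec_addressProg (ans := ans) hM hs hw
    (by omega) h1 h2 h3 hj
  rw [← hq₁] at a13
  rw [← hq₂] at a14
  rw [← hqp] at a15
  rw [← hq₀] at a16
  obtain ⟨M₂, u₂, hE₂, hu₂, hB₂, b17, b18, b9, b10, b4, f₂⟩ := exec_prepareProg (ans := ans)
    (s := s) hB₁ (by omega) (by omega) (by omega) a13 (by omega)
  have f₁₂ : ∀ a, 19 ≤ a → M₂ a = M a := fun a h => by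
    rw [f₂ a (by omega) (by omega) (by omega) (by omega) (by omega), f₁ a (by omega)]
  obtain ⟨e₁, he₁⟩ := Nat.exists_eq_add_of_le' r₁.1
  have c₁ : centers M₂ q₁ = centers M q₁ := centers_congr t₁ fun i hi => f₁₂ _ (by omega)
  have g₁ : Flagged M₂ q₁ ↔ Flagged M q₁ := by
    unfold Flagged; rw [f₁₂ _ (by omega), f₁₂ _ (by omega)]
  obtain ⟨M₃, u₃, hE₃, hu₃, hB₃, x₃, n₃, fl₃, f₃⟩ := exec_collectProg (ans := ans) (s := s) (r := e₁)
    (N := 0) (n := 2 ^ k) hB₂ (by omega) (by omega) (by omega) (by rw [b4, he₁]) b9 (by omega)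
    (by rw [← he₁, f₁₂ _ (by omega)]; exact t₁)
    (by rw [← he₁, f₁₂ _ (by omega), f₁₂ _ (by omega), f₁₂ _ (by omega)]
        exact fun h => ⟨(d₁ h).1.le, (d₁ h).2.le⟩)
  rw [← he₁, c₁] at x₃ n₃
  rw [← he₁, g₁] at fl₃
  simp only [Nat.add_zero, Nat.zero_add] at x₃ n₃
  have f₁₃ : ∀ a, 44 ≤ a → M₃ a = M a := fun a h => by
    rw [f₃ a (by omega) (by omega) (by omega), f₁₂ a (by omega)]
  have a14' : M₃ 14 = q₂ := by
    rw [f₃ _ (by norm_num) (by norm_num) (by norm_num), f₂ _ (by norm_num) (by norm_num)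
      (by norm_num) (by norm_num) (by norm_num), a14]
  obtain ⟨M₄, u₄, hE₄, hu₄, hB₄, b4', f₄⟩ := exec_of_wp (ans := ans) (s := s) (w := w)
    (p := 4 ::= cell 14) (M := M₃) (by omega) (Q := fun M' => M' 4 = q₂ ∧ ∀ a, a ≠ 4 → M' a = M₃ a)
    hB₃ (by
      simp [wp, Fits', ofNat_def, Expr.eval, Function.update_apply, a14']
      and_intros
      all_goals omega)
  obtain ⟨e₂, he₂⟩ := Nat.exists_eq_add_of_le' r₂.1
  have f₁₄ : ∀ a, 44 ≤ a → M₄ a = M a := fun a h => by rw [f₄ a (by omega), f₁₃ a h]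
  have c₂ : centers M₄ q₂ = centers M q₂ := centers_congr t₂ fun i hi => f₁₄ _ (by omega)
  have g₂ : Flagged M₄ q₂ ↔ Flagged M q₂ := by
    unfold Flagged; rw [f₁₄ _ (by omega), f₁₄ _ (by omega)]
  obtain ⟨M₅, u₅, hE₅, hu₅, hB₅, x₅, n₅, fl₅, f₅⟩ := exec_collectProg (ans := ans) (s := s) (r := e₂)
    (N := (centers M q₁).length) (n := 2 ^ k) hB₄ (by omega) (by omega) (by omega) (by rw [b4', he₂])
    (by rw [f₄ _ (by norm_num), n₃]) (by omega)
    (by rw [← he₂, f₁₄ _ (by omega)]; exact t₂)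
    (by rw [← he₂, f₁₄ _ (by omega), f₁₄ _ (by omega), f₁₄ _ (by omega)]
        exact fun h => ⟨(d₂ h).1.le, (d₂ h).2.le⟩)
  rw [← he₂, c₂] at x₅ n₅
  rw [← he₂, g₂, f₄ 10 (by norm_num)] at fl₅
  have f₁₅ : ∀ a, 44 ≤ a → M₅ a = M a := fun a h => by
    rw [f₅ a (by omega) (by omega) (by omega), f₁₄ a (by omega)]
  have reg : ∀ a, a < 32 → a ≠ 4 → a ≠ 9 → a ≠ 10 → M₅ a = M₂ a := fun a h h4 h9 h10 => by
    rw [f₅ a h9 h10 (by omega), f₄ a h4, f₃ a h9 h10 (by omega)]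
  have xs : ArrayAt M₅ 32 (centers M q₁ ++ centers M q₂) := by
    apply ArrayAt.append _ x₅
    intro i hi
    rw [f₅ _ (by omega) (by omega) (by omega), f₄ _ (by omega)]
    exact x₃ i hi
  rw [← List.length_append] at n₅
  set X := centers M q₁ ++ centers M q₂ with hXdef
  have hlen : X.length ≤ 8 := by rw [hXdef, List.length_append]; omega
  have m2 : M₅ 2 = 2 ^ l := by
    rw [reg _ (by norm_num) (by norm_num) (by norm_num) (by norm_num), f₂ _ (by norm_num)
      (by norm_num) (by norm_num) (by norm_num) (by norm_num), f₁ _ (by norm_num), h2]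
  have m15 : M₅ 15 = qp := by
    rw [reg _ (by norm_num) (by norm_num) (by norm_num) (by norm_num), f₂ _ (by norm_num)
      (by norm_num) (by norm_num) (by norm_num) (by norm_num), a15]
  have m16 : M₅ 16 = q₀ := by
    rw [reg _ (by norm_num) (by norm_num) (by norm_num) (by norm_num), f₂ _ (by norm_num)
      (by norm_num) (by norm_num) (by norm_num) (by norm_num), a16]
  have m17 : M₅ 17 = M q₁ := by
    rw [reg _ (by norm_num) (by norm_num) (by norm_num) (by norm_num), b17, f₁ _ (by omega)]
  have m18 : M₅ 18 = M (q₁ + 7) := by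
    rw [reg _ (by norm_num) (by norm_num) (by norm_num) (by norm_num), b18, f₁ _ (by omega)]
  have m0 : M₅ 0 = M 0 := by
    rw [reg _ (by norm_num) (by norm_num) (by norm_num) (by norm_num), f₂ _ (by norm_num)
      (by norm_num) (by norm_num) (by norm_num) (by norm_num), f₁ _ (by norm_num)]
  have m1 : M₅ 1 = M 1 := by
    rw [reg _ (by norm_num) (by norm_num) (by norm_num) (by norm_num), f₂ _ (by norm_num)
      (by norm_num) (by norm_num) (by norm_num) (by norm_num), f₁ _ (by norm_num)]
  have m10 : M₅ 10 = if Flagged M q₁ ∨ Flagged M q₂ then 1 else 0 := by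
    rcases fl₅ with ⟨h, e⟩ | ⟨h, e⟩
    · rw [e, if_pos (Or.inr h)]
    · rcases fl₃ with ⟨h', e'⟩ | ⟨h', e'⟩
      · rw [e, e', if_pos (Or.inl h')]
      · rw [e, e', b10, if_neg (by tauto)]
  have hguard : Fits' s w M₅ (cell 10 + ltE 4 (cell 9)) := by
    simp only [Fits', add_def, ofNat_def, Expr.eval, WordOp.eval, m10, n₅]
    refine ⟨⟨by omega, by omega⟩, ⟨by omega, by omega, by omega⟩, ?_⟩
    split_ifs <;> omega
  have hF := (fits_of_fits' (by omega) hB₅ hguard).1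
  have heval : (cell 10 + ltE 4 (cell 9)).eval M₅ =
      (if Flagged M q₁ ∨ Flagged M q₂ then 1 else 0) + if 4 < X.length then 1 else 0 := by
    simp only [add_def, ofNat_def, Expr.eval, WordOp.eval, m10, n₅]
  have hcost : (cell 10 + ltE 4 (cell 9)).cost ≤ 10 := by decide
  have hc₁ : costBound addressProg ≤ 200 := by decide
  have hc₂ : costBound prepareProg ≤ 200 := by decide
  have hc₃ : costBound collectProg ≤ 200 := by decide
  have hc₄ : costBound (4 ::= cell 14) ≤ 10 := by decide
  have hc₅ : costBound writeDense ≤ 200 := by decide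
  have hc₆ : costBound writeSparse ≤ 200 := by decide
  have hd : q₀ + 8 ≤ qp ∨ qp + 8 ≤ q₀ := by omega
  by_cases hfl : (Flagged M q₁ ∨ Flagged M q₂) ∨ 5 ≤ X.length
  · obtain ⟨M₆, u₆, hE₆, hu₆, hB₆, g11, f₆⟩ := exec_gcdProg (ans := ans) (s := s) (k := k) hB₅
      (by omega) (by omega) n₅ hlen xs hX
    have hX0 : X ≠ [] := by
      intro h0
      rcases hfl with (hfl | hfl) | hfl
      · have : centers M q₁ ≠ [] := by simp [centers, hfl.1, hfl.2]
        rw [hXdef] at h0; simp [this] at h0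
      · have : centers M q₂ ≠ [] := by simp [centers, hfl.1, hfl.2]
        rw [hXdef] at h0; simp [this] at h0
      · simp [h0] at hfl
    obtain ⟨x₀, X', hX'⟩ := List.exists_cons_of_ne_nil hX0
    have hx₀ : M₅ 32 = X.headD 0 := by
      have := xs 0 (List.length_pos_of_ne_nil hX0)
      simpa [hX'] using this
    have hx₀k : X.headD 0 < 2 ^ k := hX _ (by simp [hX'])
    rw [hx₀] at g11
    have hG : gcdDist (X.headD 0) X < 2 ^ k := gcdDist_lt X hposk hx₀k hX
    have reg' : ∀ a, a ≠ 7 → a ≠ 11 → a ≠ 12 → M₆ a = M₅ a := f₆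
    obtain ⟨M₇, u₇, hE₇, hu₇, hB₇, ⟨L₁, L₂, L₃, L₄, L₅⟩, D₁, D₂, D₃, D₄, D₅⟩ :=
      exec_writeDense (ans := ans) (s := s) (m := 2 ^ l) (a := M q₁)
      (G := gcdDist (X.headD 0) X) (x := X.headD 0) (qp := qp) (q₀ := q₀) hB₆ (by omega) (by omega)
      (by omega) (by omega) (by omega) (by rw [f₆ _ (by norm_num) (by norm_num) (by norm_num), m15])
      (by rw [f₆ _ (by norm_num) (by norm_num) (by norm_num), m16])
      (by rw [f₆ _ (by norm_num) (by norm_num) (by norm_num), m2])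
      (by rw [f₆ _ (by norm_num) (by norm_num) (by norm_num), m17]) g11
      (by rw [f₆ _ (by norm_num) (by norm_num) (by norm_num), hx₀]) (by omega) (by omega) hd
    refine ⟨M₇, _, .seq _ _ _ _ _ _ _ [] [] hE₁ (.seq _ _ _ _ _ _ _ [] [] hE₂
      (.seq _ _ _ _ _ _ _ [] [] hE₃ (.seq _ _ _ _ _ _ _ [] [] hE₄ (.seq _ _ _ _ _ _ _ [] [] hE₅
      (.ite_true _ _ _ _ _ _ _ hF ?_ (.seq _ _ _ _ _ _ _ [] [] hE₆ hE₇)))))), ?_, hB₇, ?_⟩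
    · rw [heval]
      rcases hfl with hfl | hfl
      · simp [hfl]
      · rw [if_pos (show 4 < X.length by omega)]; omega
    · omega
    · refine ⟨?_, ?_, ?_, ?_, ?_, L₄, Or.inl ⟨hfl, D₁, D₂, D₃, D₄, D₅⟩, ?_⟩
      · rw [L₅ _ (by omega) (by omega), f₆ _ (by norm_num) (by norm_num) (by norm_num), m0]
      · rw [L₅ _ (by omega) (by omega), f₆ _ (by norm_num) (by norm_num) (by norm_num), m1]
      · rw [L₁, f₆ _ (by norm_num) (by norm_num) (by norm_num), m17]
      · rw [L₂, pow_succ, mul_comm]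
      · rw [L₃, f₆ _ (by norm_num) (by norm_num) (by norm_num), m18]
      · intro a h₁ h₂ h₃
        rw [L₅ a h₂ h₃, f₆ a (by omega) (by omega) (by omega), f₁₅ a (by omega)]
  · rw [not_or] at hfl
    have hlen4 : X.length ≤ 4 := by omega
    obtain ⟨M₇, u₇, hE₇, hu₇, hB₇, ⟨L₁, L₂, L₃, L₄, L₅⟩, D₁, D₂⟩ :=
      exec_writeSparse (ans := ans) (s := s) (m := 2 ^ l) (X := X) (qp := qp) (q₀ := q₀) hB₅
      (by omega) (by omega) (by omega) (by omega) (by omega) m15 m16 m2 n₅ xs hlen4 (by omega)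
      (by omega) hd
    refine ⟨M₇, _, .seq _ _ _ _ _ _ _ [] [] hE₁ (.seq _ _ _ _ _ _ _ [] [] hE₂
      (.seq _ _ _ _ _ _ _ [] [] hE₃ (.seq _ _ _ _ _ _ _ [] [] hE₄ (.seq _ _ _ _ _ _ _ [] [] hE₅
      (.ite_false _ _ _ _ _ _ _ hF ?_ hE₇))))), ?_, hB₇, ?_⟩
    · rw [heval, if_neg hfl.1, if_neg (by omega)]
    · omega
    · refine ⟨?_, ?_, ?_, ?_, ?_, L₄, Or.inr ⟨hfl.1, hlen4, D₁, arrayAt_iff.1 D₂⟩, ?_⟩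
      · rw [L₅ _ (by omega) (by omega), m0]
      · rw [L₅ _ (by omega) (by omega), m1]
      · rw [L₁, m17]
      · rw [L₂, pow_succ, mul_comm]
      · rw [L₃, m18]
      · intro a h₁ h₂ h₃
        rw [L₅ a h₂ h₃, f₁₅ a (by omega)]

/-! ### Running the relevant processes -/

/-- The two words `u`, `f` represent the set `P` of the processes that have succeeded: `u` is one of
them, or `0` if there is none, and `f` is nonzero if there are at least two of them. -/
def RegOK (P : ℕ → Prop) (u f : ℕ) : Prop :=
  (u = 0 → ∀ c, ¬ P c) ∧ (u ≠ 0 → P u) ∧ (f = 0 → ∀ c, P c → c = u) ∧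
    (f ≠ 0 → ∃ c c', c < c' ∧ P c ∧ P c')

lemma RegOK.congr {P P' : ℕ → Prop} {u f : ℕ} (h : RegOK P u f) (hP : ∀ x, P x ↔ P' x) :
    RegOK P' u f := by
  obtain rfl : P = P' := funext fun x => propext (hP x)
  exact h

/-- The two words are updated correctly when `P(c)` has been run with outcome `v`. -/
lemma RegOK.insert {P : ℕ → Prop} {u f c v : ℕ} (h : RegOK P u f) (hc : c ≠ 0) :
    RegOK (fun x => P x ∨ (x = c ∧ v = 1)) (if v = 1 ∧ u = 0 then c else u)
      (if v = 1 ∧ u ≠ 0 ∧ u ≠ c then 1 else f) := by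
  by_cases hv : v = 1
  · obtain ⟨h₀, h₁, h₂, h₃⟩ := h
    by_cases hu : u = 0
    · have hP := h₀ hu
      simp only [hv, hu, true_and, and_true, if_true, ne_eq, not_true_eq_false, false_and, if_false,
        hP, false_or]
      refine ⟨fun h => absurd h hc, fun _ => rfl, fun _ x hx => hx, fun hf => ?_⟩
      obtain ⟨x, y, hxy, hx, hy⟩ := h₃ hf
      exact absurd hx (hP x)
    · simp only [hv, hu, true_and, and_true, ne_eq, not_false_eq_true, if_false]
      refine ⟨fun h => absurd h hu, fun _ => Or.inl (h₁ hu), ?_, ?_⟩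
      · intro hf x hx
        split_ifs at hf with huc
        rcases hx with hx | hx
        · exact h₂ hf x hx
        · exact hx.trans huc.symm
      · intro hf
        by_cases huc : u = c
        · rw [if_neg (by simpa using huc)] at hf
          obtain ⟨x, y, hxy, hx, hy⟩ := h₃ hf
          exact ⟨x, y, hxy, Or.inl hx, Or.inl hy⟩
        · rcases Nat.lt_or_gt_of_ne huc with h | h
          exacts [⟨u, c, h, Or.inl (h₁ hu), Or.inr rfl⟩, ⟨c, u, h, Or.inr rfl, Or.inl (h₁ hu)⟩]
  · simp only [hv, false_and, if_false, and_false, or_false]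
    exact h

lemma exec_run {ans : ℕ → ℕ} {s w b c : ℕ} {e : Expr} {M : Memory} (hM : Bounded w M)
    (he : Fits' s w M e) (hec : e.eval M = c) (hb : b < s) (hbw : b ≤ w) (hw : 1 ≤ w)
    (ha : ans c ≤ w) :
    ∃ M', Exec ans s w (.run (.lit b) e) M M' (e.cost + 2) [c] ∧ Bounded w M' ∧
      M' = Function.update M b (ans c) := by
  subst hec
  have h := Exec.run (ans := ans) (s := s) (w := w) M (.lit b) e hbw (fits_of_fits' hw hM he).1 hb ha
  have hc : (Expr.lit b).cost + e.cost + 1 = e.cost + 2 := by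
    simp only [Expr.cost]; omega
  rw [hc] at h
  exact ⟨_, h, bounded_update hM ha, rfl⟩

/-- Register a success of the process that has just been run, and move on to the next one. -/
def denseUpdate : Program :=
  .ite (eqE (cell 6) 1)
    (.ite (.load (cell 4 + 5))
      (.ite (eqE (.load (cell 4 + 5)) (cell 5)) .skip (cell 4 + 6 ::= 1))
      (cell 4 + 5 ::= cell 5)) .skip ;;
  5 ::= cell 5 + .load (cell 4 + 4) / 2

/-- Run the relevant processes of a segment with a dense description. -/
def denseRun : Program :=
  5 ::= .load (cell 4 + 3) ;;
  .while (ltE (cell 5) (.load (cell 4) + .load (cell 4 + 1)))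
    (.run 6 (cell 5) ;; denseUpdate)

lemma exec_denseUpdate {ans : ℕ → ℕ} {s w q c u f p v : ℕ} {M : Memory} (hM : Bounded w M)
    (hq : 64 ≤ q) (hs : q + 8 ≤ s) (hw : s ≤ w) (hcw : c + p ≤ w) (hc : c ≠ 0) (h4 : M 4 = q) (h5 : M 5 = c)
    (h6 : M 6 = v) (hp : M (q + 4) = p) (hu : M (q + 5) = u) (hf : M (q + 6) = f) :
    ∃ M' t, Exec ans s w denseUpdate M M' t [] ∧ t ≤ costBound denseUpdate ∧ Bounded w M' ∧
      M' 5 = c + p / 2 ∧ M' (q + 5) = (if v = 1 ∧ u = 0 then c else u) ∧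
      M' (q + 6) = (if v = 1 ∧ u ≠ 0 ∧ u ≠ c then 1 else f) ∧
      ∀ a, a ≠ 5 → a ≠ 6 → a ≠ q + 5 → a ≠ q + 6 → M' a = M a := by
  apply exec_of_wp (by omega) hM
  obtain ⟨r, rfl⟩ := Nat.exists_eq_add_of_le' hq
  have hp2 : p / 2 ≤ p := Nat.div_le_self _ _
  by_cases hv : v = 1 <;> by_cases hu0 : u = 0 <;> by_cases huc : u = c <;>
  simp [denseUpdate, wp, Fits', add_def, div_def, ofNat_def, zero_def, one_def,
    Expr.eval, WordOp.eval, Function.update_apply, h4, h5, h6, hp, hu, hf, hv, hu0, huc, hc] <;>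
  and_intros
  all_goals first | omega | skip
  all_goals
    intro a ha hb hc hd
    simp [ha, hb, hc, hd]

/-- The number `K` of relevant processes is not computed by the program; it bounds the number of
rounds of the loop. -/
lemma exec_denseRun {ans : ℕ → ℕ} {s w q a m c g u f K : ℕ} {M : Memory} {P : ℕ → Prop}
    (hM : Bounded w M) (hans : ∀ x, ans x ≤ 2) (hq : 64 ≤ q) (hs : q + 8 ≤ s) (hw : s ≤ w)
    (hcw : c + a + m + 2 * g ≤ w) (hc : c ≠ 0) (h4 : M 4 = q) (ha : M q = a) (hm : M (q + 1) = m)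
    (h3 : M (q + 3) = c) (hp : M (q + 4) = 2 * g) (hu : M (q + 5) = u) (hf : M (q + 6) = f)
    (hK : ∀ i, c + i * g < a + m ↔ i < K) (hP : RegOK P u f) :
    ∃ M' t, Exec ans s w denseRun M M' t ((List.range K).map fun i => c + i * g) ∧
      t ≤ 70 * K + 60 ∧ Bounded w M' ∧
      RegOK (fun x => P x ∨ (x ∈ (List.range K).map (fun i => c + i * g) ∧ ans x = 1))
        (M' (q + 5)) (M' (q + 6)) ∧
      ∀ b, b ≠ 5 → b ≠ 6 → b ≠ q + 5 → b ≠ q + 6 → M' b = M b := by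
  obtain ⟨M₁, t₁, hE₁, ht₁, hB₁, h₅, hf₁⟩ : ∃ M' t,
      Exec ans s w (5 ::= .load (cell 4 + 3)) M M' t [] ∧
      t ≤ costBound (5 ::= .load (cell 4 + 3)) ∧ Bounded w M' ∧ M' 5 = c ∧
      ∀ b, b ≠ 5 → M' b = M b := by
    apply exec_of_wp (by omega) hM
    simp [wp, Fits', add_def, ofNat_def, Expr.eval, WordOp.eval, Function.update_apply, h4, h3]
    and_intros
    all_goals omega
  have hcost : (ltE (cell 5) (.load (cell 4) + .load (cell 4 + 1))).cost = 12 := rfl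
  have hcost' : costBound denseUpdate ≤ 44 := by decide
  obtain ⟨M₂, t₂, L₂, hE₂, rfl, ht₂, hB₂, hR₂, hf₂⟩ := exec_while (ans := ans) (s := s) (w := w)
    (e := ltE (cell 5) (.load (cell 4) + .load (cell 4 + 1))) (p := .run 6 (cell 5) ;; denseUpdate)
    (fun k M' t L => k ≤ K ∧ L = (List.range (K - k)).map (fun i => c + i * g) ∧
      t ≤ 70 * (K - k) ∧ Bounded w M' ∧ M' 5 = c + (K - k) * g ∧
      RegOK (fun x => P x ∨ (x ∈ L ∧ ans x = 1)) (M' (q + 5)) (M' (q + 6)) ∧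
      ∀ b, b ≠ 5 → b ≠ 6 → b ≠ q + 5 → b ≠ q + 6 → M' b = M b)
    (Q := fun M' t L => L = (List.range K).map (fun i => c + i * g) ∧
      t ≤ 70 * K + 13 ∧ Bounded w M' ∧
      RegOK (fun x => P x ∨ (x ∈ L ∧ ans x = 1)) (M' (q + 5)) (M' (q + 6)) ∧
      ∀ b, b ≠ 5 → b ≠ 6 → b ≠ q + 5 → b ≠ q + 6 → M' b = M b) (by
    rintro k M' t L ⟨hk, hL, ht, hB, e₅, hR, hf'⟩
    have e₄ : M' 4 = q := by
      rw [hf' 4 (by norm_num) (by norm_num) (by omega) (by omega), h4]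
    have eq0 : M' q = a := by rw [hf' q (by omega) (by omega) (by omega) (by omega), ha]
    have eq1 : M' (q + 1) = m := by
      rw [hf' _ (by omega) (by omega) (by omega) (by omega), hm]
    have heval : (ltE (cell 5) (.load (cell 4) + .load (cell 4 + 1))).eval M' =
        if c + (K - k) * g < a + m then 1 else 0 := by
      simp only [add_def, one_def, Expr.eval, WordOp.eval, e₄, e₅, eq0, eq1]
    refine ⟨(fits_of_fits' (by omega) hB ?_).1, ?_⟩
    · simp only [Fits', add_def, one_def, Expr.eval, WordOp.eval, e₄, eq0, eq1]
      omega
    rcases k with _ | k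
    · left
      rw [hcost]
      refine ⟨?_, hL, by omega, hB, hR, hf'⟩
      rw [heval, if_neg]
      rw [hK]; omega
    · right
      have hlt := (hK (K - (k + 1))).2 (by omega)
      have hsub : K - k = K - (k + 1) + 1 := by omega
      refine ⟨k, rfl, by rw [heval, if_pos hlt]; norm_num, ?_⟩
      obtain ⟨M₃, hE₃, hB₃, hM₃⟩ := exec_run (ans := ans) (s := s) (w := w) (b := 6) (e := cell 5)
        (c := c + (K - (k + 1)) * g) hB (by simp only [Fits', Expr.eval]; omega)
        (by simpa only [Expr.eval] using e₅) (by omega) (by omega) (by omega)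
        ((hans _).trans (by omega))
      have hM₃' : ∀ b, b ≠ 6 → M₃ b = M' b := fun b hb => by
        rw [hM₃, Function.update_of_ne hb]
      obtain ⟨M₄, t₄, hE₄, ht₄, hB₄, g₅, gu, gf, hf₄⟩ := exec_denseUpdate (ans := ans) (s := s)
        (w := w) (q := q) (c := c + (K - (k + 1)) * g) (p := 2 * g) (u := M' (q + 5))
        (f := M' (q + 6)) (v := ans (c + (K - (k + 1)) * g)) hB₃ hq hs hw
        (by omega) (by omega) (by rw [hM₃' _ (by omega), e₄]) (by rw [hM₃' _ (by omega), e₅])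
        (by rw [hM₃, Function.update_self])
        (by rw [hM₃' _ (by omega), hf' _ (by omega) (by omega) (by omega) (by omega), hp])
        (hM₃' _ (by omega)) (hM₃' _ (by omega))
      refine ⟨M₄, _, _, .seq _ _ _ _ _ _ _ _ _ hE₃ hE₄, by omega, ?_, ?_, hB₄, ?_, ?_, ?_⟩
      · rw [hL, hsub, List.range_succ, List.map_append]
        simp
      · have : (cell 5).cost = 2 := rfl
        rw [hcost]; omega
      · rw [g₅, Nat.mul_div_cancel_left _ (by norm_num), hsub]; ring
      · rw [gu, gf]
        refine (hR.insert (c := c + (K - (k + 1)) * g) (v := ans (c + (K - (k + 1)) * g))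
          (by omega)).congr fun x => ?_
        simp only [List.append_nil, List.mem_append, List.mem_singleton]
        constructor
        · rintro ((h | h) | ⟨rfl, h⟩)
          exacts [Or.inl h, Or.inr ⟨Or.inl h.1, h.2⟩, Or.inr ⟨Or.inr rfl, h⟩]
        · rintro (h | ⟨h | rfl, h'⟩)
          exacts [Or.inl (Or.inl h), Or.inl (Or.inr ⟨h, h'⟩), Or.inr ⟨rfl, h'⟩]
      · intro b b₅ b₆ b₇ b₈
        rw [hf₄ b b₅ b₆ b₇ b₈, hM₃' b b₆, hf' b b₅ b₆ b₇ b₈]) K M₁ 0 []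
    ⟨le_rfl, by simp, by simp, hB₁, by simpa using h₅, by
      rw [hf₁ _ (by omega), hf₁ _ (by omega), hu, hf]
      exact hP.congr (by simp), fun b hb _ _ _ => hf₁ b hb⟩
  simp only [List.nil_append] at *
  refine ⟨M₂, _, .seq _ _ _ _ _ _ _ [] _ hE₁ hE₂, ?_, hB₂, hR₂, hf₂⟩
  have : costBound (5 ::= .load (cell 4 + 3)) = 7 := rfl
  omega

/-- Keep the process that has just been run on the list unless it has failed, and move on to the
next one. -/
def sparseUpdate : Program :=
  .ite (eqE (cell 6) 2) .skip
    (cell 4 + cell 8 + 3 ::= cell 5 ;;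
    8 ::= cell 8 + 1) ;;
  7 ::= cell 7 + 1

/-- Run the relevant processes of a segment with a sparse description. -/
def sparseRun : Program :=
  (7 ::= 0 ;; 8 ::= 0) ;;
  .while (ltE (cell 7) (.load (cell 4 + 2)))
    (5 ::= .load (cell 4 + cell 7 + 3) ;;
    .run 6 (cell 5) ;;
    sparseUpdate) ;;
  cell 4 + 2 ::= cell 8

lemma exec_sparseUpdate {ans : ℕ → ℕ} {s w q x v i j : ℕ} {M : Memory} (hM : Bounded w M)
    (hq : 64 ≤ q) (hs : q + 8 ≤ s) (hw : s ≤ w) (hj : j ≤ i) (hi : i < 4) (h4 : M 4 = q)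
    (h5 : M 5 = x) (h6 : M 6 = v) (h7 : M 7 = i) (h8 : M 8 = j) :
    ∃ M' t, Exec ans s w sparseUpdate M M' t [] ∧ t ≤ costBound sparseUpdate ∧ Bounded w M' ∧
      M' 7 = i + 1 ∧ M' 8 = (if v = 2 then j else j + 1) ∧ (v ≠ 2 → M' (q + 3 + j) = x) ∧
      ∀ a, a ≠ 7 → a ≠ 8 → a ≠ q + 3 + j → M' a = M a := by
  apply exec_of_wp (by omega) hM
  obtain ⟨r, rfl⟩ := Nat.exists_eq_add_of_le' hq
  by_cases hv : v = 2 <;>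
  simp [sparseUpdate, wp, Fits', add_def, ofNat_def, one_def,
    Expr.eval, WordOp.eval, Function.update_apply, h4, h5, h6, h7, h8, hv] <;>
  and_intros
  all_goals first | omega | skip
  all_goals
    intros
    split_ifs <;> omega

/-- The processes that have not failed are moved to the front of the list while it is traversed. -/
lemma exec_sparseRun {ans : ℕ → ℕ} {s w q : ℕ} {M : Memory}
    (hM : Bounded w M) (hans : ∀ x, ans x ≤ 2) (hq : 64 ≤ q) (hs : q + 8 ≤ s) (hw : s ≤ w)
    (h4 : M 4 = q) (hN : M (q + 2) ≤ 4) :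
    ∃ M' t, Exec ans s w sparseRun M M' t (cells M (q + 3) (M (q + 2))) ∧
      t ≤ 70 * M (q + 2) + 60 ∧ Bounded w M' ∧ M' (q + 2) ≤ M (q + 2) ∧
      cells M' (q + 3) (M' (q + 2)) =
        (cells M (q + 3) (M (q + 2))).filter (fun c => ans c ≠ 2) ∧
      ∀ b, b ≠ 5 → b ≠ 6 → b ≠ 7 → b ≠ 8 → b < q + 2 ∨ q + 7 ≤ b → M' b = M b := by
  obtain ⟨N, hNN⟩ : ∃ N, M (q + 2) = N := ⟨_, rfl⟩
  rw [hNN] at hN ⊢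
  obtain ⟨M₁, t₁, hE₁, ht₁, hB₁, h₇, h₈, hf₁⟩ : ∃ M' t,
      Exec ans s w (7 ::= 0 ;; 8 ::= 0) M M' t [] ∧
      t ≤ costBound (7 ::= 0 ;; 8 ::= 0) ∧ Bounded w M' ∧ M' 7 = 0 ∧ M' 8 = 0 ∧
      ∀ b, b ≠ 7 → b ≠ 8 → M' b = M b := by
    apply exec_of_wp (by omega) hM
    simp [wp, Fits', zero_def, ofNat_def, Expr.eval, Function.update_apply]
    and_intros
    all_goals first | omega | skip
    intro b h₁ h₂
    simp [h₁, h₂]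
  have hcost : (ltE (cell 7) (.load (cell 4 + 2))).cost = 8 := rfl
  have hcost' : costBound sparseUpdate ≤ 30 := by decide
  obtain ⟨M₂, t₂, L₂, hE₂, rfl, ht₂, hB₂, ⟨j, e₈, hjN, hc₂⟩, hf₂⟩ := exec_while (ans := ans)
    (s := s) (w := w) (e := ltE (cell 7) (.load (cell 4 + 2)))
    (p := 5 ::= .load (cell 4 + cell 7 + 3) ;; .run 6 (cell 5) ;; sparseUpdate)
    (fun k M' t L => k ≤ N ∧ L = cells M (q + 3) (N - k) ∧
      t ≤ 70 * (N - k) ∧ Bounded w M' ∧ M' 7 = N - k ∧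
      (∃ j, M' 8 = j ∧ j ≤ N - k ∧ cells M' (q + 3) j = L.filter (fun c => ans c ≠ 2)) ∧
      ∀ b, b ≠ 5 → b ≠ 6 → b ≠ 7 → b ≠ 8 → b < q + 3 ∨ q + 3 + (N - k) ≤ b → M' b = M b)
    (Q := fun M' t L => L = cells M (q + 3) N ∧ t ≤ 70 * N + 10 ∧ Bounded w M' ∧
      (∃ j, M' 8 = j ∧ j ≤ N ∧ cells M' (q + 3) j = L.filter (fun c => ans c ≠ 2)) ∧
      ∀ b, b ≠ 5 → b ≠ 6 → b ≠ 7 → b ≠ 8 → b < q + 3 ∨ q + 3 + N ≤ b → M' b = M b) (by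
    rintro k M' t L ⟨hk, hL, ht, hB, e₇, ⟨j, e₈, hj, hc⟩, hf'⟩
    have e₄ : M' 4 = q := by
      rw [hf' 4 (by norm_num) (by norm_num) (by norm_num) (by norm_num) (by omega), h4]
    have eq2 : M' (q + 2) = N := by
      rw [hf' _ (by omega) (by omega) (by omega) (by omega) (by omega), hNN]
    have heval : (ltE (cell 7) (.load (cell 4 + 2))).eval M' = if N - k < N then 1 else 0 := by
      simp only [add_def, ofNat_def, Expr.eval, WordOp.eval, e₄, e₇, eq2]
    refine ⟨(fits_of_fits' (by omega) hB ?_).1, ?_⟩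
    · simp only [Fits', add_def, ofNat_def, Expr.eval, WordOp.eval, e₄]
      omega
    rcases k with _ | k
    · left
      rw [hcost]
      exact ⟨by rw [heval, if_neg (by omega)], hL, by omega, hB, ⟨j, e₈, hj, hc⟩, hf'⟩
    · right
      obtain ⟨i, hi⟩ : ∃ i, N - (k + 1) = i := ⟨_, rfl⟩
      have hsub : N - k = i + 1 := by omega
      rw [hi] at hL ht e₇ hj hf' heval
      refine ⟨k, rfl, by rw [heval, if_pos (by omega)]; norm_num, ?_⟩
      rw [hsub]
      obtain ⟨x, hx⟩ : ∃ x, M (q + 3 + i) = x := ⟨_, rfl⟩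
      obtain ⟨M₀, t₀, hE₀, ht₀, hB₀, g₅, hf₀⟩ : ∃ M₀ t,
          Exec ans s w (5 ::= .load (cell 4 + cell 7 + 3)) M' M₀ t [] ∧
          t ≤ costBound (5 ::= .load (cell 4 + cell 7 + 3)) ∧ Bounded w M₀ ∧ M₀ 5 = x ∧
          ∀ b, b ≠ 5 → M₀ b = M' b := by
        apply exec_of_wp (by omega) hB
        have hx' : M' (q + i + 3) = x := by
          rw [hf' _ (by omega) (by omega) (by omega) (by omega) (by omega), ← hx]
          congr 1; omega
        simp [wp, Fits', add_def, ofNat_def, Expr.eval, WordOp.eval, Function.update_apply, e₄, e₇,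
          hx']
        and_intros
        all_goals omega
      obtain ⟨M₃, hE₃, hB₃, hM₃⟩ := exec_run (ans := ans) (s := s) (w := w) (b := 6) (e := cell 5)
        (c := x) hB₀ (by simp only [Fits', Expr.eval]; omega)
        (by simpa only [Expr.eval] using g₅) (by omega) (by omega) (by omega)
        ((hans _).trans (by omega))
      have hM₃' : ∀ b, b ≠ 5 → b ≠ 6 → M₃ b = M' b := fun b hb hb' => by
        rw [hM₃, Function.update_of_ne hb', hf₀ b hb]
      obtain ⟨M₄, t₄, hE₄, ht₄, hB₄, k₇, k₈, kx, hf₄⟩ := exec_sparseUpdate (ans := ans) (s := s)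
        (w := w) (q := q) (x := x) (v := ans x) (i := i) (j := j) hB₃ hq hs hw hj (by omega)
        (by rw [hM₃' _ (by omega) (by omega), e₄])
        (by rw [hM₃, Function.update_of_ne (by norm_num), g₅])
        (by rw [hM₃, Function.update_self])
        (by rw [hM₃' _ (by omega) (by omega), e₇]) (by rw [hM₃' _ (by omega) (by omega), e₈])
      have hcells : cells M₄ (q + 3) j = cells M' (q + 3) j := cells_congr fun i' hi' => by
        rw [hf₄ _ (by omega) (by omega) (by omega), hM₃' _ (by omega) (by omega)]
      have hLx : cells M (q + 3) (i + 1) = L ++ [x] := by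
        rw [hL, cells, cells, List.range_succ, List.map_append]
        simp [hx]
      refine ⟨M₄, _, _, .seq _ _ _ _ _ _ _ _ _ hE₀ (.seq _ _ _ _ _ _ _ _ _ hE₃ hE₄), by omega, ?_,
        ?_, hB₄, k₇, ?_, ?_⟩
      · rw [hLx]
        simp
      · have : (cell 5).cost = 2 := rfl
        have : costBound (5 ::= .load (cell 4 + cell 7 + 3)) = 10 := rfl
        rw [hcost]; omega
      · by_cases hv : ans x = 2
        · rw [if_pos hv] at k₈
          refine ⟨j, k₈, by omega, ?_⟩
          rw [hcells, hc]
          simp [hv]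
        · rw [if_neg hv] at k₈
          refine ⟨j + 1, k₈, by omega, ?_⟩
          have : cells M₄ (q + 3) (j + 1) = cells M₄ (q + 3) j ++ [x] := by
            rw [cells, cells, List.range_succ, List.map_append]
            simp [kx hv]
          rw [this, hcells, hc]
          simp [hv]
      · intro b b₅ b₆ b₇ b₈ b₉
        rw [hf₄ b b₇ b₈ (by omega), hM₃' b b₅ b₆, hf' b b₅ b₆ b₇ b₈ (by omega)]) N M₁ 0 []
    ⟨le_rfl, by simp [cells], by simp, hB₁, by simpa using h₇, ⟨0, h₈, by omega, by simp [cells]⟩,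
      fun b _ _ b₇ b₈ _ => hf₁ b b₇ b₈⟩
  simp only [List.nil_append] at *
  obtain ⟨M₃, t₃, hE₃, ht₃, hB₃, g₂, hf₃⟩ : ∃ M' t,
      Exec ans s w (cell 4 + 2 ::= cell 8) M₂ M' t [] ∧
      t ≤ costBound (cell 4 + 2 ::= cell 8) ∧ Bounded w M' ∧ M' (q + 2) = j ∧
      ∀ b, b ≠ q + 2 → M' b = M₂ b := by
    apply exec_of_wp (by omega) hB₂
    have e₄ : M₂ 4 = q := by
      rw [hf₂ 4 (by norm_num) (by norm_num) (by norm_num) (by norm_num) (by omega), h4]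
    simp [wp, Fits', add_def, ofNat_def, Expr.eval, WordOp.eval, Function.update_apply, e₄, e₈]
    and_intros
    all_goals omega
  refine ⟨M₃, t₁ + (t₂ + t₃), ?_, ?_, hB₃, by omega, ?_, ?_⟩
  · have := Exec.seq _ _ _ _ _ _ _ _ _ hE₁ (.seq _ _ _ _ _ _ _ _ _ hE₂ hE₃)
    rw [List.nil_append, List.append_nil] at this
    exact this
  · have : costBound (7 ::= 0 ;; 8 ::= 0) = 6 := rfl
    have : costBound (cell 4 + 2 ::= cell 8) = 7 := rfl
    omega
  · rw [g₂, ← hc₂]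
    exact cells_congr fun i hi => hf₃ _ (by omega)
  · intro b b₅ b₆ b₇ b₈ b₉
    rw [hf₃ b (by omega), hf₂ b b₅ b₆ b₇ b₈ (by omega)]

/-- The centers of the relevant processes of the segment with the record at address `q`, in the
order in which they are run. -/
def runs (M : Memory) (q : ℕ) : List ℕ :=
  if M (q + 2) = 5 then
    (List.range ((M q + M (q + 1) - M (q + 3) + M (q + 4) / 2 - 1) / (M (q + 4) / 2))).map
      fun i => M (q + 3) + i * (M (q + 4) / 2)
  else cells M (q + 3) (M (q + 2))

/-- The record at address `q` is fit for a run of its processes; `P` is the set of the processes that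
have succeeded earlier. -/
def Runnable (s w : ℕ) (P : ℕ → Prop) (M : Memory) (q : ℕ) : Prop :=
  64 ≤ q ∧ q + 8 ≤ s ∧ M (q + 2) ≤ 5 ∧
    (M (q + 2) = 5 → ∃ g, 0 < g ∧ M (q + 4) = 2 * g ∧ M (q + 3) ≠ 0 ∧
      M (q + 3) + M q + M (q + 1) + 2 * g ≤ w ∧ RegOK P (M (q + 5)) (M (q + 6)))

/-- The effect on the record at address `q` of a run of its processes. -/
def BlockStep (ans : ℕ → ℕ) (P : ℕ → Prop) (M M' : Memory) (q : ℕ) : Prop :=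
  M' q = M q ∧ M' (q + 1) = M (q + 1) ∧ M' (q + 7) = M (q + 7) ∧
  (M (q + 2) = 5 → M' (q + 2) = 5 ∧ M' (q + 3) = M (q + 3) ∧ M' (q + 4) = M (q + 4) ∧
    RegOK (fun x => P x ∨ (x ∈ runs M q ∧ ans x = 1)) (M' (q + 5)) (M' (q + 6))) ∧
  (M (q + 2) ≠ 5 → M' (q + 2) ≤ 4 ∧
    cells M' (q + 3) (M' (q + 2)) = (runs M q).filter (fun c => ans c ≠ 2))

/-- The record at address `q` is the same in both memories. -/
def SameBlock (M M' : Memory) (q : ℕ) : Prop := ∀ i, i < 8 → M' (q + i) = M (q + i)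

lemma runs_congr {M M' : Memory} {q : ℕ} (h : ∀ i, i < 7 → M' (q + i) = M (q + i))
    (hq : M (q + 2) ≤ 5) : runs M' q = runs M q := by
  unfold runs
  rw [h 2 (by norm_num), h 1 (by norm_num), h 3 (by norm_num), h 4 (by norm_num),
    show M' q = M q from h 0 (by norm_num)]
  split_ifs with h5
  · rfl
  · refine cells_congr fun i hi => ?_
    rw [add_assoc, h _ (by omega)]

lemma SameBlock.runs_eq {M M' : Memory} {q : ℕ} (h : SameBlock M M' q) (hq : M (q + 2) ≤ 5) :
    runs M' q = runs M q :=
  runs_congr (fun i hi => h i (by omega)) hq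

lemma SameBlock.runnable {s w : ℕ} {P : ℕ → Prop} {M M' : Memory} {q : ℕ} (h : SameBlock M M' q)
    (hr : Runnable s w P M q) : Runnable s w P M' q := by
  unfold Runnable at *
  rwa [h 2 (by norm_num), h 1 (by norm_num), h 3 (by norm_num), h 4 (by norm_num),
    h 5 (by norm_num), h 6 (by norm_num), show M' q = M q from h 0 (by norm_num)]

lemma BlockStep.of_sameBlock_left {ans : ℕ → ℕ} {P : ℕ → Prop} {M M₁ M' : Memory} {q : ℕ}
    (hs : SameBlock M M₁ q) (hq : M (q + 2) ≤ 5) (h : BlockStep ans P M₁ M' q) :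
    BlockStep ans P M M' q := by
  unfold BlockStep at *
  rwa [hs.runs_eq hq, hs 2 (by norm_num), hs 1 (by norm_num), hs 3 (by norm_num),
    hs 4 (by norm_num), hs 7 (by norm_num), show M₁ q = M q from hs 0 (by norm_num)] at h

lemma BlockStep.of_sameBlock_right {ans : ℕ → ℕ} {P : ℕ → Prop} {M M₁ M' : Memory} {q : ℕ}
    (hs : SameBlock M₁ M' q) (h : BlockStep ans P M M₁ q) : BlockStep ans P M M' q := by
  obtain ⟨h₀, h₁, h₇, hd, hsp⟩ := h
  refine ⟨?_, ?_, ?_, fun h5 => ?_, fun h5 => ?_⟩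
  · rw [← h₀]; exact hs 0 (by norm_num)
  · rw [hs 1 (by norm_num), h₁]
  · rw [hs 7 (by norm_num), h₇]
  · rw [hs 2 (by norm_num), hs 3 (by norm_num), hs 4 (by norm_num), hs 5 (by norm_num),
      hs 6 (by norm_num)]
    exact hd h5
  · obtain ⟨h₂, h₃⟩ := hsp h5
    rw [hs 2 (by norm_num)]
    refine ⟨h₂, ?_⟩
    rw [← h₃]
    refine cells_congr fun i hi => ?_
    rw [add_assoc, hs _ (by omega)]

/-- The number of terms below `e` of the progression with first term `c` and difference `g`. -/
lemma lt_count_iff {e c g : ℕ} (hg : 0 < g) (i : ℕ) :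
    c + i * g < e ↔ i < (e - c + g - 1) / g := by
  rw [← Nat.succ_le_iff, ← Nat.succ_le_iff, Nat.le_div_iff_mul_le hg, Nat.succ_mul]
  generalize i * g = x
  omega

/-- Run all relevant processes of all segments. -/
def runProg : Program :=
  4 ::= cell 0 ;;
  .while (cell 4)
    (.ite (eqE (.load (cell 4 + 2)) 5) denseRun sparseRun ;;
    4 ::= .load (cell 4 + 7))

/-- The records of the list that starts at address `q` are, in this order, those at the addresses
in `R`. -/
def Chain (M : Memory) : ℕ → List ℕ → Prop
  | q, [] => q = 0
  | q, r :: R => q = r ∧ Chain M (M (r + 7)) R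

lemma Chain.congr {M M' : Memory} {R : List ℕ} (h : ∀ q ∈ R, M' (q + 7) = M (q + 7)) {q : ℕ}
    (hc : Chain M q R) : Chain M' q R := by
  induction R generalizing q with
  | nil => exact hc
  | cons r R ih =>
    refine ⟨hc.1, ?_⟩
    rw [h r (by simp)]
    exact ih (fun q hq => h q (by simp [hq])) hc.2

lemma exec_runBlock {ans : ℕ → ℕ} {s w q : ℕ} {P : ℕ → Prop} {M : Memory} (hM : Bounded w M)
    (hans : ∀ x, ans x ≤ 2) (hw : s ≤ w) (h4 : M 4 = q) (hr : Runnable s w P M q) :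
    ∃ M' t, Exec ans s w (.ite (eqE (.load (cell 4 + 2)) 5) denseRun sparseRun ;;
      4 ::= .load (cell 4 + 7)) M M' t (runs M q) ∧ t ≤ 70 * (runs M q).length + 80 ∧
      Bounded w M' ∧ M' 4 = M (q + 7) ∧ BlockStep ans P M M' q ∧
      ∀ b, b < 4 ∨ 64 ≤ b → b < q ∨ q + 8 ≤ b → M' b = M b := by
  obtain ⟨hq, hs, h2, hd⟩ := hr
  have hcost : (eqE (.load (cell 4 + 2)) 5).cost = 7 := rfl
  have heval : (eqE (.load (cell 4 + 2)) 5).eval M = if M (q + 2) = 5 then 1 else 0 := by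
    simp only [add_def, ofNat_def, Expr.eval, WordOp.eval, h4]
  have hfits : (eqE (.load (cell 4 + 2)) 5).Fits s w M := by
    refine (fits_of_fits' (by omega) hM ?_).1
    simp only [Fits', add_def, ofNat_def, Expr.eval, WordOp.eval, h4]
    omega
  have hnext : ∀ M₁ : Memory, Bounded w M₁ → M₁ 4 = q → ∃ M' t,
      Exec ans s w (4 ::= .load (cell 4 + 7)) M₁ M' t [] ∧
      t ≤ costBound (4 ::= .load (cell 4 + 7)) ∧ Bounded w M' ∧ M' 4 = M₁ (q + 7) ∧
      ∀ b, b ≠ 4 → M' b = M₁ b := by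
    intro M₁ hM₁ h4
    apply exec_of_wp (by omega) hM₁
    simp [wp, Fits', add_def, ofNat_def, Expr.eval, WordOp.eval, Function.update_apply, h4]
    and_intros
    all_goals omega
  have hcost' : costBound (4 ::= .load (cell 4 + 7)) = 7 := rfl
  by_cases h5 : M (q + 2) = 5
  · obtain ⟨g, hg, hp, hc, hcw, hR⟩ := hd h5
    have hruns : runs M q = (List.range ((M q + M (q + 1) - M (q + 3) + g - 1) / g)).map
        fun i => M (q + 3) + i * g := by
      rw [runs, if_pos h5, hp, Nat.mul_div_cancel_left _ (by norm_num)]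
    obtain ⟨M₁, t₁, hE₁, ht₁, hB₁, hR₁, hf₁⟩ := exec_denseRun (ans := ans) hM hans hq hs hw hcw hc h4
      rfl rfl rfl hp rfl rfl (lt_count_iff hg) hR
    rw [← hruns] at hE₁ hR₁
    obtain ⟨M₂, t₂, hE₂, ht₂, hB₂, e₄, hf₂⟩ := hnext M₁ hB₁
      (by rw [hf₁ 4 (by norm_num) (by norm_num) (by omega) (by omega), h4])
    have hf : ∀ b, b ≠ 4 → b ≠ 5 → b ≠ 6 → b ≠ q + 5 → b ≠ q + 6 → M₂ b = M b := by
      intro b h₁ h₂ h₃ h₄ h₅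
      rw [hf₂ b h₁, hf₁ b h₂ h₃ h₄ h₅]
    refine ⟨M₂, _, by
        simpa using Exec.seq _ _ _ _ _ _ _ _ _ (.ite_true _ _ _ _ _ _ _ hfits
          (by rw [heval, if_pos h5]; norm_num) hE₁) hE₂, ?_, hB₂, ?_, ?_, ?_⟩
    · rw [hcost, hruns, List.length_map, List.length_range]; omega
    · rw [e₄, hf₁ _ (by omega) (by omega) (by omega) (by omega)]
    · refine ⟨hf _ (by omega) (by omega) (by omega) (by omega) (by omega),
        hf _ (by omega) (by omega) (by omega) (by omega) (by omega),
        hf _ (by omega) (by omega) (by omega) (by omega) (by omega), fun _ => ⟨?_, ?_, ?_, ?_⟩,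
        fun h => absurd h5 h⟩
      · rw [hf _ (by omega) (by omega) (by omega) (by omega) (by omega), h5]
      · rw [hf _ (by omega) (by omega) (by omega) (by omega) (by omega)]
      · rw [hf _ (by omega) (by omega) (by omega) (by omega) (by omega)]
      · rw [hf₂ _ (by omega), hf₂ _ (by omega)]
        exact hR₁
    · intro b h₁ h₂
      exact hf b (by omega) (by omega) (by omega) (by omega) (by omega)
  · have hruns : runs M q = cells M (q + 3) (M (q + 2)) := by rw [runs, if_neg h5]
    obtain ⟨M₁, t₁, hE₁, ht₁, hB₁, hle, hc₁, hf₁⟩ := exec_sparseRun (ans := ans) hM hans hq hs hw h4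
      (by omega)
    rw [← hruns] at hE₁ hc₁
    obtain ⟨M₂, t₂, hE₂, ht₂, hB₂, e₄, hf₂⟩ := hnext M₁ hB₁
      (by rw [hf₁ 4 (by norm_num) (by norm_num) (by norm_num) (by norm_num) (by omega), h4])
    have hf : ∀ b, b < 4 ∨ 64 ≤ b → b < q + 2 ∨ q + 7 ≤ b → M₂ b = M b := by
      intro b h₁ h₂
      rw [hf₂ b (by omega), hf₁ b (by omega) (by omega) (by omega) (by omega) h₂]
    refine ⟨M₂, _, by
        simpa using Exec.seq _ _ _ _ _ _ _ _ _ (.ite_false _ _ _ _ _ _ _ hfits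
          (by rw [heval, if_neg h5]) hE₁) hE₂, ?_, hB₂, ?_, ?_, ?_⟩
    · rw [hcost, hruns, length_cells]; omega
    · rw [e₄, hf₁ _ (by omega) (by omega) (by omega) (by omega) (by omega)]
    · refine ⟨hf _ (by omega) (by omega), hf _ (by omega) (by omega), hf _ (by omega) (by omega),
        fun h => absurd h h5, fun _ => ⟨?_, ?_⟩⟩
      · rw [hf₂ _ (by omega)]; omega
      · rw [hf₂ (q + 2) (by omega), ← hc₁]
        exact cells_congr fun i hi => hf₂ _ (by omega)
    · intro b h₁ h₂
      exact hf b h₁ (by omega)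

lemma exec_runLoop {ans : ℕ → ℕ} {s w : ℕ} {P : ℕ → ℕ → Prop} (hans : ∀ x, ans x ≤ 2) (hw : s ≤ w)
    (hs : 5 ≤ s) (R : List ℕ) {q : ℕ} {M : Memory} (hM : Bounded w M) (h4 : M 4 = q)
    (hc : Chain M q R) (hr : ∀ r ∈ R, Runnable s w (P r) M r)
    (hR : R.Pairwise fun r r' => r + 8 ≤ r' ∨ r' + 8 ≤ r) :
    ∃ M' t, Exec ans s w (.while (cell 4) (.ite (eqE (.load (cell 4 + 2)) 5) denseRun sparseRun ;;
      4 ::= .load (cell 4 + 7))) M M' t (R.flatMap (runs M)) ∧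
      t ≤ 70 * (R.flatMap (runs M)).length + 90 * R.length + 3 ∧ Bounded w M' ∧
      (∀ r ∈ R, BlockStep ans (P r) M M' r) ∧
      ∀ b, b < 4 ∨ 64 ≤ b → (∀ r ∈ R, b < r ∨ r + 8 ≤ b) → M' b = M b := by
  have hcost : (cell 4).cost = 2 := rfl
  have hfits : (cell 4).Fits s w M := by
    refine (fits_of_fits' (by omega) hM ?_).1
    simp only [Fits', Expr.eval]
    omega
  induction R generalizing q M with
  | nil =>
    refine ⟨M, _, .while_false _ _ _ hfits (h4.trans hc), ?_, hM,
      by simp, fun _ _ _ => rfl⟩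
    simp [hcost]
  | cons r R ih =>
    obtain ⟨rfl, hc⟩ := hc
    obtain ⟨hr₀, hr⟩ := List.forall_mem_cons.1 hr
    obtain ⟨hR₀, hR⟩ := List.pairwise_cons.1 hR
    obtain ⟨M₁, t₁, hE₁, ht₁, hB₁, e₄, hb₁, hf₁⟩ := exec_runBlock (ans := ans) hM hans hw h4 hr₀
    have hsame : ∀ r ∈ R, SameBlock M M₁ r := by
      intro r hrR i hi
      have := hR₀ r hrR
      have := (hr r hrR).1
      exact hf₁ _ (by omega) (by omega)
    have hruns : R.flatMap (runs M₁) = R.flatMap (runs M) := by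
      apply List.flatMap_congr
      intro r hrR
      exact (hsame r hrR).runs_eq (hr r hrR).2.2.1
    obtain ⟨M₂, t₂, hE₂, ht₂, hB₂, hb₂, hf₂⟩ := ih hB₁ e₄
      (hc.congr fun r hrR => hsame r hrR 7 (by norm_num))
      (fun r hrR => (hsame r hrR).runnable (hr r hrR)) hR (by
        refine (fits_of_fits' (by omega) hB₁ ?_).1
        simp only [Fits', Expr.eval]
        omega)
    rw [hruns] at hE₂ ht₂
    have h64 := hr₀.1
    refine ⟨M₂, _, .while_true _ _ _ _ _ _ _ _ _ hfits (by simp only [Expr.eval, h4]; omega) hE₁ hE₂,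
      ?_, hB₂, ?_, ?_⟩
    · rw [hcost, List.flatMap_cons, List.length_append, List.length_cons]; omega
    · intro r' hr'
      rcases List.mem_cons.1 hr' with rfl | hr'
      · refine hb₁.of_sameBlock_right fun i hi => hf₂ _ (by omega) fun r hrR => ?_
        have := hR₀ r hrR
        omega
      · exact (hb₂ r' hr').of_sameBlock_left (hsame r' hr') (hr r' hr').2.2.1
    · intro b h₁ h₂
      obtain ⟨h₃, h₂⟩ := List.forall_mem_cons.1 h₂
      rw [hf₂ b h₁ h₂, hf₁ b h₁ h₃]

lemma exec_runProg {ans : ℕ → ℕ} {s w : ℕ} {P : ℕ → ℕ → Prop} (hans : ∀ x, ans x ≤ 2) (hw : s ≤ w)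
    (hs : 5 ≤ s) {R : List ℕ} {M : Memory} (hM : Bounded w M)
    (hc : Chain M (M 0) R) (hr : ∀ r ∈ R, Runnable s w (P r) M r)
    (hR : R.Pairwise fun r r' => r + 8 ≤ r' ∨ r' + 8 ≤ r) :
    ∃ M' t, Exec ans s w runProg M M' t (R.flatMap (runs M)) ∧
      t ≤ 70 * (R.flatMap (runs M)).length + 90 * R.length + 10 ∧ Bounded w M' ∧
      (∀ r ∈ R, BlockStep ans (P r) M M' r) ∧
      ∀ b, b < 4 ∨ 64 ≤ b → (∀ r ∈ R, b < r ∨ r + 8 ≤ b) → M' b = M b := by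
  obtain ⟨M₁, t₁, hE₁, ht₁, hB₁, h₄, hf₁⟩ : ∃ M' t, Exec ans s w (4 ::= cell 0) M M' t [] ∧
      t ≤ costBound (4 ::= cell 0) ∧ Bounded w M' ∧ M' 4 = M 0 ∧ ∀ b, b ≠ 4 → M' b = M b := by
    apply exec_of_wp (by omega) hM
    simp [wp, Fits', zero_def, ofNat_def, Expr.eval, Function.update_apply]
    and_intros
    all_goals omega
  have hsame : ∀ r ∈ R, SameBlock M M₁ r := by
    intro r hrR i hi
    have := (hr r hrR).1
    exact hf₁ _ (by omega)
  have hruns : R.flatMap (runs M₁) = R.flatMap (runs M) := by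
    apply List.flatMap_congr
    intro r hrR
    exact (hsame r hrR).runs_eq (hr r hrR).2.2.1
  obtain ⟨M₂, t₂, hE₂, ht₂, hB₂, hb₂, hf₂⟩ := exec_runLoop hans hw hs R hB₁ h₄
      (hc.congr fun r hrR => hsame r hrR 7 (by norm_num))
      (fun r hrR => (hsame r hrR).runnable (hr r hrR)) hR
  rw [hruns] at hE₂ ht₂
  refine ⟨M₂, _, .seq _ _ _ _ _ _ _ [] _ hE₁ hE₂, ?_, hB₂, fun r hrR =>
    (hb₂ r hrR).of_sameBlock_left (hsame r hrR) (hr r hrR).2.2.1, fun b h₁ h₂ => ?_⟩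
  · have : costBound (4 ::= cell 0) = 4 := rfl
    omega
  · by_cases hb : b = 4
    · omega
    · rw [hf₂ b h₁ h₂, hf₁ b hb]

/-! ### The invariant for a single segment -/

/-- The record at address `q` describes, after step `h`, the segment of length `2 ^ l` that begins
at position `a` and has been created in step `e`. Its relevant processes have been run in all steps
from `e` on. -/
structure SegOK {α : Type*} {n : ℕ} (S : LandmarkScheme n) (T : ℕ → α) (lg : ℕ → List ℕ) (h : ℕ)
    (M : Memory) (q a l e : ℕ) : Prop where
  start : M q = a
  len : M (q + 1) = 2 ^ l
  tag : M (q + 2) ≤ 5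
  mem : ∀ c ∈ runs M q, a ≤ c ∧ c < a + 2 ^ l
  run : ∀ c ∈ runs M q, ∀ t, e ≤ t → t ≤ h → c ∈ lg t
  dead : ∀ c, a ≤ c → c < a + 2 ^ l → c ∉ runs M q → Dead S T lg h c
  sparse : M (q + 2) ≠ 5 → (runs M q).Nodup ∧
    ∀ c ∈ runs M q, ∀ t, e ≤ t → t ≤ h → ¬ Fails S T t c
  dense : M (q + 2) = 5 → ∃ g, 0 < g ∧ M (q + 4) = 2 * g ∧ 4 * g ≤ 2 ^ l ∧ a ≤ M (q + 3) ∧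
    M (q + 3) < a + g ∧ Structured T a (2 ^ l) (M (q + 3)) g ∧
    RegOK (fun x => x ∈ runs M q ∧ ∃ t, e ≤ t ∧ t ≤ h ∧ Succeeds S T t x)
      (M (q + 5)) (M (q + 6))

section

variable {α : Type*} {n : ℕ} {S : LandmarkScheme n} {T : ℕ → α} {lg lg' : ℕ → List ℕ} {h : ℕ}
  {M M' : Memory} {q a l e : ℕ}

lemma mem_runs_dense {m g c x : ℕ} (h5 : M (q + 2) = 5) (hg : 0 < g) (hp : M (q + 4) = 2 * g)
    (ha : M q = a) (hm : M (q + 1) = m) (h3 : M (q + 3) = c) (hc : c < a + g) (hac : a ≤ c) :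
    x ∈ runs M q ↔ a ≤ x ∧ x < a + m ∧ (g : ℤ) ∣ (x : ℤ) - c := by
  rw [runs, if_pos h5, hp, Nat.mul_div_cancel_left _ (by norm_num), ha, hm, h3]
  simp only [List.mem_map, List.mem_range]
  constructor
  · rintro ⟨i, hi, rfl⟩
    refine ⟨by omega, (lt_count_iff hg i).2 hi, ⟨i, ?_⟩⟩
    push_cast; ring
  · rintro ⟨h₁, h₂, i, hi⟩
    have hi0 : 0 ≤ i := by
      by_contra hneg
      have : (g : ℤ) * i ≤ (g : ℤ) * (-1) := mul_le_mul_of_nonneg_left (by omega) (by omega)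
      omega
    obtain ⟨i, rfl⟩ := Int.eq_ofNat_of_zero_le hi0
    have hx : c + i * g = x := by
      zify; rw [mul_comm]; omega
    exact ⟨i, (lt_count_iff hg i).1 (by omega), hx⟩

lemma dead_mono {c h' : ℕ} (hd : Dead S T lg h c) (hh : h ≤ h') (hl : ∀ t, t ≤ h → lg' t = lg t) :
    Dead S T lg' h' c := by
  obtain ⟨j, h₁, h₂, h₃, h₄⟩ := hd
  exact ⟨j, h₁, h₂.trans hh, by rwa [hl j h₂], h₄⟩

lemma SegOK.congr_log (hs : SegOK S T lg h M q a l e) (hl : ∀ t, t ≤ h → lg' t = lg t) :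
    SegOK S T lg' h M q a l e where
  start := hs.start
  len := hs.len
  tag := hs.tag
  mem := hs.mem
  run c hc t h₁ h₂ := by rw [hl t h₂]; exact hs.run c hc t h₁ h₂
  dead c h₁ h₂ h₃ := dead_mono (hs.dead c h₁ h₂ h₃) le_rfl hl
  sparse := hs.sparse
  dense := hs.dense

lemma SegOK.congr_mem (hs : SegOK S T lg h M q a l e)
    (hM : ∀ i, i < 7 → M' (q + i) = M (q + i)) : SegOK S T lg h M' q a l e := by
  have hr := runs_congr hM hs.tag
  obtain ⟨h₁, h₂, h₃, h₄, h₅, h₆, h₇, h₈⟩ := hs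
  have h0 : M' q = M q := hM 0 (by norm_num)
  constructor
  all_goals
    simp only [hr, h0, hM 1 (by norm_num), hM 2 (by norm_num), hM 3 (by norm_num),
      hM 4 (by norm_num), hM 5 (by norm_num), hM 6 (by norm_num)]
    assumption

/-- The invariant is maintained by a run of all relevant processes. -/
lemma SegOK.step (hs : SegOK S T lg h M q a l e) (he : e ≤ h + 1)
    (hb : BlockStep (runAnswer S T (h + 1))
      (fun x => x ∈ runs M q ∧ ∃ t, e ≤ t ∧ t ≤ h ∧ Succeeds S T t x) M M' q)
    (hl : ∀ t, t ≤ h → lg' t = lg t) (hlog : ∀ c ∈ runs M q, c ∈ lg' (h + 1)) :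
    SegOK S T lg' (h + 1) M' q a l e := by
  obtain ⟨b₀, b₁, -, bd, bs⟩ := hb
  have hrun : ∀ c ∈ runs M q, ∀ t, e ≤ t → t ≤ h + 1 → c ∈ lg' t := by
    intro c hc t h₁ h₂
    rcases Nat.lt_or_ge h t with h₃ | h₃
    · obtain rfl : t = h + 1 := by omega
      exact hlog c hc
    · rw [hl t h₃]; exact hs.run c hc t h₁ h₃
  have hdead : ∀ c, a ≤ c → c < a + 2 ^ l → c ∉ runs M q → Dead S T lg' (h + 1) c :=
    fun c h₁ h₂ h₃ => dead_mono (hs.dead c h₁ h₂ h₃) (by omega) hl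
  by_cases h5 : M (q + 2) = 5
  · obtain ⟨c₂, c₃, c₄, hR⟩ := bd h5
    have hr : runs M' q = runs M q := by
      rw [runs, runs, if_pos h5, if_pos c₂, b₀, b₁, c₃, c₄]
    refine ⟨b₀.trans hs.start, b₁.trans hs.len, by omega, by rw [hr]; exact hs.mem,
      by rw [hr]; exact hrun, by rw [hr]; exact hdead, fun h => absurd c₂ h, fun _ => ?_⟩
    obtain ⟨g, d₁, d₂, d₃, d₄, d₅, d₆, -⟩ := hs.dense h5
    rw [c₃, c₄, hr]
    refine ⟨g, d₁, d₂, d₃, d₄, d₅, d₆, hR.congr fun x => ?_⟩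
    rw [runAnswer_eq_one]
    constructor
    · rintro (⟨hx, t, h₁, h₂, h₃⟩ | ⟨hx, h₃⟩)
      exacts [⟨hx, t, h₁, by omega, h₃⟩, ⟨hx, h + 1, he, le_rfl, h₃⟩]
    · rintro ⟨hx, t, h₁, h₂, h₃⟩
      rcases Nat.lt_or_ge h t with h₄ | h₄
      · obtain rfl : t = h + 1 := by omega
        exact Or.inr ⟨hx, h₃⟩
      · exact Or.inl ⟨hx, t, h₁, h₄, h₃⟩
  · obtain ⟨c₂, hc⟩ := bs h5
    have hr : runs M' q = (runs M q).filter fun c => runAnswer S T (h + 1) c ≠ 2 := by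
      rw [runs, if_neg (by omega), hc]
    have hmem : ∀ c, c ∈ runs M' q ↔ c ∈ runs M q ∧ ¬ Fails S T (h + 1) c := by
      intro c
      rw [hr, List.mem_filter]
      simp [runAnswer_eq_two]
    refine ⟨b₀.trans hs.start, b₁.trans hs.len, by omega, fun c hc => hs.mem c ((hmem c).1 hc).1,
      fun c hc => hrun c ((hmem c).1 hc).1, fun c h₁ h₂ h₃ => ?_, fun _ => ⟨?_, ?_⟩,
      fun h => by omega⟩
    · by_cases hcr : c ∈ runs M q
      · refine ⟨h + 1, by omega, le_rfl, hlog c hcr, ?_⟩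
        by_contra hf
        exact h₃ ((hmem c).2 ⟨hcr, hf⟩)
      · exact hdead c h₁ h₂ hcr
    · rw [hr]; exact (hs.sparse h5).1.filter _
    · intro c hc t h₁ h₂
      obtain ⟨hc, hf⟩ := (hmem c).1 hc
      rcases Nat.lt_or_ge h t with h₄ | h₄
      · obtain rfl : t = h + 1 := by omega
        exact hf
      · exact (hs.sparse h5).2 c hc t h₁ h₄

/-! ### Merging two segments -/

/-- A process that has succeeded late is the center of a long palindrome. -/
lemma palAt_of_succeeds {t c R : ℕ} (hs : Succeeds S T t c) (hR : R + c ≤ t + 1) :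
    PalAt (toWord T) c R :=
  (palAt_of_isPalindromeAt hs.1 hs.2.2).mono (by omega)

lemma SegOK.centers_mem (hs : SegOK S T lg h M q a l e) : ∀ c ∈ centers M q, c ∈ runs M q := by
  intro c hc
  unfold centers at hc
  split_ifs at hc with h5 h6 h7
  · obtain ⟨g, d₁, d₂, d₃, d₄, d₅, -⟩ := hs.dense h5
    rw [mem_runs_dense h5 d₁ d₂ hs.start hs.len rfl d₅ d₄]
    rw [d₂, Nat.mul_div_cancel_left _ (by norm_num)] at hc
    simp only [List.mem_cons, List.not_mem_nil, or_false] at hc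
    rcases hc with rfl | rfl
    · exact ⟨d₄, by omega, by simp⟩
    · exact ⟨by omega, by omega, by simp⟩
  · obtain ⟨g, d₁, d₂, d₃, d₄, d₅, -, hR⟩ := hs.dense h5
    rw [List.mem_singleton] at hc
    subst hc
    exact (hR.2.1 h7).1
  · simp at hc
  · rw [runs, if_neg h5]; exact hc

lemma SegOK.nodup_centers (hs : SegOK S T lg h M q a l e) (hf : ¬ Flagged M q) :
    (centers M q).Nodup := by
  unfold centers
  split_ifs with h5 h6 h7
  · exact absurd ⟨h5, h6⟩ hf
  · simp
  · simp
  · have := (hs.sparse h5).1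
    rwa [runs, if_neg h5] at this

lemma nodup_centers_append {q₁ q₂ e₁ e₂ : ℕ} (h₁ : SegOK S T lg h M q₁ a l e₁)
    (h₂ : SegOK S T lg h M q₂ (a + 2 ^ l) l e₂) (hf₁ : ¬ Flagged M q₁) (hf₂ : ¬ Flagged M q₂) :
    (centers M q₁ ++ centers M q₂).Nodup := by
  refine (h₁.nodup_centers hf₁).append (h₂.nodup_centers hf₂) fun x hx hx' => ?_
  have := h₁.mem x (h₁.centers_mem x hx)
  have := h₂.mem x (h₂.centers_mem x hx')
  omega

/-- The time `e` at which the segment was created is late enough for the palindromes that have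
been found since then to be long, and at least `2 ^ l` steps have passed since then, so that all
relevant processes have met a landmark. -/
structure Mature (n h a l e μ : ℕ) : Prop where
  pos : 1 ≤ a
  two_mul : 2 ^ l = 2 * μ
  created : e + 5 = a + 9 * μ
  old : e + 2 ^ l ≤ h + 1
  le : h + 1 ≤ n

variable {μ : ℕ}

lemma Mature.pos_half (hm : Mature n h a l e μ) : 0 < μ := by
  have := hm.two_mul
  have : 0 < 2 ^ l := by positivity
  omega

lemma Mature.tested (hm : Mature n h a l e μ) (hb : ∀ l, l ≤ S.L → 12 ≤ S.b l)
    (hn : (n : ℕ∞) ≤ S.b S.L * 2 ^ S.L) {c : ℕ} (hc : a ≤ c) (hc' : c < a + 2 ^ l) :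
    ∃ t, e ≤ t ∧ t ≤ h ∧ 1 ≤ t ∧ (Succeeds S T t c ∨ Fails S T t c) := by
  have h₀ := hm.pos_half
  obtain ⟨h₁, h₂, h₃, h₄, h₅⟩ := hm
  obtain ⟨t, ht₁, ht₂, ht⟩ := exists_succeeds_or_fails S T hb hn (l := l) (c := c) (t₀ := e)
    (by omega) (by omega) (by omega)
  exact ⟨t, ht₁, by omega, by omega, ht⟩

lemma Mature.palAt (hm : Mature n h a l e μ) {t c : ℕ} (hc : c < a + 2 ^ l) (ht : e ≤ t)
    (hs : Succeeds S T t c) : PalAt (toWord T) c (7 * μ - 3 : ℤ) := by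
  have h₀ := hm.pos_half
  obtain ⟨h₁, h₂, h₃, h₄, h₅⟩ := hm
  have := palAt_of_succeeds hs (R := 7 * μ - 3) (by omega)
  rwa [Nat.cast_sub (by omega)] at this

/-- Unless two different relevant processes of a dense segment have succeeded, all centers except
those that take part in the merge are dead. -/
lemma SegOK.dead_of_not_flagged (hs : SegOK S T lg h M q a l e)
    (hm : M (q + 2) = 5 → ∃ μ, Mature n h a l e μ) (hb : ∀ l, l ≤ S.L → 12 ≤ S.b l)
    (hn : (n : ℕ∞) ≤ S.b S.L * 2 ^ S.L) (hf : ¬ Flagged M q) {c : ℕ} (hc : a ≤ c)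
    (hc' : c < a + 2 ^ l) (hcc : c ∉ centers M q) : Dead S T lg h c := by
  by_cases h5 : M (q + 2) = 5
  · by_cases hcr : c ∈ runs M q
    · obtain ⟨μ, hm⟩ := hm h5
      obtain ⟨t, ht₁, ht₂, ht₃, ht | ht⟩ := hm.tested (T := T) hb hn hc hc'
      · exfalso
        have h6 : M (q + 6) = 0 := by
          by_contra h6; exact hf ⟨h5, h6⟩
        obtain ⟨g, -, -, -, -, -, -, hR⟩ := hs.dense h5
        have hcu := hR.2.2.1 h6 c ⟨hcr, t, ht₁, ht₂, ht⟩
        have h0 : M (q + 5) ≠ 0 := by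
          have := hm.pos
          omega
        apply hcc
        rw [centers, if_pos h5, if_neg (by simpa using h6), if_pos h0, hcu]
        simp
      · exact ⟨t, ht₃, ht₂, hs.run c hcr t ht₁ ht₂, ht⟩
    · exact hs.dead c hc hc' hcr
  · rw [centers, if_neg h5] at hcc
    apply hs.dead c hc hc'
    rwa [runs, if_neg h5]

lemma SegOK.palAt_of_not_flagged (hs : SegOK S T lg h M q a l e) (hm : Mature n h a l e μ)
    (hb : ∀ l, l ≤ S.L → 12 ≤ S.b l) (hn : (n : ℕ∞) ≤ S.b S.L * 2 ^ S.L) (hf : ¬ Flagged M q)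
    {c : ℕ} (hc : c ∈ centers M q) : PalAt (toWord T) c (7 * μ - 3 : ℤ) := by
  have hcr := hs.centers_mem c hc
  obtain ⟨h₁, h₂⟩ := hs.mem c hcr
  by_cases h5 : M (q + 2) = 5
  · obtain ⟨g, -, -, -, -, -, -, hR⟩ := hs.dense h5
    have h6 : M (q + 6) = 0 := by
      by_contra h6; exact hf ⟨h5, h6⟩
    rw [centers, if_pos h5, if_neg (by simpa using h6)] at hc
    split_ifs at hc with h0
    · rw [List.mem_singleton] at hc
      obtain ⟨-, t, ht₁, ht₂, ht⟩ := hR.2.1 h0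
      subst hc
      exact hm.palAt h₂ ht₁ ht
    · simp at hc
  · obtain ⟨t, ht₁, ht₂, ht₃, ht | ht⟩ := hm.tested (T := T) hb hn h₁ h₂
    · exact hm.palAt h₂ ht₁ ht
    · exact absurd ht ((hs.sparse h5).2 c hcr t ht₁ ht₂)

/-- If two different relevant processes of a dense segment have succeeded, then the periodicity of
the segment extends far beyond its ends. -/
lemma SegOK.exists_word_of_flagged (hs : SegOK S T lg h M q a l e) (hm : Mature n h a l e μ)
    (hf : Flagged M q) {b : ℤ} (hb : b ≤ a) (hb' : a ≤ b + 2 * μ) :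
    ∃ (F : ℤ → α) (g : ℕ), 0 < g ∧ M (q + 4) = 2 * g ∧ 2 * g ≤ μ ∧ Sym F (M (q + 3)) ∧
      HalfPeriod F g ∧ ∀ i, b - 3 * μ + 2 ≤ i → i < b + 7 * μ - 3 → toWord T i = F i := by
  obtain ⟨g, d₁, d₂, d₃, d₄, d₅, ⟨F, hF, hg, hU⟩, hR⟩ := hs.dense hf.1
  obtain ⟨x, y, hxy, ⟨hx, t, ht₁, ht₂, ht⟩, ⟨hy, t', ht₁', ht₂', ht'⟩⟩ := hR.2.2.2 hf.2
  rw [mem_runs_dense hf.1 d₁ d₂ hs.start hs.len rfl d₅ d₄] at hx hy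
  have h2 := hm.two_mul
  obtain ⟨hx₁, hx₂, k, hk⟩ := hx
  obtain ⟨hy₁, hy₂, k', hk'⟩ := hy
  refine ⟨F, g, d₁, d₂, by omega, hF, hg, ?_⟩
  refine extend_word (b := a) (c := M (q + 3)) (u := x) (v := y) (g := g) hb hb' le_rfl hF hg
    (fun i h₁ h₂ => hU i h₁ (by rw [h2]; push_cast; omega)) (by omega) (by omega) (by omega)
    ⟨k, by rw [mul_comm]; omega⟩ ⟨k', by rw [mul_comm]; omega⟩ (hm.palAt hx₂ ht₁ ht)
    (hm.palAt hy₂ ht₁' ht')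

lemma SegOK.palAt_centers (hs : SegOK S T lg h M q a l e) (hm : Mature n h a l e μ)
    (hbS : ∀ l, l ≤ S.L → 12 ≤ S.b l) (hn : (n : ℕ∞) ≤ S.b S.L * 2 ^ S.L)
    {b : ℤ} (hb : b ≤ a) (hb' : a ≤ b + 2 * μ) {c : ℕ} (hc : c ∈ centers M q) :
    PalAt (toWord T) c μ := by
  have h₀ := hm.pos_half
  by_cases hf : Flagged M q
  · obtain ⟨F, g, hg, hp, hgμ, hF, hFg, hU⟩ := hs.exists_word_of_flagged hm hf hb hb'
    have hsym : Sym F (c : ℤ) := by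
      rw [centers, if_pos hf.1, if_pos hf.2, hp, Nat.mul_div_cancel_left _ (by norm_num)] at hc
      simp only [List.mem_cons, List.not_mem_nil, or_false] at hc
      rcases hc with rfl | rfl
      · exact hF
      · have := hF.add_mul hFg 1
        simpa using this
    obtain ⟨h₁, h₂⟩ := hs.mem c (hs.centers_mem c hc)
    have h2 := hm.two_mul
    intro i hi₁ hi₂
    rw [hU i (by omega) (by omega), hU _ (by omega) (by omega)]
    exact hsym i
  · exact (hs.palAt_of_not_flagged hm hbS hn hf hc).mono (by omega)

/-- When the merged segment gets a dense description, there is a periodic word that the text follows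
far beyond the ends of the segment, and the common divisor of the distances between the centers is a
half-period of this word. -/
lemma exists_word_of_merge {q₁ q₂ e₁ e₂ x₀ : ℕ} (h₁ : SegOK S T lg h M q₁ a l e₁)
    (h₂ : SegOK S T lg h M q₂ (a + 2 ^ l) l e₂) (hm₁ : Mature n h a l e₁ μ)
    (hm₂ : Mature n h (a + 2 ^ l) l e₂ μ) (hb : ∀ l, l ≤ S.L → 12 ≤ S.b l)
    (hn : (n : ℕ∞) ≤ S.b S.L * 2 ^ S.L)
    (hX : (Flagged M q₁ ∨ Flagged M q₂) ∨ 5 ≤ (centers M q₁ ++ centers M q₂).length) :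
    ∃ (F : ℤ → α) (g : ℕ), 0 < g ∧ g ≤ μ ∧ gcdDist x₀ (centers M q₁ ++ centers M q₂) ∣ g ∧
      HalfPeriod F g ∧ ∀ i : ℤ, a - 3 * μ + 2 ≤ i → i < a + 7 * μ - 3 → toWord T i = F i := by
  have h2 := hm₁.two_mul
  have hflag : ∀ q a' e, SegOK S T lg h M q a' l e → Mature n h a' l e μ → Flagged M q → a ≤ a' →
      a' ≤ a + 2 * μ → (∀ c ∈ centers M q, c ∈ centers M q₁ ++ centers M q₂) →
      ∃ (F : ℤ → α) (g : ℕ), 0 < g ∧ g ≤ μ ∧ gcdDist x₀ (centers M q₁ ++ centers M q₂) ∣ g ∧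
        HalfPeriod F g ∧ ∀ i : ℤ, a - 3 * μ + 2 ≤ i → i < a + 7 * μ - 3 → toWord T i = F i := by
    intro q a' e hs hm hf ha ha' hsub
    obtain ⟨F, g, hg, hp, hgμ, hF, hFg, hU⟩ := hs.exists_word_of_flagged hm hf (b := a)
      (by omega) (by omega)
    refine ⟨F, g, hg, by omega, ?_, hFg, hU⟩
    rw [centers, if_pos hf.1, if_pos hf.2, hp, Nat.mul_div_cancel_left _ (by norm_num)] at hsub
    have := gcdDist_dvd_sub x₀ _ (hsub (M (q + 3) + g) (by simp)) (hsub (M (q + 3)) (by simp))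
    rw [← Int.natCast_dvd_natCast]
    simpa using this
  by_cases hf₁ : Flagged M q₁
  · exact hflag q₁ a e₁ h₁ hm₁ hf₁ le_rfl (by omega) fun c hc => List.mem_append_left _ hc
  by_cases hf₂ : Flagged M q₂
  · exact hflag q₂ _ e₂ h₂ hm₂ hf₂ (by omega) (by omega) fun c hc => List.mem_append_right _ hc
  have hr : ∀ x ∈ centers M q₁ ++ centers M q₂, a ≤ x ∧ x < a + 4 * μ ∧
      PalAt (toWord T) x (7 * μ - 3 : ℤ) := by
    intro x hx
    rcases List.mem_append.1 hx with hx | hx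
    · have := h₁.mem x (h₁.centers_mem x hx)
      exact ⟨by omega, by omega, h₁.palAt_of_not_flagged hm₁ hb hn hf₁ hx⟩
    · have := h₂.mem x (h₂.centers_mem x hx)
      exact ⟨by omega, by omega, h₂.palAt_of_not_flagged hm₂ hb hn hf₂ hx⟩
  obtain ⟨x, hx, y, hy, hxy, hd⟩ := exists_close (X := centers M q₁ ++ centers M q₂) (a := a)
    hm₁.pos_half (nodup_centers_append h₁ h₂ hf₁ hf₂) (by tauto)
    fun x hx => ⟨(hr x hx).1, (hr x hx).2.1⟩
  obtain ⟨hx₁, hx₂, hx₃⟩ := hr x hx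
  obtain ⟨hy₁, hy₂, hy₃⟩ := hr y hy
  obtain ⟨F, hF, hU⟩ := exists_word_of_close (a := a) (μ := μ) le_rfl (by omega) (by omega)
    (by omega) hx₃ hy₃
  have hcast : ((y - x : ℕ) : ℤ) = (y : ℤ) - x := by omega
  refine ⟨F, y - x, by omega, by omega, ?_, by rwa [hcast], hU⟩
  rw [← Int.natCast_dvd_natCast, hcast]
  exact gcdDist_dvd_sub x₀ _ hy hx

/-- The merge of two segments that have existed for long enough. -/
lemma SegOK.merge {q₁ q₂ qp e₁ e₂ : ℕ} (h₁ : SegOK S T lg h M q₁ a l e₁)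
    (h₂ : SegOK S T lg h M q₂ (a + 2 ^ l) l e₂)
    (hm₁ : ∀ k, l = k + 1 → Mature n h a l e₁ (2 ^ k))
    (hm₂ : ∀ k, l = k + 1 → Mature n h (a + 2 ^ l) l e₂ (2 ^ k)) (hb : ∀ l, l ≤ S.L → 12 ≤ S.b l)
    (hn : (n : ℕ∞) ≤ S.b S.L * 2 ^ S.L) (hstart : M' qp = M q₁) (hlen : M' (qp + 1) = 2 ^ (l + 1))
    (hdesc : MergedDesc M' qp (M q₁) (Flagged M q₁ ∨ Flagged M q₂)
      (centers M q₁ ++ centers M q₂)) :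
    SegOK S T lg h M' qp a (l + 1) (h + 1) := by
  have hlarge : (Flagged M q₁ ∨ Flagged M q₂) ∨ 5 ≤ (centers M q₁ ++ centers M q₂).length →
      ∃ k, l = k + 1 := by
    intro hX
    rcases l with _ | k
    · exfalso
      have hnf : ∀ {q a e}, SegOK S T lg h M q a 0 e → M (q + 2) ≠ 5 := by
        intro q a e hs h5
        obtain ⟨g, d₁, -, d₃, -⟩ := hs.dense h5
        omega
      have hle : ∀ {q a e}, SegOK S T lg h M q a 0 e → (centers M q).length ≤ 1 := by
        intro q a e hs
        have hnd := hs.nodup_centers fun hf => hnf hs hf.1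
        have : (centers M q).toFinset ⊆ {a} := by
          intro x hx
          have := hs.mem x (hs.centers_mem x (List.mem_toFinset.1 hx))
          simp only [Finset.mem_singleton]; omega
        have := Finset.card_le_card this
        rwa [List.toFinset_card_of_nodup hnd, Finset.card_singleton] at this
      rcases hX with (hf | hf) | hX
      · exact hnf h₁ hf.1
      · exact hnf h₂ hf.1
      · have := hle h₁
        have := hle h₂
        rw [List.length_append] at hX
        omega
    · exact ⟨k, rfl⟩
  have hdense : ∀ {q a e}, SegOK S T lg h M q a l e → M (q + 2) = 5 → ∃ k, l = k + 1 := by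
    intro q a e hs h5
    obtain ⟨g, d₁, -, d₃, -⟩ := hs.dense h5
    rcases l with _ | k
    · omega
    · exact ⟨k, rfl⟩
  have hpow : 2 ^ (l + 1) = 2 * 2 ^ l := pow_succ' _ _
  have hmem : ∀ x ∈ centers M q₁ ++ centers M q₂, a ≤ x ∧ x < a + 2 ^ (l + 1) := by
    intro x hx
    rcases List.mem_append.1 hx with hx | hx
    · have := h₁.mem x (h₁.centers_mem x hx); omega
    · have := h₂.mem x (h₂.centers_mem x hx); omega
  have hdead₁ : ¬ Flagged M q₁ → ∀ c, a ≤ c → c < a + 2 ^ l → c ∉ centers M q₁ →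
      Dead S T lg h c := fun hf c hc hc' => h₁.dead_of_not_flagged (fun h5 => by
    obtain ⟨k, hk⟩ := hdense h₁ h5
    exact ⟨_, hm₁ k hk⟩) hb hn hf hc hc'
  have hdead₂ : ¬ Flagged M q₂ → ∀ c, a + 2 ^ l ≤ c → c < a + 2 ^ l + 2 ^ l → c ∉ centers M q₂ →
      Dead S T lg h c := fun hf c hc hc' => h₂.dead_of_not_flagged (fun h5 => by
    obtain ⟨k, hk⟩ := hdense h₂ h5
    exact ⟨_, hm₂ k hk⟩) hb hn hf hc hc'
  rcases hdesc with ⟨hX, t2, t3, t4, t5, t6⟩ | ⟨hnf, hX, t2, tX⟩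
  · obtain ⟨k, hk⟩ := hlarge hX
    have M₁ := hm₁ k hk
    have M₂ := hm₂ k hk
    obtain ⟨μ, hμ⟩ : ∃ μ, 2 ^ k = μ := ⟨_, rfl⟩
    rw [hμ] at M₁ M₂
    have h2 := M₁.two_mul
    have hμ0 := M₁.pos_half
    obtain ⟨X, hXdef⟩ : ∃ X, centers M q₁ ++ centers M q₂ = X := ⟨_, rfl⟩
    obtain ⟨x₀, hx₀⟩ : ∃ x₀, X.headD 0 = x₀ := ⟨_, rfl⟩
    obtain ⟨F, g, hg, hgμ, hdvd, hFg, hU⟩ := exists_word_of_merge (x₀ := x₀) h₁ h₂ M₁ M₂ hb hn hX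
    have hx₀X : x₀ ∈ X := by
      rcases X with _ | ⟨y, X⟩
      · exfalso
        rw [List.append_eq_nil_iff] at hXdef
        rcases hX with (hf | hf) | hX
        · have := hXdef.1
          rw [centers, if_pos hf.1, if_pos hf.2] at this
          simp at this
        · have := hXdef.2
          rw [centers, if_pos hf.1, if_pos hf.2] at this
          simp at this
        · rw [hXdef.1, hXdef.2] at hX
          simp at hX
      · rw [← hx₀]; simp
    rw [hXdef] at hdvd hmem t3 t4
    rw [hx₀, h₁.start] at t3
    rw [hx₀] at t4
    have hsym : ∀ x ∈ X, Sym F (x : ℤ) := by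
      intro x hx
      have hxr := hmem x hx
      have hp : PalAt (toWord T) x μ := by
        rw [← hXdef] at hx
        rcases List.mem_append.1 hx with hx | hx
        · exact h₁.palAt_centers M₁ hb hn (b := a) le_rfl (by omega) hx
        · exact h₂.palAt_centers M₂ hb hn (b := a) (by omega) (by omega) hx
      exact sym_of_palAt (by omega) hFg (fun i h₁ h₂ => hU i (by omega) (by omega))
        (hp.mono (by omega))
    obtain ⟨G, hG⟩ : ∃ G, gcdDist x₀ X = G := ⟨_, rfl⟩
    have hGdvd : ∀ x ∈ X, (G : ℤ) ∣ (x : ℤ) - x₀ := fun x hx => hG ▸ gcdDist_dvd x₀ X hx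
    have hFG : HalfPeriod F G := hG ▸ halfPeriod_gcdDist (hsym x₀ hx₀X) X hsym
    rw [hG] at t3 t4 hdvd
    have hG0 : 0 < G := Nat.pos_of_dvd_of_pos hdvd hg
    have hGg := Nat.le_of_dvd hg hdvd
    have hx₀r := hmem x₀ hx₀X
    have hmod := Nat.mod_lt (x₀ - a) hG0
    have hc : (G : ℤ) ∣ (x₀ : ℤ) - (a + (x₀ - a) % G : ℕ) := by
      refine ⟨((x₀ - a) / G : ℕ), ?_⟩
      have := Nat.mod_add_div (x₀ - a) G
      zify [hx₀r.1] at this ⊢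
      linarith
    have hstart' := hstart.trans h₁.start
    have hruns : ∀ x, x ∈ runs M' qp ↔ a ≤ x ∧ x < a + 2 ^ (l + 1) ∧ (G : ℤ) ∣ (x : ℤ) - x₀ := by
      intro x
      rw [mem_runs_dense t2 hG0 t4 hstart' hlen t3 (by omega) (by omega),
        show (x : ℤ) - (a + (x₀ - a) % G : ℕ) = (x - x₀) + (x₀ - (a + (x₀ - a) % G : ℕ)) by ring,
        dvd_add_left hc]
    have hflag : ∀ {q a' e x}, SegOK S T lg h M q a' l e → Flagged M q → x ∈ runs M q →
        (∀ c ∈ centers M q, c ∈ X) → (G : ℤ) ∣ (x : ℤ) - x₀ := by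
      intro q a' e x hs hf hx hsub
      obtain ⟨g', d₁, d₂, -, d₄, d₅, -⟩ := hs.dense hf.1
      rw [mem_runs_dense hf.1 d₁ d₂ hs.start hs.len rfl d₅ d₄] at hx
      rw [centers, if_pos hf.1, if_pos hf.2, d₂, Nat.mul_div_cancel_left _ (by norm_num)] at hsub
      have e₁ := hGdvd _ (hsub (M (q + 3)) (by simp))
      have e₂ := hGdvd _ (hsub (M (q + 3) + g') (by simp))
      have e₃ : (G : ℤ) ∣ g' := by
        have := dvd_sub e₂ e₁
        simpa using this
      have := dvd_add (e₃.trans hx.2.2) e₁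
      simpa using this
    have hcdead : ∀ x, a ≤ x → x < a + 2 ^ (l + 1) → x ∉ runs M' qp → Dead S T lg h x := by
      intro x hx hx' hxr
      have hnd : ¬ (G : ℤ) ∣ (x : ℤ) - x₀ := fun hd => hxr ((hruns x).2 ⟨hx, hx', hd⟩)
      have hxX : x ∉ X := fun h => hnd (hGdvd x h)
      rw [← hXdef, List.mem_append, not_or] at hxX
      rcases Nat.lt_or_ge x (a + 2 ^ l) with hlt | hge
      · by_cases hf : Flagged M q₁
        · exact h₁.dead x hx hlt fun hxr' => hnd (hflag h₁ hf hxr' fun c hc => by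
            rw [← hXdef]; exact List.mem_append_left _ hc)
        · exact hdead₁ hf x hx hlt hxX.1
      · by_cases hf : Flagged M q₂
        · exact h₂.dead x hge (by omega) fun hxr' => hnd (hflag h₂ hf hxr' fun c hc => by
            rw [← hXdef]; exact List.mem_append_right _ hc)
        · exact hdead₂ hf x hge (by omega) hxX.2
    refine ⟨hstart', hlen, by omega, fun c hc => ⟨((hruns c).1 hc).1, ((hruns c).1 hc).2.1⟩,
      fun _ _ t _ _ => by omega, hcdead, fun h => absurd t2 h, fun _ => ⟨G, hG0, t4, by omega,
        by omega, by omega, ⟨F, ?_, hFG, fun i h₁ h₂ => hU i (by omega) ?_⟩, ?_⟩⟩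
    · obtain ⟨i, hi⟩ := hc
      have := (hsym x₀ hx₀X).add_mul hFG (-i)
      rw [t3]
      convert this using 1
      rw [neg_mul, mul_comm i]; omega
    · rw [hpow, h2] at h₂; push_cast at h₂; omega
    · rw [t5, t6]
      refine ⟨fun _ c hc => ?_, fun h => absurd rfl h, fun _ c hc => ?_, fun h => absurd rfl h⟩
      all_goals
        obtain ⟨-, t, ht₁, ht₂, -⟩ := hc
        omega
  · rw [not_or] at hnf
    have hr : runs M' qp = centers M q₁ ++ centers M q₂ := by
      rw [runs, if_neg (by omega), t2, tX]
    refine ⟨hstart.trans h₁.start, hlen, by omega, by rw [hr]; exact hmem,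
      fun _ _ t _ _ => by omega, ?_, fun _ => ⟨?_, fun _ _ t _ _ => by omega⟩, fun h => by omega⟩
    · rw [hr]
      intro x hx hx' hxX
      rw [List.mem_append, not_or] at hxX
      rcases Nat.lt_or_ge x (a + 2 ^ l) with hlt | hge
      · exact hdead₁ hnf.1 x hx hlt hxX.1
      · exact hdead₂ hnf.2 x hge (by omega) hxX.2
    · rw [hr]
      exact nodup_centers_append h₁ h₂ hnf.1 hnf.2

end

/-! ### The invariant for the whole memory -/

lemma addr_disjoint {l k l' k' : ℕ} (hne : l ≠ l' ∨ k ≠ k') (h : l = l' → k < k' + 8 ∧ k' < k + 8) :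
    addr l k + 8 ≤ addr l' k' ∨ addr l' k' + 8 ≤ addr l k := by
  unfold addr
  have := Nat.mod_lt k (show 0 < 8 by norm_num)
  have := Nat.mod_lt k' (show 0 < 8 by norm_num)
  by_cases hl : l = l'
  · have := h hl
    omega
  · omega

/-- The numbers `A l` of segments created on the levels are such that at most `6` segments of every
level are present. -/
def Narrow (A : ℕ → ℕ) : Prop := ∀ l, 2 * A (l + 1) ≤ A l ∧ A l ≤ 2 * A (l + 1) + 6

lemma narrow_made (h : ℕ) : Narrow (made h) := fun l => by
  have := made_bounds h l
  omega

/-- The address of the record of a segment that is given by its level and its number. -/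
def recAddr (x : ℕ × ℕ) : ℕ := addr x.1 x.2

lemma Narrow.disjoint {A : ℕ → ℕ} (hA : Narrow A) {K : ℕ} {x y : ℕ × ℕ} (hx : x ∈ skel A 0 K)
    (hy : y ∈ skel A 0 K) (hne : x ≠ y) :
    recAddr x + 8 ≤ recAddr y ∨ recAddr y + 8 ≤ recAddr x := by
  rw [mem_skel] at hx hy
  apply addr_disjoint
  · by_contra h
    rw [not_or, not_not, not_not] at h
    exact hne (Prod.ext h.1 h.2)
  · intro h
    have := hA x.1
    rw [← h] at hy
    omega

lemma nodup_levelList {l a c : ℕ} (hc : c ≤ a) : (levelList l a c).Nodup := by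
  induction c generalizing a with
  | zero => simp [levelList]
  | succ c ih =>
    rw [levelList, List.nodup_cons, mem_levelList (by omega)]
    exact ⟨fun h => by simp only at h; omega, ih (by omega)⟩

lemma nodup_skel (A : ℕ → ℕ) (l K : ℕ) : (skel A l K).Nodup := by
  induction K generalizing l with
  | zero => simp [skel]
  | succ K ih =>
    rw [skel]
    refine (nodup_levelList (Nat.sub_le _ _)).append (ih _) fun x hx hx' => ?_
    have h₁ := ((mem_levelList (Nat.sub_le _ _)).1 hx).1
    have h₂ := (mem_skel.1 hx').1
    omega

lemma Narrow.pairwise {A : ℕ → ℕ} (hA : Narrow A) (K : ℕ) :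
    ((skel A 0 K).map recAddr).Pairwise fun r r' => r + 8 ≤ r' ∨ r' + 8 ≤ r := by
  rw [List.pairwise_map]
  exact (nodup_skel A 0 K).pairwise_of_forall_ne fun x hx y hy hne => hA.disjoint hx hy hne

lemma Chain.tail {M : Memory} {P R : List ℕ} {q r : ℕ} (h : Chain M q (P ++ r :: R)) :
    Chain M (M (r + 7)) R := by
  induction P generalizing q with
  | nil => exact h.2
  | cons p P ih => exact ih h.2

/-- The part of a linked list behind the record `r` may be exchanged by changing the link in `r`. -/
lemma Chain.splice {M M' : Memory} {P R R' : List ℕ} {q r : ℕ} (h : Chain M q (P ++ r :: R))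
    (hP : ∀ p ∈ P, M' (p + 7) = M (p + 7)) (hR : Chain M' (M' (r + 7)) R') :
    Chain M' q (P ++ r :: R') := by
  induction P generalizing q with
  | nil => exact ⟨h.1, hR⟩
  | cons p P ih =>
    obtain ⟨hp, hP⟩ := List.forall_mem_cons.1 hP
    refine ⟨h.1, ?_⟩
    rw [hp]
    exact ih h.2 hP

lemma made_mul_le (h l : ℕ) : made h l * 2 ^ l ≤ h := by
  cases l with
  | zero => simp [made]
  | succ l =>
    have : 0 < 2 ^ l := by positivity
    have := Nat.div_mul_le_self (h + 4 - 7 * 2 ^ l) (2 ^ (l + 1))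
    rw [made]
    omega

lemma level_le_log {n h l : ℕ} (hn : h ≤ n) (hl : 1 ≤ made h l) : l ≤ Nat.log 2 n + 1 := by
  cases l with
  | zero => omega
  | succ l =>
    have : 0 < 2 ^ l := by positivity
    rw [made, Nat.le_div_iff_mul_le (by positivity), pow_succ] at hl
    have : l ≤ Nat.log 2 n := Nat.le_log_of_pow_le (by norm_num) (by omega)
    omega

lemma skel_add {A : ℕ → ℕ} {l K : ℕ} (h : ∀ l', l + K ≤ l' → A l' = 0) (d : ℕ) :
    skel A l (K + d) = skel A l K := by
  induction K generalizing l with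
  | zero =>
    rw [Nat.zero_add, skel, List.eq_nil_iff_forall_not_mem]
    intro x hx
    have := mem_skel.1 hx
    have := h x.1 (by omega)
    omega
  | succ K ih =>
    rw [show K + 1 + d = K + d + 1 by omega, skel, skel, ih fun l' hl => h l' (by omega)]

/-- There are only logarithmically many segments. -/
lemma length_skel_le_log {n h : ℕ} (hn : h ≤ n) :
    (skel (made h) 0 (n + 5)).length ≤ 10 * (Nat.log 2 n + 1) := by
  have hlog : Nat.log 2 n ≤ n := Nat.log_le_self 2 n
  have h₁ := skel_add (A := made h) (l := 0) (K := Nat.log 2 n + 2) (fun l' hl => by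
    by_contra h0
    have := level_le_log (l := l') hn (by omega)
    omega) (n + 5 - (Nat.log 2 n + 2))
  rw [show Nat.log 2 n + 2 + (n + 5 - (Nat.log 2 n + 2)) = n + 5 by omega] at h₁
  rw [h₁]
  have := length_skel_le h 0 (Nat.log 2 n + 2)
  omega

/-- The invariant between the phases of a step, when `A l` segments have been created on each level
`l`. The records are up to date with respect to the runs in the first `h` steps. -/
structure Ready {α : Type*} {n : ℕ} (S : LandmarkScheme n) (T : ℕ → α) (w : ℕ) (A : ℕ → ℕ)
    (lg : ℕ → List ℕ) (h : ℕ) (M : Memory) : Prop where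
  bounded : Bounded w M
  chain : Chain M (M 0) ((skel A 0 (n + 5)).map recAddr)
  seg : ∀ x ∈ skel A 0 (n + 5),
    SegOK S T lg h M (recAddr x) ((x.2 - 1) * 2 ^ x.1 + 1) x.1 (born x.1 x.2)

section

variable {α : Type*} {n : ℕ} {S : LandmarkScheme n} {T : ℕ → α} {lg lg' : ℕ → List ℕ} {h : ℕ}
  {M : Memory} {w s : ℕ} {ans : ℕ → ℕ}

lemma skel_made_zero (K : ℕ) : skel (made 0) 0 K = [] := by
  rw [List.eq_nil_iff_forall_not_mem]
  intro x hx
  have h₁ := mem_skel.1 hx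
  have h₂ : made 0 x.1 ≤ made 0 x.1 * 2 ^ x.1 := Nat.le_mul_of_pos_right _ (by positivity)
  have h₃ := made_mul_le 0 x.1
  omega

lemma ready_zero (S : LandmarkScheme n) (T : ℕ → α) (w : ℕ) (lg : ℕ → List ℕ) :
    Ready S T w (made 0) lg 0 (fun _ => 0) := by
  refine ⟨fun _ => by simp, ?_, ?_⟩
  · rw [skel_made_zero]; rfl
  · rw [skel_made_zero]; simp

lemma Ready.append (hr : Ready S T w (made h) lg h M) (hs : 200 ≤ s) (hw : 200 + h ≤ w)
    (h1 : M 1 = h) :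
    ∃ M' t, Exec ans s w appendProg M M' t [] ∧ t ≤ 100 ∧ M' 1 = h + 1 ∧
      Ready S T w (Function.update (made h) 0 (h + 1)) lg h M' := by
  obtain ⟨M', t, hE, ht, hB, q, hq, h0, h1, a0, a1, a2, a3, a7, hf⟩ :=
    exec_appendProg (ans := ans) hr.bounded hs hw h1
  have hcost : costBound appendProg ≤ 100 := by decide
  have hq' : q = addr 0 (h + 1) := by rw [hq]; unfold addr; omega
  have hruns : runs M' q = [h + 1] := by
    rw [runs, a2, if_neg (by norm_num)]
    simp [cells, a3]
  have hsk := skel_append_segment (A := made h) (A' := Function.update (made h) 0 (h + 1))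
    (by simp [made]) (fun l => by simp) (made_bounds h 0).1 (n + 4)
  rw [Function.update_self] at hsk
  have e : recAddr (0, h + 1) = q := hq'.symm
  have hsame : ∀ x ∈ skel (made h) 0 (n + 5), SameBlock M M' (recAddr x) := by
    intro x hx i hi
    have hx' := mem_skel.1 hx
    have hd := addr_disjoint (l := x.1) (k := x.2) (l' := 0) (k' := h + 1) (by
      by_contra hcon
      rw [not_or, not_not, not_not] at hcon
      obtain ⟨e₁, e₂⟩ := hcon
      rw [e₁, e₂] at hx'
      simp only [made] at hx'
      omega) (by
      intro e
      rw [e] at hx'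
      have := made_bounds h 0
      simp only [made, Nat.zero_add] at hx' this
      omega)
    rw [← hq'] at hd
    have h64 : 64 ≤ recAddr x := by unfold recAddr addr; omega
    exact hf _ (by omega) (by unfold recAddr; omega)
  refine ⟨M', t, hE, by omega, h1, hB, ?_, ?_⟩
  · rw [hsk]
    refine ⟨by rw [h0, e], ?_⟩
    rw [e, a7]
    refine hr.chain.congr fun r hrx => ?_
    obtain ⟨x, hx, rfl⟩ := List.mem_map.1 hrx
    exact hsame x hx 7 (by norm_num)
  · rw [hsk]
    intro x hx
    rcases List.mem_cons.1 hx with rfl | hx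
    · simp only [e, Nat.add_sub_cancel, pow_zero, mul_one, born]
      refine ⟨a0, by rw [a1, pow_zero], by omega, ?_, fun _ _ t _ _ => by omega, ?_,
        fun _ => ⟨?_, fun _ _ t _ _ => by omega⟩, fun h5 => by omega⟩
      · rw [hruns]; simp
      · rw [hruns]
        intro c h₁ h₂ h₃
        exfalso
        apply h₃
        rw [List.mem_singleton]
        rw [pow_zero] at h₂
        omega
      · rw [hruns]; simp
    · exact (hr.seg x hx).congr_mem fun i hi => hsame x hx i (by omega)

/-- The part of the program that performs the merge, if there is one. -/
def updateProg : Program :=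
  levelProg ;; .ite (ltE (cell 1 + 4) (9 * cell 2)) .skip mergeProg

lemma update_made_eq (hne : ¬ ∃ l j, h + 5 = 2 ^ l * (2 * j + 9)) :
    Function.update (made h) 0 (h + 1) = made (h + 1) := by
  funext l
  cases l with
  | zero => simp [made]
  | succ l =>
    rw [Function.update_of_ne (by omega), made_succ_eq h l fun ⟨j, hj⟩ => hne ⟨l, j, hj⟩]

lemma narrow_update (h : ℕ) : Narrow (Function.update (made h) 0 (h + 1)) := by
  intro l
  have := made_bounds h l
  rcases l with _ | l
  · simp only [Function.update_self, Function.update_of_ne (show 0 + 1 ≠ 0 by omega)]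
    simp only [made] at this ⊢
    omega
  · rw [Function.update_of_ne (by omega), Function.update_of_ne (by omega)]
    omega

/-- The effect of a merge on the list of the segments. -/
lemma skel_update_merge {l j K : ℕ} (hj : h + 5 = 2 ^ l * (2 * j + 9)) (hK : l + 2 ≤ K) :
    ∃ pre post, skel (Function.update (made h) 0 (h + 1)) 0 K =
        pre ++ (l, 2 * j + 3) :: (l, 2 * j + 2) :: (l, 2 * j + 1) :: post ∧
      skel (made (h + 1)) 0 K = pre ++ (l, 2 * j + 3) :: (l + 1, j + 1) :: post ∧
      ∀ x ∈ post, l < x.1 := by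
  have hpos : 0 < 2 ^ l := by positivity
  obtain ⟨hA₀, hA₁⟩ := made_merge hj
  have hnarrow := narrow_update h
  obtain ⟨A, hA⟩ : ∃ A, Function.update (made h) 0 (h + 1) = A := ⟨_, rfl⟩
  rw [hA] at hnarrow ⊢
  have hAj : A (l + 1) = j := by rw [← hA, Function.update_of_ne (by omega), hA₀]
  have hAl : 2 * A (l + 1) + 3 ≤ A l := by
    rw [hAj, ← hA]
    obtain ⟨y, hy⟩ : ∃ y, j * 2 ^ l = y := ⟨_, rfl⟩
    have hjy : h + 5 = 2 * y + 9 * 2 ^ l := by rw [hj, ← hy]; ring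
    rcases l with _ | l'
    · rw [Function.update_self]; omega
    · rw [Function.update_of_ne (by omega), le_made_iff (by omega), born]
      have e₁ : (2 * j + 3) * 2 ^ (l' + 1) = 2 * y + 3 * 2 ^ (l' + 1) := by rw [← hy]; ring
      have e₂ : 2 ^ (l' + 1) = 2 * 2 ^ l' := pow_succ' _ _
      omega
  have hAne : ∀ l', l' ≠ l + 1 → made (h + 1) l' = A l' := by
    intro l' hl'
    rw [← hA]
    rcases l' with _ | l'
    · simp [made]
    · rw [Function.update_of_ne (by omega), made_merge_other hj (by omega)]
  have := skel_merge (A := A) (A' := made (h + 1)) (l := l)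
    (by rw [hA₁, hAj]) hAne hAl (hnarrow (l + 1)).1 (l₀ := 0) (K := K) (by omega) (by omega)
  rwa [hAj] at this

/-- The times of creation of the two halves of a merge, in terms of their positions. -/
lemma mature_of_merge {l j k i : ℕ} (hj : h + 5 = 2 ^ l * (2 * j + 9)) (hl : l = k + 1)
    (hn : h + 1 ≤ n) (hi : i ≤ 1) :
    Mature n h ((2 * j + i) * 2 ^ l + 1) l (born l (2 * j + i + 1)) (2 ^ k) := by
  subst hl
  have h0 : 0 < 2 ^ k := by positivity
  have e₁ : 2 ^ (k + 1) = 2 * 2 ^ k := pow_succ' _ _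
  obtain ⟨y, hy⟩ : ∃ y, j * 2 ^ k = y := ⟨_, rfl⟩
  have e₂ : h + 5 = 4 * y + 18 * 2 ^ k := by rw [hj, e₁, ← hy]; ring
  have e₃ : (2 * j + i) * 2 ^ (k + 1) = 4 * y + i * (2 * 2 ^ k) := by rw [e₁, ← hy]; ring
  have e₄ : born (k + 1) (2 * j + i + 1) = 4 * y + i * (2 * 2 ^ k) + 2 * 2 ^ k + 7 * 2 ^ k - 4 := by
    rw [born, e₁, ← hy]; congr 2; ring
  refine ⟨by omega, e₁, ?_, ?_, hn⟩
  · rw [e₃, e₄]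
    omega
  · rw [e₄, e₁]
    have : i = 0 ∨ i = 1 := by omega
    rcases this with rfl | rfl <;> omega

lemma Ready.update (hr : Ready S T w (Function.update (made h) 0 (h + 1)) lg h M)
    (hs : 64 * (Nat.log 2 n + 1) + 300 ≤ s) (hw : 2 * s + 4000 * n ≤ w)
    (hb : ∀ l, l ≤ S.L → 12 ≤ S.b l) (hbn : (n : ℕ∞) ≤ S.b S.L * 2 ^ S.L) (hn : h + 1 ≤ n)
    (h1 : M 1 = h + 1) :
    ∃ M' t, Exec ans s w updateProg M M' t [] ∧ t ≤ 30000 * (Nat.log 2 n + 1) ∧ M' 1 = h + 1 ∧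
      Ready S T w (made (h + 1)) lg h M' := by
  obtain ⟨M₁, t₁, l, j₀, hE₁, ht₁, hB₁, hlj, g2, g3, hf₁⟩ := exec_levelProg (ans := ans) (s := s)
    hr.bounded (by omega) (by omega) h1
  -- all positions, and all words in the records, are smaller than `2 ^ k`
  obtain ⟨k, hk⟩ : ∃ k, Nat.log 2 n + 4 = k := ⟨_, rfl⟩
  have hk₁ : n + 5 < 2 ^ k := by
    have := Nat.lt_pow_succ_log_self (b := 2) (by norm_num) n
    rw [← hk, show Nat.log 2 n + 4 = (Nat.log 2 n).succ + 3 by omega, pow_add]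
    omega
  have hk₂ : 2 ^ k ≤ 16 * n := by
    have := Nat.pow_log_le_self 2 (x := n) (by omega)
    rw [← hk, pow_add]
    omega
  have hlog : Nat.log 2 (h + 1 + 4) < k := Nat.log_lt_of_lt_pow (by omega) (by omega)
  have g1 : M₁ 1 = h + 1 := by rw [hf₁ 1 (by norm_num) (by norm_num), h1]
  have hpos : 0 < 2 ^ l := by positivity
  have hle : 2 ^ l ≤ h + 1 + 4 := by rw [hlj]; exact Nat.le_mul_of_pos_right _ (by omega)
  have hcost : (ltE (cell 1 + 4) (9 * cell 2)).cost = 9 := rfl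
  have heval : (ltE (cell 1 + 4) (9 * cell 2)).eval M₁ = if h + 1 + 4 < 9 * 2 ^ l then 1 else 0 := by
    simp only [add_def, mul_def, ofNat_def, one_def, Expr.eval, WordOp.eval, g1, g2]
  have hfits : (ltE (cell 1 + 4) (9 * cell 2)).Fits s w M₁ := by
    refine (fits_of_fits' (by omega) hB₁ ?_).1
    simp only [Fits', add_def, mul_def, ofNat_def, one_def, Expr.eval, WordOp.eval, g1, g2]
    omega
  have hsame₁ : ∀ x : ℕ × ℕ, SameBlock M M₁ (recAddr x) := by
    intro x i hi
    have h64 : 64 ≤ recAddr x := by unfold recAddr addr; omega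
    exact hf₁ _ (by omega) (by omega)
  have hready₁ : Ready S T w (Function.update (made h) 0 (h + 1)) lg h M₁ := by
    refine ⟨hB₁, ?_, fun x hx => (hr.seg x hx).congr_mem fun i hi => hsame₁ x i (by omega)⟩
    rw [hf₁ 0 (by norm_num) (by norm_num)]
    refine hr.chain.congr fun r hrx => ?_
    obtain ⟨x, hx, rfl⟩ := List.mem_map.1 hrx
    exact hsame₁ x 7 (by norm_num)
  clear hr hsame₁
  -- if `h + 5` is an odd multiple of `2 ^ l` less than `9 * 2 ^ l`, there is nothing to merge yet
  by_cases hcmp : h + 1 + 4 < 9 * 2 ^ l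
  · have hA := update_made_eq (h := h) (by
      rintro ⟨l', j, hj⟩
      have hll : l = l' := by
        refine two_pow_mul_odd_inj (a := j₀) (b := j + 4) ?_
        rw [show 2 * (j + 4) + 1 = 2 * j + 9 by ring]
        omega
      subst hll
      have : 2 ^ l * 9 ≤ 2 ^ l * (2 * j + 9) := Nat.mul_le_mul_left _ (by omega)
      omega)
    rw [hA] at hready₁
    refine ⟨M₁, _, .seq _ _ _ _ _ _ _ [] [] hE₁ (.ite_true _ _ _ _ _ _ _ hfits
      (by rw [heval, if_pos hcmp]; norm_num) (.skip M₁)), by rw [hcost]; omega, g1, hready₁⟩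
  obtain ⟨j, rfl⟩ : ∃ j, j₀ = j + 4 := by
    refine ⟨j₀ - 4, ?_⟩
    by_contra hlt
    have : 2 ^ l * (2 * j₀ + 1) ≤ 2 ^ l * 8 := Nat.mul_le_mul_left _ (by omega)
    omega
  have hj' : h + 1 + 4 = 2 ^ l * (2 * j + 9) := by
    rw [hlj]; ring
  have hj : h + 5 = 2 ^ l * (2 * j + 9) := by omega
  clear hlj
  obtain ⟨y, hy⟩ : ∃ y, j * 2 ^ l = y := ⟨_, rfl⟩
  have hjy : h + 5 = 2 * y + 9 * 2 ^ l := by rw [hj, ← hy]; ring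
  have hllog : l ≤ Nat.log 2 n := Nat.le_log_of_pow_le (by norm_num) (by omega)
  have hln := Nat.lt_two_pow_self (n := l)
  obtain ⟨hA₀, hA₁⟩ := made_merge hj
  obtain ⟨A, hA⟩ : ∃ A, Function.update (made h) 0 (h + 1) = A := ⟨_, rfl⟩
  rw [hA] at hready₁
  have hAj : A (l + 1) = j := by rw [← hA, Function.update_of_ne (by omega), hA₀]
  have hnarrow : Narrow A := hA ▸ narrow_update h
  obtain ⟨pre, post, hs₁, hs₂, hs₃⟩ := skel_update_merge (K := n + 5) hj (by omega)
  rw [hA] at hs₁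
  have hm₁ : (l, 2 * j + 1) ∈ skel A 0 (n + 5) := by rw [hs₁]; simp
  have hm₂ : (l, 2 * j + 2) ∈ skel A 0 (n + 5) := by rw [hs₁]; simp
  have ok₁ := hready₁.seg _ hm₁
  have ok₂ := hready₁.seg _ hm₂
  obtain ⟨q₁, hq₁⟩ : ∃ q, addr l (2 * j + 1) = q := ⟨_, rfl⟩
  obtain ⟨q₂, hq₂⟩ : ∃ q, addr l (2 * j + 2) = q := ⟨_, rfl⟩
  obtain ⟨q₀, hq₀⟩ : ∃ q, addr l (2 * j + 3) = q := ⟨_, rfl⟩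
  obtain ⟨qp, hqp⟩ : ∃ q, addr (l + 1) (j + 1) = q := ⟨_, rfl⟩
  have ha₁ : (2 * j + 1 - 1) * 2 ^ l + 1 = 2 * y + 1 := by
    rw [Nat.add_sub_cancel, ← hy]; ring
  have ha₂ : (2 * j + 2 - 1) * 2 ^ l + 1 = 2 * y + 1 + 2 ^ l := by
    rw [show 2 * j + 2 - 1 = 2 * j + 1 by omega, ← hy]; ring
  simp only [recAddr, hq₁, hq₂, ha₁, ha₂] at ok₁ ok₂
  have hsize : ∀ {q a e}, SegOK S T lg h M₁ q a l e → a + 2 ^ l ≤ n + 1 → M₁ (q + 2) = 5 →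
      M₁ (q + 3) < 2 ^ k ∧ M₁ (q + 4) < 2 ^ k := by
    intro q a e hs ha h5
    obtain ⟨g, d₁, d₂, d₃, d₄, d₅, -⟩ := hs.dense h5
    omega
  obtain ⟨M₂, t₂, hE₂, ht₂, hB₂, e0, e1, ep0, ep1, ep7, e7, hdesc, hf₂⟩ := exec_mergeProg (ans := ans)
    (s := s) (k := k) hB₁ (by omega) (by omega) (by omega) (by omega) g1 g2 g3 hj' hq₁.symm hq₂.symm
    hq₀.symm hqp.symm (by rw [ok₁.start]; omega) ok₁.tag ok₂.tag (hsize ok₁ (by omega))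
    (hsize ok₂ (by omega)) (by
      intro x hx
      rcases List.mem_append.1 hx with hx | hx
      · have := ok₁.mem x (ok₁.centers_mem x hx); omega
      · have := ok₂.mem x (ok₂.centers_mem x hx); omega)
  have hmerged : SegOK S T lg h M₂ qp (2 * y + 1) (l + 1) (h + 1) := by
    refine ok₁.merge ok₂ (fun k hk => ?_) (fun k hk => ?_) hb hbn ep0 ep1 hdesc
    · have := mature_of_merge (i := 0) hj hk hn (by norm_num)
      rwa [show (2 * j + 0) * 2 ^ l = 2 * y by rw [← hy]; ring] at this
    · have := mature_of_merge (i := 1) hj hk hn (by norm_num)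
      rwa [show (2 * j + 1) * 2 ^ l + 1 = 2 * y + 1 + 2 ^ l by rw [← hy]; ring] at this
  have hdisj : ∀ x ∈ skel A 0 (n + 5), recAddr x + 8 ≤ qp ∨ qp + 8 ≤ recAddr x := by
    intro x hx
    have hx' := mem_skel.1 hx
    rw [← hqp]
    apply addr_disjoint
    · by_contra hcon
      rw [not_or, not_not, not_not] at hcon
      rw [hcon.1, hcon.2, hAj] at hx'
      omega
    · intro e
      rw [e, hAj] at hx'
      have := hnarrow (l + 1)
      rw [hAj] at this
      omega
  have hsame : ∀ x ∈ skel A 0 (n + 5), ∀ i, i < 8 → (x ≠ (l, 2 * j + 3) ∨ i < 7) →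
      M₂ (recAddr x + i) = M₁ (recAddr x + i) := by
    intro x hx i hi hxi
    have h64 : 64 ≤ recAddr x := by unfold recAddr addr; omega
    have hd := hdisj x hx
    refine hf₂ _ (by omega) (by omega) ?_
    by_cases hx0 : x = (l, 2 * j + 3)
    · have : recAddr x = q₀ := by rw [hx0, ← hq₀]; rfl
      have := hxi.resolve_left fun h => h hx0
      omega
    · have := hnarrow.disjoint hx (y := (l, 2 * j + 3)) (by rw [hs₁]; simp) hx0
      have e : recAddr (l, 2 * j + 3) = q₀ := hq₀
      omega
  refine ⟨M₂, _, .seq _ _ _ _ _ _ _ [] [] hE₁ (.ite_false _ _ _ _ _ _ _ hfits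
      (by rw [heval, if_neg hcmp]) hE₂), by rw [hcost]; omega, by rw [e1, g1], hB₂, ?_, ?_⟩
  · have hc := hready₁.chain
    rw [hs₁, List.map_append, List.map_cons, List.map_cons, List.map_cons] at hc
    rw [hs₂, List.map_append, List.map_cons, List.map_cons, e0]
    have hnd := nodup_skel A 0 (n + 5)
    rw [hs₁, List.nodup_append] at hnd
    refine hc.splice (fun p hp => ?_) ?_
    · obtain ⟨x, hx, rfl⟩ := List.mem_map.1 hp
      refine hsame x (by rw [hs₁]; simp [hx]) 7 (by norm_num) (Or.inl ?_)
      exact hnd.2.2 x hx _ (by simp)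
    · have e : recAddr (l, 2 * j + 3) = q₀ := hq₀
      have ep : recAddr (l + 1, j + 1) = qp := hqp
      have eq : recAddr (l, 2 * j + 1) = q₁ := hq₁
      rw [e, e7]
      refine ⟨ep.symm, ?_⟩
      rw [ep, ep7, ← eq]
      have htail := hc.tail.2.2
      refine htail.congr fun p hp => ?_
      obtain ⟨x, hx, rfl⟩ := List.mem_map.1 hp
      refine hsame x (by rw [hs₁]; simp [hx]) 7 (by norm_num) (Or.inl ?_)
      have := hs₃ x hx
      rintro rfl
      omega
  · rw [hs₂]
    intro x hx
    have hx' : x = (l + 1, j + 1) ∨ x ∈ skel A 0 (n + 5) := by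
      rw [hs₁]
      simp only [List.mem_append, List.mem_cons] at hx ⊢
      tauto
    rcases hx' with rfl | hx'
    · have e₁ : (j + 1 - 1) * 2 ^ (l + 1) + 1 = 2 * y + 1 := by
        rw [Nat.add_sub_cancel, ← hy]; ring
      have e₂ : born (l + 1) (j + 1) = h + 1 := by
        have : (j + 1) * 2 ^ (l + 1) = 2 * y + 2 * 2 ^ l := by rw [← hy]; ring
        rw [born, this]; omega
      have ep : recAddr (l + 1, j + 1) = qp := hqp
      simp only [e₁, e₂, ep]
      exact hmerged
    · exact (hready₁.seg x hx').congr_mem fun i hi => hsame x hx' i (by omega) (Or.inr hi)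

end

/-! ### A step of the program -/

section

variable {α : Type*} {n : ℕ} {S : LandmarkScheme n} {T : ℕ → α} {lg lg' : ℕ → List ℕ} {h : ℕ}
  {M : Memory} {w s : ℕ} {ans : ℕ → ℕ}

lemma exists_mem_of_covers {D : List Segment} {c : ℕ} (hD : Covers h D) (hc : 1 ≤ c)
    (hch : c ≤ h) : ∃ s ∈ D, s.start ≤ c ∧ c < s.start + s.len := by
  induction D generalizing h with
  | nil =>
    have : h = 0 := hD
    omega
  | cons s D ih =>
    obtain ⟨h₁, h₂, h₃⟩ := hD
    by_cases hcs : s.start ≤ c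
    · exact ⟨s, by simp, hcs, by omega⟩
    · obtain ⟨s', hs', h'⟩ := ih h₃ (by omega)
      exact ⟨s', by simp [hs'], h'⟩

lemma covers_made (d : ℕ → ℕ → Description) (hn : h ≤ n) :
    Covers h ((skel (made h) 0 (n + 5)).map (mkSegment d)) := by
  have := covers_skel d (fun l => (made_bounds h l).1) (l := 0) (K := n + 5)
    (made_eq_zero (by omega))
  simpa [made] using this

lemma mem_skel_made {x : ℕ × ℕ} (hx : x ∈ skel (made h) 0 (n + 5)) (hn : h ≤ n) :
    1 ≤ x.2 ∧ (x.2 - 1) * 2 ^ x.1 + 2 ^ x.1 ≤ h ∧ born x.1 x.2 ≤ h ∧ x.1 ≤ Nat.log 2 n + 1 := by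
  obtain ⟨-, -, h₁, h₂⟩ := mem_skel.1 hx
  have h₃ : x.2 * 2 ^ x.1 ≤ h := (Nat.mul_le_mul_right _ h₂).trans (made_mul_le h x.1)
  refine ⟨by omega, ?_, (le_made_iff (by omega)).1 h₂, level_le_log hn (by omega)⟩
  rwa [← Nat.succ_mul, Nat.succ_eq_add_one, Nat.sub_add_cancel (by omega)]

/-- The processes that have succeeded since step `e` among the relevant ones of the segment with the
record at address `r`. -/
def Succeeded (S : LandmarkScheme n) (T : ℕ → α) (h : ℕ) (M : Memory) (e r : ℕ) (x : ℕ) : Prop :=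
  x ∈ runs M r ∧ ∃ t, e ≤ t ∧ t ≤ h ∧ Succeeds S T t x

/-- At most four processes are removed, as none is removed from a dense segment. -/
lemma BlockStep.length_runs_le {P : ℕ → Prop} {M' : Memory} {q : ℕ} (h : BlockStep ans P M M' q)
    (hq : M (q + 2) ≤ 5) : (runs M q).length ≤ (runs M' q).length + 4 := by
  obtain ⟨b₀, b₁, -, bd, bs⟩ := h
  by_cases h5 : M (q + 2) = 5
  · obtain ⟨c₂, c₃, c₄, -⟩ := bd h5
    have hr : runs M' q = runs M q := by
      rw [runs, runs, if_pos h5, if_pos c₂, b₀, b₁, c₃, c₄]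
    rw [hr]; omega
  · rw [runs, if_neg h5, length_cells]; omega

lemma Ready.run (hr : Ready S T w (made (h + 1)) lg h M)
    (hs : 1000 * (Nat.log 2 n + 1) ≤ s) (hsw : s ≤ w) (hw : 10 * n ≤ w) (hn : h + 1 ≤ n) :
    ∃ M' t L, Exec (runAnswer S T (h + 1)) s w runProg M M' t L ∧
      t ≤ 70 * L.length + 1000 * (Nat.log 2 n + 1) ∧ M' 1 = M 1 ∧
      Ready S T w (made (h + 1)) (Function.update lg (h + 1) L) (h + 1) M' ∧
      (∀ c, 1 ≤ c → c ≤ h + 1 → ¬ Dead S T lg h c → c ∈ L) ∧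
      L.length ≤ ((skel (made (h + 1)) 0 (n + 5)).map fun x =>
        (runs M' (recAddr x)).length + 4).sum := by
  classical
  obtain ⟨X, hX⟩ : ∃ X, skel (made (h + 1)) 0 (n + 5) = X := ⟨_, rfl⟩
  have hlen := length_skel_le_log hn
  have hpair := (narrow_made (h + 1)).pairwise (n + 5)
  rw [hX] at hlen hpair
  have hinj : ∀ x ∈ X, ∀ y ∈ X, recAddr x = recAddr y → x = y := by
    intro x hx y hy hxy
    rw [← hX] at hx hy
    by_contra hne
    have := (narrow_made (h + 1)).disjoint hx hy hne
    omega
  -- the step in which the segment with the record at address `r` was created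
  obtain ⟨e, he⟩ : ∃ e : ℕ → ℕ, ∀ x ∈ X, e (recAddr x) = born x.1 x.2 := by
    refine ⟨fun r => if hr : ∃ x ∈ X, recAddr x = r then born hr.choose.1 hr.choose.2 else 0,
      fun x hx => ?_⟩
    have hex : ∃ y ∈ X, recAddr y = recAddr x := ⟨x, hx, rfl⟩
    have := hinj _ hex.choose_spec.1 x hx hex.choose_spec.2
    simp only [dif_pos hex, this]
  obtain ⟨M', t, hE, ht, hB, hb, hf⟩ := exec_runProg (ans := runAnswer S T (h + 1)) (s := s) (w := w)
    (P := fun r => Succeeded S T h M (e r) r) (runAnswer_le S T (h + 1)) hsw (by omega) hr.bounded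
    hr.chain (by
      rw [hX]
      intro r hrX
      obtain ⟨x, hx, rfl⟩ := List.mem_map.1 hrX
      rw [he x hx]
      rw [← hX] at hx
      have ok := hr.seg x hx
      obtain ⟨p₁, p₂, -, p₄⟩ := mem_skel_made hx hn
      have hpos : 0 < 2 ^ x.1 := by positivity
      have hq : 64 ≤ recAddr x ∧ recAddr x + 8 ≤ 64 * x.1 + 128 := by unfold recAddr addr; omega
      refine ⟨hq.1, by omega, ok.tag, fun h5 => ?_⟩
      obtain ⟨g, d₁, d₂, d₃, d₄, d₅, -, d₇⟩ := ok.dense h5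
      refine ⟨g, d₁, d₂, by omega, ?_, d₇⟩
      rw [ok.start, ok.len]
      omega) (by rw [hX]; exact hpair)
  rw [hX] at hb hE ht hf
  have hflat : (X.map recAddr).flatMap (runs M) = X.flatMap fun x => runs M (recAddr x) := by
    rw [List.flatMap_map]
  rw [hflat] at hE ht
  obtain ⟨L, hL⟩ : ∃ L, (X.flatMap fun x => runs M (recAddr x)) = L := ⟨_, rfl⟩
  rw [hL] at hE ht
  have hmemL : ∀ x ∈ X, ∀ c ∈ runs M (recAddr x), c ∈ L := fun x hx c hc => by
    rw [← hL]; exact List.mem_flatMap.2 ⟨x, hx, hc⟩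
  have hb' : ∀ x ∈ X, BlockStep (runAnswer S T (h + 1))
      (Succeeded S T h M (born x.1 x.2) (recAddr x)) M M' (recAddr x) := fun x hx => by
    rw [← he x hx]; exact hb _ (List.mem_map_of_mem hx)
  have h64 : ∀ r ∈ X.map recAddr, 64 ≤ r := by
    intro r hrX
    obtain ⟨x, hx, rfl⟩ := List.mem_map.1 hrX
    unfold recAddr addr; omega
  have hlow : ∀ b, b < 4 → M' b = M b := fun b hb => hf b (Or.inl hb) fun r hrX => by
    have := h64 r hrX; omega
  refine ⟨M', t, L, hE, ?_, hlow 1 (by norm_num), ⟨hB, ?_, ?_⟩, ?_, ?_⟩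
  · rw [List.length_map] at ht; omega
  · rw [hlow 0 (by norm_num), hX]
    have hc := hr.chain
    rw [hX] at hc
    refine hc.congr fun r hrX => ?_
    obtain ⟨x, hx, rfl⟩ := List.mem_map.1 hrX
    exact (hb' x hx).2.2.1
  · rw [hX]
    intro x hx
    have hx' := hx
    rw [← hX] at hx'
    refine (hr.seg x hx').step (mem_skel_made hx' hn).2.2.1 (hb' x hx)
      (fun t ht => Function.update_of_ne (by omega) _ _) fun c hc => ?_
    rw [Function.update_self]
    exact hmemL x hx c hc
  · intro c hc hch hdead
    obtain ⟨sg, hs, h₁, h₂⟩ := exists_mem_of_covers (covers_made (fun _ _ => .sparse []) hn) hc hch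
    rw [hX] at hs
    obtain ⟨x, hx, rfl⟩ := List.mem_map.1 hs
    have hx' := hx
    rw [← hX] at hx'
    refine hmemL x hx c ?_
    by_contra hcr
    exact hdead ((hr.seg x hx').dead c h₁ h₂ hcr)
  · rw [hX, ← hL, List.length_flatMap]
    apply List.sum_le_sum
    intro x hx
    have hx' := hx
    rw [← hX] at hx'
    exact (hb' x hx).length_runs_le (hr.seg x hx').tag

/-- The program that is executed in every step. -/
def stepProg : Program := appendProg ;; updateProg ;; runProg

lemma Ready.step (hr : Ready S T w (made h) lg h M)
    (hs : 1000 * (Nat.log 2 n + 1) ≤ s) (hw : 2 * s + 4000 * n ≤ w)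
    (hb : ∀ l, l ≤ S.L → 12 ≤ S.b l) (hbn : (n : ℕ∞) ≤ S.b S.L * 2 ^ S.L) (hn : h + 1 ≤ n)
    (h1 : M 1 = h) :
    ∃ M' t L, Exec (runAnswer S T (h + 1)) s w stepProg M M' t L ∧
      t ≤ 70 * L.length + 40000 * (Nat.log 2 n + 1) ∧ M' 1 = h + 1 ∧
      Ready S T w (made (h + 1)) (Function.update lg (h + 1) L) (h + 1) M' ∧
      (∀ c, 1 ≤ c → c ≤ h + 1 → ¬ Dead S T lg h c → c ∈ L) ∧
      L.length ≤ ((skel (made (h + 1)) 0 (n + 5)).map fun x =>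
        (runs M' (recAddr x)).length + 4).sum := by
  obtain ⟨M₁, t₁, hE₁, ht₁, g₁, hr₁⟩ := hr.append (ans := runAnswer S T (h + 1)) (s := s)
    (by omega) (by omega) h1
  obtain ⟨M₂, t₂, hE₂, ht₂, g₂, hr₂⟩ := hr₁.update (ans := runAnswer S T (h + 1)) (s := s)
    (by omega) hw hb hbn hn g₁
  obtain ⟨M₃, t₃, L, hE₃, ht₃, g₃, hr₃⟩ := hr₂.run hs (by omega) (by omega) hn
  exact ⟨M₃, _, L, by
    simpa [stepProg] using Exec.seq _ _ _ _ _ _ _ _ _ hE₁ (.seq _ _ _ _ _ _ _ _ _ hE₂ hE₃),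
    by omega, by rw [g₃, g₂], hr₃⟩

/-! ### The descriptions in the memory -/

/-- The description in the record at address `q`. -/
def descAt (M : Memory) (q : ℕ) : Description :=
  if M (q + 2) = 5 then .dense (M (q + 3)) (M (q + 4)) else .sparse (cells M (q + 3) (M (q + 2)))

/-- The segment `x`, which is given by its level and its number, with the description in the
memory. -/
def segAt (M : Memory) (x : ℕ × ℕ) : Segment := mkSegment (fun l k => descAt M (addr l k)) x

lemma SegOK.storedAt {x : ℕ × ℕ} {e : ℕ}
    (hs : SegOK S T lg h M (recAddr x) ((x.2 - 1) * 2 ^ x.1 + 1) x.1 e) :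
    (segAt M x).StoredAt M (recAddr x) := by
  have htag := hs.tag
  refine ⟨hs.start, hs.len, ?_⟩
  change match descAt M (recAddr x) with
    | .sparse l => _
    | .dense c p => _
  unfold descAt
  by_cases h5 : M (recAddr x + 2) = 5
  · rw [if_pos h5]
    exact ⟨h5, rfl, rfl⟩
  · rw [if_neg h5]
    exact ⟨by rw [length_cells]; omega, by rw [length_cells], arrayAt_iff.2 (by rw [length_cells])⟩

lemma SegOK.mem_relevant {x : ℕ × ℕ} {e : ℕ}
    (hs : SegOK S T lg h M (recAddr x) ((x.2 - 1) * 2 ^ x.1 + 1) x.1 e) {c : ℕ} :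
    c ∈ (segAt M x).relevant ↔ c ∈ runs M (recAddr x) := by
  unfold Segment.relevant
  change c ∈ (match descAt M (recAddr x) with
    | .sparse l => l.toFinset
    | .dense c p => _) ↔ _
  unfold descAt
  by_cases h5 : M (recAddr x + 2) = 5
  · obtain ⟨g, d₁, d₂, d₃, d₄, d₅, -⟩ := hs.dense h5
    rw [if_pos h5, mem_runs_dense h5 d₁ d₂ hs.start hs.len rfl d₅ d₄]
    simp only [Finset.mem_filter, Finset.mem_Ico, d₂, Nat.mul_div_cancel_left _ (show 0 < 2 by
      norm_num), segAt, mkSegment]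
    rw [and_assoc]
    refine and_congr_right fun h₁ => and_congr_right fun h₂ => ⟨?_, ?_⟩
    · rintro ⟨i, rfl⟩
      exact ⟨i, by push_cast; ring⟩
    · rintro ⟨i, hi⟩
      have hi0 : 0 ≤ i := by
        by_contra hneg
        have : (g : ℤ) * i ≤ (g : ℤ) * (-1) := mul_le_mul_of_nonneg_left (by omega) (by omega)
        omega
      obtain ⟨i, rfl⟩ := Int.eq_ofNat_of_zero_le hi0
      refine ⟨i, ?_⟩
      zify; rw [mul_comm (i : ℤ)]; omega
  · rw [if_neg h5, runs, if_neg h5, List.mem_toFinset]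

lemma SegOK.nodup_runs {q a l e : ℕ} (hs : SegOK S T lg h M q a l e) : (runs M q).Nodup := by
  by_cases h5 : M (q + 2) = 5
  · obtain ⟨g, d₁, d₂, -⟩ := hs.dense h5
    rw [runs, if_pos h5, d₂, Nat.mul_div_cancel_left _ (by norm_num)]
    refine List.nodup_range.map fun i j hij => ?_
    exact Nat.eq_of_mul_eq_mul_right d₁ (Nat.add_left_cancel hij)
  · exact (hs.sparse h5).1

lemma SegOK.card_relevant {x : ℕ × ℕ} {e : ℕ}
    (hs : SegOK S T lg h M (recAddr x) ((x.2 - 1) * 2 ^ x.1 + 1) x.1 e) :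
    (segAt M x).relevant.card = (runs M (recAddr x)).length := by
  rw [← List.toFinset_card_of_nodup hs.nodup_runs]
  congr 1
  ext c
  rw [hs.mem_relevant, List.mem_toFinset]

lemma SegOK.wellFormed {x : ℕ × ℕ} {e : ℕ}
    (hs : SegOK S T lg h M (recAddr x) ((x.2 - 1) * 2 ^ x.1 + 1) x.1 e) :
    (segAt M x).WellFormed T := by
  have htag := hs.tag
  by_cases h5 : M (recAddr x + 2) = 5
  · obtain ⟨g, d₁, d₂, d₃, d₄, d₅, d₆, -⟩ := hs.dense h5
    have := d₆.wellFormed d₁ d₃ d₄ d₅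
    have e : segAt M x = ⟨(x.2 - 1) * 2 ^ x.1 + 1, 2 ^ x.1, .dense (M (recAddr x + 3)) (2 * g)⟩ := by
      rw [← d₂]
      simp only [segAt, mkSegment, descAt]
      rw [if_pos (show M (addr x.1 x.2 + 2) = 5 from h5)]
      rfl
    rw [e]
    exact this
  · have hr : runs M (recAddr x) = cells M (recAddr x + 3) (M (recAddr x + 2)) := by
      rw [runs, if_neg h5]
    have e : segAt M x = ⟨(x.2 - 1) * 2 ^ x.1 + 1, 2 ^ x.1, .sparse (runs M (recAddr x))⟩ := by
      rw [hr]
      simp only [segAt, mkSegment, descAt]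
      rw [if_neg (show ¬ M (addr x.1 x.2 + 2) = 5 from h5)]
      rfl
    rw [e]
    refine ⟨?_, (hs.sparse h5).1, hs.mem⟩
    rw [hr, length_cells]
    omega

lemma storedList_of_chain {X : List (ℕ × ℕ)} {q : ℕ} (hc : Chain M q (X.map recAddr))
    (hX : ∀ x ∈ X, (segAt M x).StoredAt M (recAddr x)) : StoredList M q (X.map (segAt M)) := by
  induction X generalizing q with
  | nil => exact hc
  | cons x X ih =>
    obtain ⟨h₁, h₂⟩ := List.forall_mem_cons.1 hX
    have hq : q = recAddr x := hc.1
    subst hq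
    refine ⟨?_, h₁, ih hc.2 h₂⟩
    unfold recAddr addr
    omega

/-! ### The computation -/

lemma lens_segAt (X : List (ℕ × ℕ)) : (X.map (segAt M)).map Segment.len = lens X := by
  rw [List.map_map]; rfl

lemma partitionStep_made (hn : h + 1 ≤ n) : PartitionStep (lens (skel (made h) 0 (n + 5)))
    (lens (skel (made (h + 1)) 0 (n + 5))) := by
  have hsk := skel_append_segment (A := made h) (A' := Function.update (made h) 0 (h + 1))
    (by simp [made]) (fun l => by simp) (made_bounds h 0).1 (n + 4)
  have hone : lens (skel (Function.update (made h) 0 (h + 1)) 0 (n + 5)) =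
      1 :: lens (skel (made h) 0 (n + 5)) := by
    rw [show n + 5 = n + 4 + 1 from rfl, hsk]; simp [lens]
  by_cases hm : ∃ l j, h + 5 = 2 ^ l * (2 * j + 9)
  · right
    obtain ⟨l, j, hj⟩ := hm
    have hl : l < 2 ^ l := Nat.lt_two_pow_self
    have hle : 2 ^ l * 9 ≤ 2 ^ l * (2 * j + 9) := Nat.mul_le_mul_left _ (by omega)
    obtain ⟨pre, post, hs₁, hs₂, hs₃⟩ := skel_update_merge (K := n + 5) hj (by omega)
    refine ⟨lens (pre ++ [(l, 2 * j + 3)]), lens post, l, ?_, ?_, ?_⟩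
    · rw [← hone, hs₁]; simp [lens]
    · intro x hx
      obtain ⟨y, hy, rfl⟩ := List.mem_map.1 (List.mem_of_mem_head? hx)
      exact Nat.pow_lt_pow_right (by norm_num) (hs₃ y hy)
    · rw [hs₂]; simp [lens]
  · left
    rw [← update_made_eq hm, hone]

lemma Ready.congr_log (hr : Ready S T w (made h) lg h M) (hl : ∀ t, t ≤ h → lg' t = lg t) :
    Ready S T w (made h) lg' h M :=
  ⟨hr.bounded, hr.chain, fun x hx => (hr.seg x hx).congr_log hl⟩

/-- The computation, step by step. The number of runs exceeds the number of relevant processes by at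
most `4` for each segment. -/
lemma exists_computation (T : ℕ → α) (hb : ∀ l, l ≤ S.L → 12 ≤ S.b l)
    (hbn : (n : ℕ∞) ≤ S.b S.L * 2 ^ S.L) (hs : 1000 * (Nat.log 2 n + 1) ≤ s)
    (hw : 2 * s + 4000 * n ≤ w) {N : ℕ} (hN : N ≤ n) :
    ∃ (mem : ℕ → Memory) (log : ℕ → List ℕ) (time : ℕ → ℕ), mem 0 = (fun _ => 0) ∧
      ∀ h, h ≤ N → mem h 1 = h ∧ Ready S T w (made h) log h (mem h) ∧ (1 ≤ h →
        Exec (runAnswer S T h) s w stepProg (mem (h - 1)) (mem h) (time h) (log h) ∧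
        time h ≤ 70 * (log h).length + 40000 * (Nat.log 2 n + 1) ∧
        (∀ c, 1 ≤ c → c ≤ h → ¬ Dead S T log (h - 1) c → c ∈ log h) ∧
        (log h).length ≤ ((skel (made h) 0 (n + 5)).map fun x =>
          (runs (mem h) (recAddr x)).length + 4).sum) := by
  induction N with
  | zero =>
    refine ⟨fun _ _ => 0, fun _ => [], fun _ => 0, rfl, fun h hh => ?_⟩
    obtain rfl : h = 0 := by omega
    exact ⟨rfl, ready_zero S T w _, fun h => by omega⟩
  | succ N ih =>
    obtain ⟨mem, log, time, h0, hind⟩ := ih (by omega)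
    obtain ⟨h1, hr, -⟩ := hind N le_rfl
    obtain ⟨M', t, L, hE, ht, h1', hr', halive, hlen⟩ := hr.step hs hw hb hbn hN h1
    refine ⟨Function.update mem (N + 1) M', Function.update log (N + 1) L,
      Function.update time (N + 1) t, by rw [Function.update_of_ne (by omega), h0],
      fun h hh => ?_⟩
    rcases Nat.lt_or_ge N h with hlt | hle
    · obtain rfl : h = N + 1 := by omega
      simp only [Function.update_self, Nat.add_sub_cancel,
        Function.update_of_ne (show N ≠ N + 1 by omega)]
      refine ⟨h1', hr', fun _ => ⟨hE, ht, fun c hc hc' hd => halive c hc hc' fun hd' => hd ?_,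
        hlen⟩⟩
      exact dead_mono hd' le_rfl fun t ht => Function.update_of_ne (by omega) _ _
    · obtain ⟨i₁, i₂, i₃⟩ := hind h hle
      simp only [Function.update_of_ne (show h ≠ N + 1 by omega),
        Function.update_of_ne (show h - 1 ≠ N + 1 by omega)]
      refine ⟨i₁, i₂.congr_log fun t ht => Function.update_of_ne (by omega) _ _, fun hh => ?_⟩
      obtain ⟨j₁, j₂, j₃, j₄⟩ := i₃ hh
      refine ⟨j₁, j₂, fun c hc hc' hd => j₃ c hc hc' fun hd' => hd ?_, j₄⟩
      exact dead_mono hd' le_rfl fun t ht => Function.update_of_ne (by omega) _ _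

end

end PalSegments

open PalSegments in
theorem mainTheorem4 :
    ∃ (prog : Program) (C : ℕ),
      ∀ (n : ℕ) (S : LandmarkScheme n),
        (∀ l, l ≤ S.L → 12 ≤ S.b l) →
        -- the last level covers the whole text
        (n : ℕ∞) ≤ S.b S.L * 2 ^ S.L →
        ∀ {α : Type*} (T : ℕ → α),
        ∃ (mem : ℕ → Memory) (log : ℕ → List ℕ) (time : ℕ → ℕ) (D : ℕ → List Segment),
          (∀ a, mem 0 a = 0) ∧ D 0 = [] ∧
          ∀ h, 1 ≤ h → h ≤ n →
            -- step `h` of the program, in `C (log n + 1)` words of memory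
            Exec (runAnswer S T h) (C * (Nat.log 2 n + 1)) (C * n) prog
              (mem (h - 1)) (mem h) (time h) (log h) ∧
            -- the memory holds the segments with their descriptions; cell `0` points to them
            StoredList (mem h) (mem h 0) (D h) ∧
            -- the segments form a partition scheme
            Covers h (D h) ∧
            ValidLengths ((D h).map Segment.len) ∧
            PartitionStep ((D (h - 1)).map Segment.len) ((D h).map Segment.len) ∧
            -- the descriptions are correct
            (∀ s ∈ D h, s.WellFormed T ∧
              (∀ c, s.start ≤ c → c < s.start + s.len → c ∉ s.relevant →
                Dead S T log h c) ∧
              -- a process whose run fails leaves a sparse description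
              (∀ l, s.desc = .sparse l → ∀ c ∈ l, ¬ Fails S T h c) ∧
              -- all relevant processes are run
              (∀ c ∈ s.relevant, c ∈ log h)) ∧
            -- all alive processes are run
            (∀ c, 1 ≤ c → c ≤ h → ¬ Dead S T log (h - 1) c → c ∈ log h) ∧
            -- the time
            time h ≤ C * (Nat.log 2 n + 1 + ((D h).map (fun s => s.relevant.card)).sum) := by
  refine ⟨stepProg, 100000, fun n S hb hbn α T => ?_⟩
  have hlog : Nat.log 2 n + 1 ≤ n := by
    have hn : 0 < n := lt_of_lt_of_le (by positivity) S.L_le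
    have := Nat.pow_log_le_self 2 (x := n) (by omega)
    have := Nat.lt_two_pow_self (n := Nat.log 2 n)
    omega
  -- fewer cells are used than granted: their number has to be small in comparison with the word size
  obtain ⟨mem, log, time, h0, hind⟩ := exists_computation (s := 1000 * (Nat.log 2 n + 1))
    (w := 100000 * n) T hb hbn le_rfl (by omega) (le_refl n)
  refine ⟨mem, log, time, fun h => (skel (made h) 0 (n + 5)).map (segAt (mem h)), fun a => by
    rw [h0], by simp only [skel_made_zero, List.map_nil], fun h h1 hn => ?_⟩
  obtain ⟨-, hr, hstep⟩ := hind h hn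
  obtain ⟨hE, ht, halive, hlen⟩ := hstep h1
  refine ⟨exec_mono (by omega) le_rfl hE, storedList_of_chain hr.chain fun x hx =>
    (hr.seg x hx).storedAt, covers_made (fun l k => descAt (mem h) (addr l k)) hn, ?_, ?_, ?_, halive, ?_⟩
  · rw [lens_segAt]
    exact validLengths_skel h1 (by omega)
  · rw [lens_segAt, lens_segAt]
    obtain ⟨h, rfl⟩ : ∃ h', h = h' + 1 := ⟨h - 1, by omega⟩
    exact partitionStep_made hn
  · intro s hs
    obtain ⟨x, hx, rfl⟩ := List.mem_map.1 hs
    have ok := hr.seg x hx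
    have hborn := (mem_skel_made hx hn).2.2.1
    refine ⟨ok.wellFormed, fun c hc hc' hcr => ok.dead c hc hc' fun h => hcr (ok.mem_relevant.2 h),
      fun l hl c hc => ?_, fun c hc => ok.run c (ok.mem_relevant.1 hc) h hborn le_rfl⟩
    have hcr : c ∈ runs (mem h) (recAddr x) := by
      rw [← ok.mem_relevant, Segment.relevant, hl]
      exact List.mem_toFinset.2 hc
    refine (ok.sparse fun h5 => ?_).2 c hcr h hborn le_rfl
    have : descAt (mem h) (recAddr x) = .sparse l := hl
    rw [descAt, if_pos h5] at this
    cases this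
  · have hsum : ((skel (made h) 0 (n + 5)).map fun x =>
        (runs (mem h) (recAddr x)).length + 4).sum =
        (((skel (made h) 0 (n + 5)).map (segAt (mem h))).map fun s => s.relevant.card).sum +
          4 * (skel (made h) 0 (n + 5)).length := by
      rw [List.map_map, List.sum_map_add]
      congr 1
      · congr 1
        apply List.map_congr_left
        intro x hx
        exact ((hr.seg x hx).card_relevant).symm
      · simp [mul_comm]
    have hlen' := length_skel_le_log hn
    dsimp only
    omega
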